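/- Let $n\ge 2$, let $M$ be a non-empty closed smooth manifold, let $\xi$ be a smooth real vector bundle of rank $n$ over $M$ with total space $E$ and a smooth fibre metric, and let $g_M$ be a Riemannian metric on $M$ with positive Ricci curvature. Let $B(\xi)=\{v\in E:|v|\le 1\}$ be the disc bundle, and let $D(\xi,M)=B(\xi)\sqcup_{\mathrm{id}}B(\xi)$ be the double manifold: two copies of $B(\xi)$ glued by the identity of the boundary $S(\xi)$, with the smooth structure given by the collars $(u,t)\mapsto e^{-t}u$ of $S(\xi)$. Then $D(\xi,M)$ admits a Riemannian metric with positive Ricci curvature and, for the same metric, a natural isoparametric foliation. More precisely, there is a smooth connection $\nabla$ on $\xi$ compatible with the fibre metric for which the following holds. Let $h$ be the connection metric on $E$, i.e. the Riemannian metric with $$h(Z,Z)=g_M(X,X)+|\nabla_X\sigma+w|^2\qquad\text{for } Z=d\sigma(X)+(\text{vertical lift of }w),$$ where $\sigma$ is a section of $\xi$ differentiable at $p\in M$, $X\in T_pM$ and $w\in\xi_p$. Give the total space $E\times\mathbb R$ of $\xi\oplus\mathbf 1$ the metric $h+dt^2$, and for $r>0$ let $$S_r(\xi\oplus\mathbf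 1)=\{(v,t)\in E\times\mathbb R:\ |v|^2+t^2=r^2\}.$$ Then there is $r_0>0$ such that for every $0<r<r_0$: 1. The map $\Phi_r:D(\xi,M)\to E\times\mathbb R$ given by $v\mapsto\left(\frac{2r\,v}{1+|v|^2},\ \pm r\,\frac{1-|v|^2}{1+|v|^2}\right)$, with sign $+$ on the first and $-$ on the second copy of $B(\xi)$, is a diffeomorphism onto the sphere bundle $S_r(\xi\oplus\mathbf 1)$ (a smooth embedding with this image). 2. The metric $g=\Phi_r^*(h+dt^2)$ on $D(\xi,M)$ has positive Ricci curvature. 3. The last fibre coordinate $f=t\circ\Phi_r$ is an isoparametric function on $(D(\xi,M),g)$: it is smooth and non-constant, $|\nabla f|^2=b(f)$ for a smooth function $b:\mathbb R\to\mathbb R$, and $\Delta f=a(f)$ for a function $a:\mathbb R\to\mathbb R$. The isoparametric foliation is the family of the level sets of $f$. -/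

import Mathlib

set_option maxSynthPendingDepth 3

open Manifold Set Topology
open Bundle (TotalSpace ContMDiffRiemannianMetric)
open scoped ContDiff

noncomputable section

/-! ### Riemannian geometry in charts -/

section Coordinates

variable {E : Type*} [NormedAddCommGroup E] [NormedSpace ℝ E]

/-- The Christoffel symbols of the first kind of a metric `G` given on an open set of `E`,
`Γ(u, v, w) = (∂_u G(v, w) + ∂_v G(u, w) - ∂_w G(u, v)) / 2`. -/
def christoffelFirst (G : E → E →L[ℝ] E →L[ℝ] ℝ) (y : E) : E →L[ℝ] E →L[ℝ] E →L[ℝ] ℝ :=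
  let D : E →L[ℝ] E →L[ℝ] E →L[ℝ] ℝ := fderiv ℝ G y
  let T : E →L[ℝ] E →L[ℝ] E →L[ℝ] ℝ :=
    (ContinuousLinearMap.flipₗᵢ ℝ E E ℝ).toContinuousLinearEquiv.toContinuousLinearMap ∘L D.flip
  (1 / 2 : ℝ) • (D + D.flip - T)

/-- The Christoffel symbols of the second kind, `G(Γ(u, v), w) = Γ(u, v, w)`. -/
def christoffel (G : E → E →L[ℝ] E →L[ℝ] ℝ) (y : E) : E →L[ℝ] E →L[ℝ] E :=
  (ContinuousLinearMap.compL ℝ E (E →L[ℝ] ℝ) E (G y).inverse) ∘L christoffelFirst G y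

/-- For fixed `v, w`, the endomorphism `u ↦ R(u, v) w`, where `R` is the curvature tensor
`R(u, v) w = ∂_u Γ(v, w) - ∂_v Γ(u, w) + Γ(u, Γ(v, w)) - Γ(v, Γ(u, w))`. -/
def curvatureEnd (G : E → E →L[ℝ] E →L[ℝ] ℝ) (y v w : E) : E →L[ℝ] E :=
  ((fderiv ℝ (christoffel G) y).flip v).flip w - (fderiv ℝ (christoffel G) y v).flip w +
    (christoffel G y).flip (christoffel G y v w) -
    (christoffel G y v) ∘L ((christoffel G y).flip w)

/-- The Ricci tensor `Ric(v, w) = tr (u ↦ R(u, v) w)`. -/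
def ricciCoord (G : E → E →L[ℝ] E →L[ℝ] ℝ) (y v w : E) : ℝ :=
  LinearMap.trace ℝ E (curvatureEnd G y v w : E →ₗ[ℝ] E)

/-- The Hessian `Hess f(u, v) = ∂_u ∂_v f - df(Γ(u, v))`. -/
def hessianCoord (G : E → E →L[ℝ] E →L[ℝ] ℝ) (f : E → ℝ) (y : E) : E →L[ℝ] E →L[ℝ] ℝ :=
  fderiv ℝ (fderiv ℝ f) y -
    (ContinuousLinearMap.compL ℝ E E ℝ (fderiv ℝ f y)) ∘L (christoffel G y)

/-- The Laplacian, the `G`-trace of the Hessian. -/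
def laplacianCoord (G : E → E →L[ℝ] E →L[ℝ] ℝ) (f : E → ℝ) (y : E) : ℝ :=
  LinearMap.trace ℝ E ((G y).inverse ∘L hessianCoord G f y : E →L[ℝ] E)

/-- The gradient of `f`: the vector `u` with `G(u, ·) = df`. -/
def gradientCoord (G : E → E →L[ℝ] E →L[ℝ] ℝ) (f : E → ℝ) (y : E) : E :=
  (G y).inverse (fderiv ℝ f y)

end Coordinates

section Riemannian

variable {E : Type*} [NormedAddCommGroup E] [NormedSpace ℝ E]
  {H : Type*} [TopologicalSpace H]

/-- Smooth Riemannian metrics on a smooth manifold. -/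
abbrev SmoothMetric (I : ModelWithCorners ℝ E H) (N : Type*) [TopologicalSpace N]
    [ChartedSpace H N] [IsManifold I ∞ N] : Type _ :=
  ContMDiffRiemannianMetric I ∞ E (fun x : N ↦ TangentSpace I x)

variable {I : ModelWithCorners ℝ E H} {N : Type*} [TopologicalSpace N]
    [ChartedSpace H N] [IsManifold I ∞ N]

/-- The metric coefficients in the chart `e`: the pull-back of `g` under the inverse of `e`. -/
def metricInChart (g : SmoothMetric I N) (e : OpenPartialHomeomorph N H) (y : E) :
    E →L[ℝ] E →L[ℝ] ℝ :=
  let L : E →L[ℝ] TangentSpace I ((e.extend I).symm y) := mfderiv 𝓘(ℝ, E) I (e.extend I).symm y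
  (ContinuousLinearMap.precomp ℝ L) ∘L (g.inner ((e.extend I).symm y) ∘L L)

/-- Positive Ricci curvature (of a manifold without boundary): the Ricci tensor is positive definite
at every point, computed in the charts of the atlas. -/
def HasPosRicci (g : SmoothMetric I N) : Prop :=
  ∀ e ∈ atlas H N, ∀ y ∈ (e.extend I).target, ∀ v : E, v ≠ 0 →
    0 < ricciCoord (metricInChart g e) y v v

/-- A non-constant smooth function `f` is isoparametric if `|∇f|² = b(f)` for a smooth function `b`
and `Δf = a(f)` for a function `a`. -/
def IsIsoparametric (g : SmoothMetric I N) (f : N → ℝ) : Prop :=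
  ContMDiff I 𝓘(ℝ, ℝ) ∞ f ∧ (∃ x x', f x ≠ f x') ∧
  (∃ b : ℝ → ℝ, ContDiff ℝ ∞ b ∧ ∀ e ∈ atlas H N, ∀ y ∈ (e.extend I).target,
    metricInChart g e y (gradientCoord (metricInChart g e) (f ∘ (e.extend I).symm) y)
      (gradientCoord (metricInChart g e) (f ∘ (e.extend I).symm) y) =
        b (f ((e.extend I).symm y))) ∧
  (∃ a : ℝ → ℝ, ∀ e ∈ atlas H N, ∀ y ∈ (e.extend I).target,
    laplacianCoord (metricInChart g e) (f ∘ (e.extend I).symm) y = a (f ((e.extend I).symm y)))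

end Riemannian

/-! ### The double of a disc bundle -/

section Double

variable {B : Type*} (F : Type*) (V : B → Type*) [∀ x, NormedAddCommGroup (V x)]

/-- The disc bundle `B(ξ)` of a vector bundle with a fibre metric. -/
abbrev DiscBundle : Type _ := {v : TotalSpace F V // ‖v.2‖ ≤ 1}

/-- Boundary points of the two copies of the disc bundle are identified. -/
inductive DoubleRel : Bool × DiscBundle F V → Bool × DiscBundle F V → Prop
  | glue (s t : Bool) (v : DiscBundle F V) (hv : ‖v.1.2‖ = 1) : DoubleRel (s, v) (t, v)

/-- The double `D(ξ, M) = B(ξ) ⊔_id B(ξ)`: two copies of the disc bundle (labelled by `true` and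
`false`) glued by the identity of the sphere bundle. -/
def Double : Type _ := Quot (DoubleRel F V)

variable {F V}

/-- The image of a point of one of the two discs. -/
def Double.mk (s : Bool) (v : DiscBundle F V) : Double F V := Quot.mk _ (s, v)

theorem Double.mk_eq (s t : Bool) (v : DiscBundle F V) (hv : ‖v.1.2‖ = 1) :
    Double.mk s v = Double.mk t v := Quot.sound (.glue s t v hv)

theorem Double.ind {P : Double F V → Prop} (h : ∀ s v, P (Double.mk s v)) (x) : P x :=
  Quot.ind (fun y ↦ h y.1 y.2) x

variable [∀ x, InnerProductSpace ℝ (V x)]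

/-- The inversion `v ↦ v / |v|²` in the unit sphere bundle. -/
def fiberInversion (v : TotalSpace F V) : TotalSpace F V := ⟨v.1, (‖v.2‖ ^ 2)⁻¹ • v.2⟩

theorem norm_fiberInversion (v : TotalSpace F V) : ‖(fiberInversion v).2‖ = ‖v.2‖⁻¹ := by
  rcases v with ⟨x, v⟩
  change ‖(‖v‖ ^ 2)⁻¹ • v‖ = ‖v‖⁻¹
  rw [norm_smul, norm_inv, norm_pow, norm_norm]
  by_cases h : ‖v‖ = 0
  · simp [h]
  · field_simp

theorem fiberInversion_of_norm_eq_one (v : TotalSpace F V) (h : ‖v.2‖ = 1) :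
    fiberInversion v = v := by
  simp [fiberInversion, h]

theorem fiberInversion_fiberInversion (v : TotalSpace F V) :
    fiberInversion (fiberInversion v) = v := by
  have h := norm_fiberInversion v
  rcases v with ⟨x, v⟩
  change ‖(‖v‖ ^ 2)⁻¹ • v‖ = ‖v‖⁻¹ at h
  change (⟨x, (‖(‖v‖ ^ 2)⁻¹ • v‖ ^ 2)⁻¹ • (‖v‖ ^ 2)⁻¹ • v⟩ : TotalSpace F V) = ⟨x, v⟩
  rw [h, smul_smul]
  by_cases h0 : v = 0
  · simp [h0]
  · have h1 : ‖v‖ ≠ 0 := by simpa using h0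
    have : ((‖v‖⁻¹ ^ 2)⁻¹ * (‖v‖ ^ 2)⁻¹) = 1 := by field_simp
    rw [this, one_smul]

/-- The unfolding of the double to the total space: the disc labelled `s` is mapped by the
inclusion, the other one by the inversion, so that the exterior of the zero section in the other
disc becomes the exterior `|v| > 1` of the unit disc bundle. -/
def Double.unfold (s : Bool) : Double F V → TotalSpace F V :=
  Quot.lift (fun x ↦ if x.1 = s then x.2.1 else fiberInversion x.2.1) (by
    rintro _ _ ⟨a, b, v, hv⟩
    simp [fiberInversion_of_norm_eq_one _ hv])

/-- The inverse of the unfolding. -/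
def Double.fold (s : Bool) (v : TotalSpace F V) : Double F V :=
  if h : ‖v.2‖ ≤ 1 then Double.mk s ⟨v, h⟩ else
    Double.mk (!s) ⟨fiberInversion v, by
      rw [norm_fiberInversion]; exact inv_le_one_of_one_le₀ (not_le.mp h).le⟩

/-- The sign `1` on the disc `true`, `-1` on the disc `false`. -/
def Double.sign (s : Bool) : ℝ := if s then 1 else -1

/-- The identification of the double with the sphere bundle of radius `r` in `ξ ⊕ 1`, whose total
space is the product of the total space of `ξ` with `ℝ`: the point `v` of the disc labelled `s` goes
to `(2 r v / (1 + |v|²), ± r (1 - |v|²) / (1 + |v|²))`. -/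
def Double.toSphere (r : ℝ) : Double F V → TotalSpace F V × ℝ :=
  Quot.lift (fun x ↦
    (⟨x.2.1.1, (2 * r / (1 + ‖x.2.1.2‖ ^ 2)) • x.2.1.2⟩,
      Double.sign x.1 * (r * ((1 - ‖x.2.1.2‖ ^ 2) / (1 + ‖x.2.1.2‖ ^ 2))))) (by
    rintro _ _ ⟨a, b, v, hv⟩
    simp [hv])

variable (F V) in
/-- The sphere bundle `S_r(ξ ⊕ 1)`. -/
def sphereBundle (r : ℝ) : Set (TotalSpace F V × ℝ) := {z | ‖z.1.2‖ ^ 2 + z.2 ^ 2 = r ^ 2}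

end Double

/-! ### The smooth structure of the double

The double is a smooth manifold by means of the collar `(u, t) ↦ exp (-t) u` of the sphere bundle in
each of the two discs: a neighbourhood of the sphere bundle is identified with an open set of the
total space of the vector bundle by the inclusion on one disc and by `v ↦ v / |v|²` on the other. -/

section DoubleManifold

instance {B F : Type*} {V : B → Type*} [∀ x, NormedAddCommGroup (V x)]
    [TopologicalSpace (TotalSpace F V)] : TopologicalSpace (Double F V) :=
  inferInstanceAs (TopologicalSpace (Quot _))

theorem Double.continuous_mk {B F : Type*} {V : B → Type*} [∀ x, NormedAddCommGroup (V x)]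
    [TopologicalSpace (TotalSpace F V)] (s : Bool) :
    Continuous (Double.mk s : DiscBundle F V → Double F V) :=
  continuous_quot_mk.comp (Continuous.prodMk_right s)

theorem Double.mk_mem_source {B F : Type*} {V : B → Type*} [∀ x, NormedAddCommGroup (V x)]
    [∀ x, InnerProductSpace ℝ (V x)] (s a : Bool) (v : DiscBundle F V) :
    (Double.toSphere 1 (Double.mk a v)).2 ≠ -Double.sign s ↔ (a = s ∨ v.1.2 ≠ 0) := by
  change Double.sign a * (1 * ((1 - ‖v.1.2‖ ^ 2) / (1 + ‖v.1.2‖ ^ 2))) ≠ -Double.sign s ↔ _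
  have hq : 0 ≤ ‖v.1.2‖ ^ 2 := by positivity
  have hz : v.1.2 = 0 ↔ ‖v.1.2‖ ^ 2 = 0 := by simp
  rw [ne_eq, ne_eq, hz]
  generalize ‖v.1.2‖ ^ 2 = q at hq
  have h1 : 1 + q ≠ 0 := by positivity
  cases a <;> cases s <;> simp [Double.sign] <;> rw [← sub_eq_zero] <;> field_simp
  · intro h; linarith
  · constructor
    · intro h h2; apply h; rw [h2]; norm_num
    · intro h h2; apply h; linarith
  · constructor
    · intro h h2; apply h; rw [h2]; norm_num
    · intro h h2; apply h; linarith
  · intro h; linarith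

section

variable {B F : Type*} {V : B → Type*} [TopologicalSpace (TotalSpace F V)]
  [∀ x, NormedAddCommGroup (V x)] [∀ x, InnerProductSpace ℝ (V x)]

theorem Double.isOpen_source (hN : Continuous fun v : TotalSpace F V ↦ ‖v.2‖) (s : Bool) :
    IsOpen {x : Double F V | (Double.toSphere 1 x).2 ≠ -Double.sign s} := by
  have hN' : Continuous fun x : DiscBundle F V ↦ ‖x.1.2‖ ^ 2 :=
    (hN.comp continuous_subtype_val).pow 2
  refine isOpen_coinduced.2 (isOpen_prod_iff.2 ?_)
  rintro a v (h : (Double.toSphere 1 (Double.mk a v)).2 ≠ -Double.sign s)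
  rw [Double.mk_mem_source] at h
  rcases h with rfl | h
  · refine ⟨{a}, univ, isOpen_discrete _, isOpen_univ, rfl, trivial, ?_⟩
    rintro ⟨b, w⟩ ⟨hb, -⟩
    exact (Double.mk_mem_source _ _ _).2 (Or.inl hb)
  · refine ⟨univ, {w | ‖w.1.2‖ ^ 2 ≠ 0}, isOpen_univ, isOpen_ne_fun hN' continuous_const, trivial,
      by simpa using h, ?_⟩
    rintro ⟨b, w⟩ ⟨-, hw⟩
    exact (Double.mk_mem_source _ _ _).2 (Or.inr (by simpa using hw))

theorem Double.continuousOn_unfold (hN : Continuous fun v : TotalSpace F V ↦ ‖v.2‖)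
    (hI : ContinuousOn (fiberInversion : TotalSpace F V → TotalSpace F V) {v | v.2 ≠ 0}) (s : Bool) :
    ContinuousOn (Double.unfold s : Double F V → TotalSpace F V)
      {x | (Double.toSphere 1 x).2 ≠ -Double.sign s} := by
  have hnz : IsOpen {v : TotalSpace F V | v.2 ≠ 0} := by
    simpa only [ne_eq, norm_eq_zero] using isOpen_ne_fun hN (continuous_const (y := (0 : ℝ)))
  have hq : IsQuotientMap (Quot.mk (DoubleRel F V)) := isQuotientMap_quot_mk
  refine (hq.continuousOn_isOpen_iff (Double.isOpen_source hN s)).2 ?_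
  rintro ⟨a, v⟩ (h : (Double.toSphere 1 (Double.mk a v)).2 ≠ -Double.sign s)
  rw [Double.mk_mem_source] at h
  refine ContinuousAt.continuousWithinAt ?_
  have hev : ∀ᶠ y : Bool × DiscBundle F V in 𝓝 (a, v), y.1 = a :=
    continuous_fst.continuousAt.eventually
      (p := fun b ↦ b = a) ((isOpen_discrete ({a} : Set Bool)).mem_nhds rfl)
  by_cases ha : a = s
  · have h1 : ContinuousAt (fun y : Bool × DiscBundle F V ↦ y.2.1) (a, v) :=
      (continuous_subtype_val.comp continuous_snd).continuousAt
    refine h1.congr ?_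
    filter_upwards [hev] with y hy
    exact (if_pos (hy.trans ha)).symm
  · have hv := h.resolve_left ha
    have h1 : ContinuousAt (fun y : Bool × DiscBundle F V ↦ fiberInversion y.2.1) (a, v) :=
      ContinuousAt.comp (g := fiberInversion) (f := fun y : Bool × DiscBundle F V ↦ y.2.1)
        (hI.continuousAt (hnz.mem_nhds hv))
        (continuous_subtype_val.comp continuous_snd).continuousAt
    refine h1.congr ?_
    filter_upwards [hev] with y hy
    exact (if_neg (fun h' ↦ ha (hy.symm.trans h'))).symm

theorem Double.continuous_fold (hN : Continuous fun v : TotalSpace F V ↦ ‖v.2‖)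
    (hI : ContinuousOn (fiberInversion : TotalSpace F V → TotalSpace F V) {v | v.2 ≠ 0}) (s : Bool) :
    Continuous (Double.fold s : TotalSpace F V → Double F V) := by
  have h1 : ContinuousOn (Double.fold s : TotalSpace F V → Double F V) {v | ‖v.2‖ ≤ 1} := by
    rw [continuousOn_iff_continuous_domRestrict]
    have : ({v | ‖v.2‖ ≤ 1} : Set (TotalSpace F V)).domRestrict (Double.fold s) =
        Double.mk s := by
      funext v
      exact dif_pos v.2
    rw [this]
    exact Double.continuous_mk s
  have h2 : ContinuousOn (Double.fold s : TotalSpace F V → Double F V) {v | 1 ≤ ‖v.2‖} := by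
    rw [continuousOn_iff_continuous_domRestrict]
    have hle (v : ({v | 1 ≤ ‖v.2‖} : Set (TotalSpace F V))) : ‖(fiberInversion v.1).2‖ ≤ 1 := by
      rw [norm_fiberInversion]; exact inv_le_one_of_one_le₀ v.2
    have : ({v | 1 ≤ ‖v.2‖} : Set (TotalSpace F V)).domRestrict (Double.fold s) =
        fun v ↦ Double.mk (!s) ⟨fiberInversion v.1, hle v⟩ := by
      funext v
      change Double.fold s v.1 = _
      unfold Double.fold
      split_ifs with h
      · have h' : ‖v.1.2‖ = 1 := le_antisymm h v.2
        rw [Double.mk_eq s (!s) ⟨v.1, h⟩ h']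
        congr 2
        exact (fiberInversion_of_norm_eq_one _ h').symm
      · rfl
    rw [this]
    refine (Double.continuous_mk _).comp (Continuous.subtype_mk ?_ _)
    refine (continuousOn_iff_continuous_domRestrict.1 (hI.mono ?_))
    intro v hv hv0
    have : (1 : ℝ) ≤ ‖v.2‖ := hv
    rw [hv0, norm_zero] at this
    linarith
  have h := h1.union_of_isClosed h2 (isClosed_le hN continuous_const)
    (isClosed_le continuous_const hN)
  rw [← continuousOn_univ]
  refine h.mono (fun v _ ↦ ?_)
  exact le_total ‖v.2‖ 1

end

variable {EB : Type*} [NormedAddCommGroup EB] [NormedSpace ℝ EB]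
  {B : Type*} [TopologicalSpace B] [ChartedSpace EB B]
  {F : Type*} [NormedAddCommGroup F] [NormedSpace ℝ F]
  {V : B → Type*} [TopologicalSpace (TotalSpace F V)] [∀ x, NormedAddCommGroup (V x)]
  [∀ x, InnerProductSpace ℝ (V x)] [FiberBundle F V] [VectorBundle ℝ F V]

theorem contMDiffAt_fiberSMul {c : TotalSpace F V → ℝ} {v : TotalSpace F V}
    (hc : ContMDiffAt (𝓘(ℝ, EB).prod 𝓘(ℝ, F)) 𝓘(ℝ, ℝ) ∞ c v) :
    ContMDiffAt (𝓘(ℝ, EB).prod 𝓘(ℝ, F)) (𝓘(ℝ, EB).prod 𝓘(ℝ, F)) ∞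
      (fun v ↦ (⟨v.1, c v • v.2⟩ : TotalSpace F V)) v := by
  have hid : ContMDiffAt (𝓘(ℝ, EB).prod 𝓘(ℝ, F)) (𝓘(ℝ, EB).prod 𝓘(ℝ, F)) ∞
      (fun v : TotalSpace F V ↦ v) v := contMDiffAt_id
  rw [Bundle.contMDiffAt_totalSpace] at hid ⊢
  refine ⟨hid.1, (hc.smul hid.2).congr_of_eventuallyEq ?_⟩
  have hb : ∀ᶠ w : TotalSpace F V in 𝓝 v, w.1 ∈ (trivializationAt F V v.1).baseSet :=
    (FiberBundle.continuous_proj F V).continuousAt.eventually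
      ((trivializationAt F V v.1).open_baseSet.mem_nhds
        (FiberBundle.mem_baseSet_trivializationAt' v.1))
  filter_upwards [hb] with w hw
  exact ((trivializationAt F V v.1).linear ℝ hw).map_smul (c w) w.2

variable (EB F V) in
theorem contMDiff_fiberNormSq [IsContMDiffRiemannianBundle 𝓘(ℝ, EB) ∞ F V] :
    ContMDiff (𝓘(ℝ, EB).prod 𝓘(ℝ, F)) 𝓘(ℝ, ℝ) ∞
    (fun v : TotalSpace F V ↦ ‖v.2‖ ^ 2) := by
  have h : ContMDiff (𝓘(ℝ, EB).prod 𝓘(ℝ, F)) 𝓘(ℝ, ℝ) ∞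
      (fun v : TotalSpace F V ↦ inner ℝ v.2 v.2) :=
    ContMDiff.inner_bundle (b := fun v : TotalSpace F V ↦ v.1) (v := fun v ↦ v.2)
      (w := fun v ↦ v.2) contMDiff_id contMDiff_id
  simpa only [real_inner_self_eq_norm_sq] using h

theorem contMDiffAt_fiberInversion [IsContMDiffRiemannianBundle 𝓘(ℝ, EB) ∞ F V]
    {v : TotalSpace F V} (hv : v.2 ≠ 0) :
    ContMDiffAt (𝓘(ℝ, EB).prod 𝓘(ℝ, F)) (𝓘(ℝ, EB).prod 𝓘(ℝ, F)) ∞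
      (fiberInversion : TotalSpace F V → TotalSpace F V) v := by
  refine contMDiffAt_fiberSMul ?_
  have h1 : ContDiffAt ℝ ∞ (fun t : ℝ ↦ t⁻¹) (‖v.2‖ ^ 2) :=
    contDiffAt_inv ℝ (by simpa using hv)
  exact h1.contMDiffAt.comp v (contMDiff_fiberNormSq EB F V).contMDiffAt

variable (EB F V) in
theorem continuous_fiberNorm_and_continuousOn_fiberInversion
    [IsContMDiffRiemannianBundle 𝓘(ℝ, EB) ∞ F V] :
    Continuous (fun v : TotalSpace F V ↦ ‖v.2‖) ∧
      ContinuousOn (fiberInversion : TotalSpace F V → TotalSpace F V) {v | v.2 ≠ 0} := by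
  refine ⟨?_, fun _ hv ↦
    (contMDiffAt_fiberInversion (EB := EB) hv).continuousAt.continuousWithinAt⟩
  have h := (contMDiff_fiberNormSq EB F V).continuous.sqrt
  simpa only [Real.sqrt_sq (norm_nonneg _)] using h

variable [IsContMDiffRiemannianBundle 𝓘(ℝ, EB) ∞ F V]

variable (EB F V) in
/-- The chart of the double with values in the total space of the vector bundle, defined outside the
zero section of the disc labelled `!s`. -/
def Double.chart (s : Bool) : OpenPartialHomeomorph (Double F V) (TotalSpace F V) where
  toFun := Double.unfold s
  invFun := Double.fold s
  source := {x | (Double.toSphere 1 x).2 ≠ -Double.sign s}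
  target := univ
  map_source' _ _ := trivial
  map_target' v _ := by
    unfold Double.fold
    split_ifs with h
    · exact (Double.mk_mem_source _ _ _).2 (Or.inl rfl)
    · refine (Double.mk_mem_source _ _ _).2 (Or.inr ?_)
      rw [← norm_ne_zero_iff, norm_fiberInversion]
      exact inv_ne_zero (by linarith [not_le.1 h])
  left_inv' x := by
    induction x using Double.ind with | h a v => ?_
    intro h
    have h : (Double.toSphere 1 (Double.mk a v)).2 ≠ -Double.sign s := h
    rw [Double.mk_mem_source] at h
    change Double.fold s (if a = s then v.1 else fiberInversion v.1) = _
    by_cases ha : a = s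
    · rw [if_pos ha, ha]
      exact dif_pos v.2
    · rw [if_neg ha]
      have hv := norm_pos_iff.2 (h.resolve_left ha)
      have ha' : (!s) = a := by cases a <;> cases s <;> simp_all
      unfold Double.fold
      split_ifs with h1
      · rw [norm_fiberInversion] at h1
        have h2 : ‖v.1.2‖ = 1 := le_antisymm v.2 ((inv_le_one₀ hv).1 h1)
        rw [Double.mk_eq a s v h2]
        congr 2
        exact fiberInversion_of_norm_eq_one _ h2
      · rw [ha']
        congr 2
        exact fiberInversion_fiberInversion _
  right_inv' v _ := by
    unfold Double.fold
    split_ifs with h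
    · exact if_pos rfl
    · refine (if_neg (by simp)).trans ?_
      exact fiberInversion_fiberInversion _
  open_source := Double.isOpen_source
    (continuous_fiberNorm_and_continuousOn_fiberInversion EB F V).1 s
  open_target := isOpen_univ
  continuousOn_toFun := Double.continuousOn_unfold
    (continuous_fiberNorm_and_continuousOn_fiberInversion EB F V).1
    (continuous_fiberNorm_and_continuousOn_fiberInversion EB F V).2 s
  continuousOn_invFun := (Double.continuous_fold
    (continuous_fiberNorm_and_continuousOn_fiberInversion EB F V).1
    (continuous_fiberNorm_and_continuousOn_fiberInversion EB F V).2 s).continuousOn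

theorem Double.exists_mem_source (x : Double F V) : ∃ s, x ∈ (Double.chart EB F V s).source :=
  Double.ind (P := fun x ↦ ∃ s, x ∈ (Double.chart EB F V s).source)
    (fun s v ↦ ⟨s, (Double.mk_mem_source s s v).2 (Or.inl rfl)⟩) x

instance : ChartedSpace (ModelProd EB F) (Double F V) where
  atlas := {e | ∃ s, ∃ c ∈ atlas (ModelProd EB F) (TotalSpace F V),
    e = (Double.chart EB F V s).trans c}
  chartAt x := (Double.chart EB F V (Double.exists_mem_source x).choose).trans
    (chartAt (ModelProd EB F) (Double.chart EB F V (Double.exists_mem_source x).choose x))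
  mem_chart_source x := by
    rw [OpenPartialHomeomorph.trans_source]
    exact ⟨(Double.exists_mem_source x).choose_spec,
      mem_chart_source (ModelProd EB F) (Double.chart EB F V (Double.exists_mem_source x).choose x)⟩
  chart_mem_atlas x := ⟨_, _, chart_mem_atlas _ _, rfl⟩

theorem Double.contMDiffOn_transition (s t : Bool) :
    ContMDiffOn (𝓘(ℝ, EB).prod 𝓘(ℝ, F)) (𝓘(ℝ, EB).prod 𝓘(ℝ, F)) ∞
      ((Double.chart EB F V s).symm.trans (Double.chart EB F V t))
      ((Double.chart EB F V s).symm.trans (Double.chart EB F V t)).source := by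
  by_cases hst : s = t
  · subst hst
    refine contMDiffOn_id.congr fun v _ ↦ ?_
    exact (Double.chart EB F V s).right_inv trivial
  · have key (v : TotalSpace F V) : Double.unfold t (Double.fold s v) = fiberInversion v := by
      unfold Double.fold
      split_ifs with h
      · exact if_neg hst
      · exact if_pos (by cases s <;> cases t <;> simp_all)
    intro v hv
    rw [OpenPartialHomeomorph.trans_source] at hv
    have h2 : (Double.toSphere 1 (Double.fold s v)).2 ≠ -Double.sign t := hv.2
    have hv0 : v.2 ≠ 0 := by
      intro h0
      have hle : ‖v.2‖ ≤ 1 := by rw [h0, norm_zero]; exact zero_le_one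
      rw [show Double.fold s v = Double.mk s ⟨v, hle⟩ from dif_pos hle,
        Double.mk_mem_source] at h2
      exact h2.elim hst (fun h ↦ h h0)
    exact ((contMDiffAt_fiberInversion hv0).contMDiffWithinAt).congr
      (fun w _ ↦ key w) (key v)

variable [IsManifold 𝓘(ℝ, EB) ∞ B] [ContMDiffVectorBundle ∞ F V 𝓘(ℝ, EB)]

instance : IsManifold (𝓘(ℝ, EB).prod 𝓘(ℝ, F)) ∞ (Double F V) := by
  refine isManifold_of_contDiffOn _ _ _ ?_
  rintro _ _ ⟨s, c, hc, rfl⟩ ⟨t, c', hc', rfl⟩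
  have h1 := contMDiffOn_extend_symm (I := 𝓘(ℝ, EB).prod 𝓘(ℝ, F)) (n := ∞)
    (IsManifold.subset_maximalAtlas hc)
  have h2 : ContMDiffOn (𝓘(ℝ, EB).prod 𝓘(ℝ, F)) 𝓘(ℝ, EB × F) ∞
      (c'.extend (𝓘(ℝ, EB).prod 𝓘(ℝ, F))) c'.source :=
    c'.contMDiffOn_extend (IsManifold.subset_maximalAtlas hc')
  have h3 := Double.contMDiffOn_transition (EB := EB) (F := F) (V := V) s t
  have h4 := (h2.comp' h3).comp' h1
  rw [contMDiffOn_iff_contDiffOn] at h4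
  refine h4.mono ?_
  rintro y ⟨hy, hr⟩
  simp only [mfld_simps] at hy ⊢
  exact ⟨⟨y, hy.1.1, rfl⟩, ⟨hy.1.2, hy.2.1⟩, hy.2.2⟩

end DoubleManifold

/-! ### Connection metrics -/

section ConnectionMetric

variable {EB : Type*} [NormedAddCommGroup EB] [NormedSpace ℝ EB]
  {B : Type*} [TopologicalSpace B] [ChartedSpace EB B] [IsManifold 𝓘(ℝ, EB) ∞ B]
  {F : Type*} [NormedAddCommGroup F] [NormedSpace ℝ F]
  {V : B → Type*} [TopologicalSpace (TotalSpace F V)] [∀ x, NormedAddCommGroup (V x)]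
  [∀ x, InnerProductSpace ℝ (V x)] [FiberBundle F V] [VectorBundle ℝ F V]

variable (EB F) in
/-- The vertical lift of `w`: the velocity at `t = 0` of the curve `v + t w` in the fibre. -/
def verticalLift {p : B} (v w : V p) :
    TangentSpace (𝓘(ℝ, EB).prod 𝓘(ℝ, F)) (⟨p, v⟩ : TotalSpace F V) :=
  let L : ℝ →L[ℝ] TangentSpace (𝓘(ℝ, EB).prod 𝓘(ℝ, F)) (⟨p, v⟩ : TotalSpace F V) :=
    mfderiv 𝓘(ℝ, ℝ) (𝓘(ℝ, EB).prod 𝓘(ℝ, F)) (fun t : ℝ ↦ (⟨p, v + t • w⟩ : TotalSpace F V)) 0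
  L 1

/-- `h` is the connection metric on the total space of the vector bundle determined by the metric
`g` of the base, the fibre metric and the connection `∇`: every tangent vector of the total space is
of the form `dσ(X) + (vertical lift of w)` for a section `σ`, its horizontal part is measured by
`g(X, X)`, and its vertical part is `∇_X σ + w`. -/
def IsConnectionMetric [ContMDiffVectorBundle ∞ F V 𝓘(ℝ, EB)] (g : SmoothMetric 𝓘(ℝ, EB) B)
    (cov : CovariantDerivative 𝓘(ℝ, EB) F V)
    (h : SmoothMetric (𝓘(ℝ, EB).prod 𝓘(ℝ, F)) (TotalSpace F V)) : Prop :=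
  ∀ (σ : ∀ x, V x) (p : B),
    MDifferentiableAt 𝓘(ℝ, EB) (𝓘(ℝ, EB).prod 𝓘(ℝ, F))
      (fun x ↦ (⟨x, σ x⟩ : TotalSpace F V)) p →
    ∀ (X : TangentSpace 𝓘(ℝ, EB) p) (w : V p),
      let Z : TangentSpace (𝓘(ℝ, EB).prod 𝓘(ℝ, F)) (⟨p, σ p⟩ : TotalSpace F V) :=
        mfderiv 𝓘(ℝ, EB) (𝓘(ℝ, EB).prod 𝓘(ℝ, F)) (fun x ↦ (⟨x, σ x⟩ : TotalSpace F V)) p X +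
          verticalLift EB F (σ p) w
      h.inner ⟨p, σ p⟩ Z Z = g.inner p X X + ‖cov σ p X + w‖ ^ 2

variable [ContMDiffVectorBundle ∞ F V 𝓘(ℝ, EB)] [IsContMDiffRiemannianBundle 𝓘(ℝ, EB) ∞ F V]

/-- `g` is the metric of the double induced by the map `Double.toSphere r` into the total space of
`ξ ⊕ 1`, which carries the product `h + dt²` of the connection metric `h` of `ξ` with the standard
metric of the line. (This product is the connection metric of the orthogonal sum `ξ ⊕ 1` for the
connection extending the one of `ξ` and making the unit section of the line bundle parallel.) -/
def IsInducedBySphere (h : SmoothMetric (𝓘(ℝ, EB).prod 𝓘(ℝ, F)) (TotalSpace F V)) (r : ℝ)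
    (g : SmoothMetric (𝓘(ℝ, EB).prod 𝓘(ℝ, F)) (Double F V)) : Prop :=
  ∀ (x : Double F V) (Y Y' : TangentSpace (𝓘(ℝ, EB).prod 𝓘(ℝ, F)) x),
    let dv := mfderiv (𝓘(ℝ, EB).prod 𝓘(ℝ, F)) (𝓘(ℝ, EB).prod 𝓘(ℝ, F))
      (fun x : Double F V ↦ (Double.toSphere r x).1) x
    let dt : TangentSpace (𝓘(ℝ, EB).prod 𝓘(ℝ, F)) x →L[ℝ] ℝ :=
      mfderiv (𝓘(ℝ, EB).prod 𝓘(ℝ, F)) 𝓘(ℝ, ℝ) (fun x : Double F V ↦ (Double.toSphere r x).2) x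
    g.inner x Y Y' = h.inner (Double.toSphere r x).1 (dv Y) (dv Y') + dt Y * dt Y'

variable (EB F V) in
/-- `Double.toSphere r` is a diffeomorphism of the double onto the sphere bundle `S_r(ξ ⊕ 1)`, that
is, a smooth embedding into the total space of `ξ ⊕ 1` with this image. -/
def IsSphereDiffeo (r : ℝ) : Prop :=
  ContMDiff (𝓘(ℝ, EB).prod 𝓘(ℝ, F)) ((𝓘(ℝ, EB).prod 𝓘(ℝ, F)).prod 𝓘(ℝ, ℝ)) ∞
    (Double.toSphere r : Double F V → TotalSpace F V × ℝ) ∧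
  IsEmbedding (Double.toSphere r : Double F V → TotalSpace F V × ℝ) ∧
  (∀ x : Double F V, Function.Injective
    (mfderiv (𝓘(ℝ, EB).prod 𝓘(ℝ, F)) ((𝓘(ℝ, EB).prod 𝓘(ℝ, F)).prod 𝓘(ℝ, ℝ))
      (Double.toSphere r : Double F V → TotalSpace F V × ℝ) x)) ∧
  range (Double.toSphere r : Double F V → TotalSpace F V × ℝ) = sphereBundle F V r

end ConnectionMetric

end

noncomputable section

/-! ### Coordinate expressions of the Ricci tensor -/

section CoordinateRicci

variable {E : Type*} [NormedAddCommGroup E] [NormedSpace ℝ E]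

/-! The idea is to shrink the fibres, in coordinates where the limit is smooth. Each disc of the
double unfolds to the whole total space, and `Double.toSphere r` becomes the inverse stereographic
projection in every fibre (`Double.toSphere_fold`). In a chart of the base and a trivialization, let
`θ = dy + A y` be the vertical part of a tangent vector and `ε = r ^ 2`. The induced metric is then
`G_ε = g + ε · 4/(1+|y|²)² · k(θ, θ)` (`sphereMetric_eq_pullback`), with `g`, `k`, `A` independent
of `r`.

Although `G_ε` degenerates at `ε = 0`, its Christoffel symbols do not: they are affine in `ε`.
Testing the Koszul formula against vertical vectors, the factor `ε` cancels, so the vertical part of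
the symbols does not depend on `ε`. Testing it against horizontal vectors, the fibre term enters
with the factor `ε`. Hence `Γ_ε = Γ₀ + ε Γ₁` with smooth `Γ₀`, `Γ₁` (`christoffel_sphereMetric`).
The Ricci tensor, as the trace of the curvature endomorphism, is a polynomial in the symbols and
their first derivatives, so it extends continuously to `ε = 0`.

The limit is the Ricci tensor of the base plus that of the round unit `n`-sphere, `Ric_M(V, V) + (n
- 1) · 4/(1+|y|²)² · |θ V|²` (`trace_curvature_limitΓ`). The curvature of the connection does not
appear in it. Since `n ≥ 2` and `Ric_M > 0`, it is positive definite. Positivity on a compact sphere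
of directions is an open condition, so it persists near each point for small `ε`
(`exists_curvatureTrace_pos`). The radius `r₀` comes from compactness of the double, and naturality
of the Ricci tensor (`ricciCoord_pullback`) carries positivity to all charts of the atlas.

The height `f` depends only on `|y|²`, whose differential is `2 k(y, θ)` because the connection is
metric. Its gradient is therefore vertical, and its Hessian is `-f/r²` times the fibre part of the
metric, as on a round sphere. This gives `|∇f|² = 1 - f²/r²` and `Δf = -n f/r²`.

A metric connection is obtained from finitely many global sections with `v = ∑ ⟪v, s i⟫ t i`, by
averaging the connection `∑ d⟪σ, s i⟫ t i` with its adjoint. The connection metric is `g(dπ, dπ) +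
|K|²` for the connector `K`. -/

theorem christoffelFirst_apply (G : E → E →L[ℝ] E →L[ℝ] ℝ) (y u v w : E) :
    christoffelFirst G y u v w =
      (1 / 2) * (fderiv ℝ G y u v w + fderiv ℝ G y v u w - fderiv ℝ G y w u v) := by
  simp [christoffelFirst]

/-- A positive definite symmetric bilinear form. -/
structure IsMetricForm (b : E →L[ℝ] E →L[ℝ] ℝ) : Prop where
  symm : ∀ v w, b v w = b w v
  pos : ∀ v, v ≠ 0 → 0 < b v v

theorem IsMetricForm.isInvertible [FiniteDimensional ℝ E] {b : E →L[ℝ] E →L[ℝ] ℝ}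
    (hb : IsMetricForm b) : b.IsInvertible := by
  have hinj : Function.Injective (b : E →ₗ[ℝ] (E →L[ℝ] ℝ)) := by
    rw [injective_iff_map_eq_zero]
    intro v hv
    by_contra hne
    have h1 := hb.pos v hne
    have h2 : b v = 0 := hv
    rw [h2] at h1
    simp at h1
  have hdim : Module.finrank ℝ E = Module.finrank ℝ (E →L[ℝ] ℝ) := by
    rw [← (LinearMap.toContinuousLinearMap : (E →ₗ[ℝ] ℝ) ≃ₗ[ℝ] (E →L[ℝ] ℝ)).finrank_eq]
    exact (Subspace.dual_finrank_eq (K := ℝ) (V := E)).symm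
  refine ⟨(LinearEquiv.ofInjectiveOfFinrankEq (b : E →ₗ[ℝ] (E →L[ℝ] ℝ)) hinj
    hdim).toContinuousLinearEquiv, ?_⟩
  ext v w
  rfl

theorem IsMetricForm.inverse_apply [FiniteDimensional ℝ E] {b : E →L[ℝ] E →L[ℝ] ℝ}
    (hb : IsMetricForm b) (l : E →L[ℝ] ℝ) (w : E) : b (b.inverse l) w = l w := by
  have := (hb.isInvertible.inverse_apply_eq (x := b.inverse l) (y := l)).1 rfl
  rw [← this]

theorem IsMetricForm.inverse_eq [FiniteDimensional ℝ E] {b : E →L[ℝ] E →L[ℝ] ℝ}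
    (hb : IsMetricForm b) {l : E →L[ℝ] ℝ} {v : E} (h : ∀ w, b v w = l w) : b.inverse l = v :=
  hb.isInvertible.inverse_apply_eq.2 (ContinuousLinearMap.ext fun w ↦ (h w).symm)

theorem IsMetricForm.eq_of_forall {b : E →L[ℝ] E →L[ℝ] ℝ}
    (hb : IsMetricForm b) {v v' : E} (h : ∀ w, b v w = b v' w) : v = v' := by
  by_contra hne
  have h1 := hb.pos (v - v') (sub_ne_zero.2 hne)
  simp only [map_sub, sub_apply, h] at h1
  simp at h1

theorem metric_christoffel_apply [FiniteDimensional ℝ E] {G : E → E →L[ℝ] E →L[ℝ] ℝ} {y : E}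
    (hG : IsMetricForm (G y)) (u v w : E) :
    G y (christoffel G y u v) w = christoffelFirst G y u v w := hG.inverse_apply _ _

/-- Symmetry holds in a neighbourhood of the point, so it can be differentiated. -/
theorem fderiv_symm_of_eventually_symm {G : E → E →L[ℝ] E →L[ℝ] ℝ} {y : E}
    (hG : ∀ᶠ z in 𝓝 y, IsMetricForm (G z)) (hd : DifferentiableAt ℝ G y) (u v w : E) :
    fderiv ℝ G y u v w = fderiv ℝ G y u w v := by
  have h (a b : E) : HasFDerivAt (fun z ↦ G z a b)
      (((fderiv ℝ G y).flip a).flip b) y := by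
    have := (hd.hasFDerivAt.clm_apply (hasFDerivAt_const a y)).clm_apply (hasFDerivAt_const b y)
    refine this.congr_fderiv ?_
    ext; simp
  have h1 := (h v w).unique ((h w v).congr_of_eventuallyEq
    (by filter_upwards [hG] with z hz using hz.symm v w))
  exact congrArg (fun L : E →L[ℝ] ℝ ↦ L u) h1

theorem christoffel_symm {G : E → E →L[ℝ] E →L[ℝ] ℝ} {y : E}
    (hG : ∀ᶠ z in 𝓝 y, IsMetricForm (G z)) (hd : DifferentiableAt ℝ G y) (u v : E) :
    christoffel G y u v = christoffel G y v u := by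
  have : christoffelFirst G y u v = christoffelFirst G y v u := by
    ext w
    rw [christoffelFirst_apply, christoffelFirst_apply,
      fderiv_symm_of_eventually_symm hG hd w u v]
    ring
  exact congrArg (G y).inverse this

theorem christoffel_congr {G G' : E → E →L[ℝ] E →L[ℝ] ℝ} {y : E} (h : G =ᶠ[𝓝 y] G') :
    christoffel G =ᶠ[𝓝 y] christoffel G' := by
  filter_upwards [eventually_eventually_nhds.2 h] with z hz
  unfold christoffel christoffelFirst
  rw [(show G =ᶠ[𝓝 z] G' from hz).fderiv_eq, (show G =ᶠ[𝓝 z] G' from hz).eq_of_nhds]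

theorem ricciCoord_congr {G G' : E → E →L[ℝ] E →L[ℝ] ℝ} {y : E} (h : G =ᶠ[𝓝 y] G') (v w : E) :
    ricciCoord G y v w = ricciCoord G' y v w := by
  have h' := christoffel_congr h
  unfold ricciCoord curvatureEnd
  rw [h'.fderiv_eq, h'.eq_of_nhds]

/-- The only operation here that is not linear or bilinear is the inversion of `G`, which is smooth
at an invertible map. -/
theorem contDiffAt_christoffel [FiniteDimensional ℝ E] {G : E → E →L[ℝ] E →L[ℝ] ℝ} {y : E}
    (hG : IsMetricForm (G y)) (hd : ContDiffAt ℝ ∞ G y) : ContDiffAt ℝ ∞ (christoffel G) y := by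
  have hD : ContDiffAt ℝ ∞ (fderiv ℝ G) y := hd.fderiv_right (by simp)
  have h1 : ContDiffAt ℝ ∞ (christoffelFirst G) y := by
    refine ContDiffAt.const_smul (1 / 2 : ℝ) ((hD.add ?_).sub ?_)
    · exact (ContinuousLinearMap.flipₗᵢ ℝ E E (E →L[ℝ] ℝ)).contDiff.contDiffAt.comp y hD
    · refine contDiffAt_const.clm_comp ?_
      exact (ContinuousLinearMap.flipₗᵢ ℝ E E (E →L[ℝ] ℝ)).contDiff.contDiffAt.comp y hD
  refine ContDiffAt.clm_comp ?_ h1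
  have h2 : ContDiffAt ℝ ∞ (fun z ↦ (G z).inverse) y :=
    (hG.isInvertible.contDiffAt_map_inverse).comp y hd
  exact (ContinuousLinearMap.compL ℝ E (E →L[ℝ] ℝ) E).contDiff.contDiffAt.comp y h2

/-- Transformation of the derivatives of a metric under a change of coordinates. -/
theorem fderiv_pullback {G G' : E → E →L[ℝ] E →L[ℝ] ℝ} {φ : E → E} {y : E}
    (hφ : ContDiffAt ℝ ∞ φ y) (hG : DifferentiableAt ℝ G (φ y)) (hG' : DifferentiableAt ℝ G' y)
    (h : ∀ᶠ z in 𝓝 y, ∀ v w, G' z v w = G (φ z) (fderiv ℝ φ z v) (fderiv ℝ φ z w)) (u v w : E) :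
    fderiv ℝ G' y u v w =
      fderiv ℝ G (φ y) (fderiv ℝ φ y u) (fderiv ℝ φ y v) (fderiv ℝ φ y w) +
      G (φ y) (fderiv ℝ (fderiv ℝ φ) y u v) (fderiv ℝ φ y w) +
      G (φ y) (fderiv ℝ φ y v) (fderiv ℝ (fderiv ℝ φ) y u w) := by
  have hA : HasFDerivAt (fderiv ℝ φ) (fderiv ℝ (fderiv ℝ φ) y) y :=
    ((hφ.fderiv_right (m := 1) (by norm_cast)).differentiableAt (by simp)).hasFDerivAt
  have hφ1 : HasFDerivAt φ (fderiv ℝ φ y) y := (hφ.differentiableAt (by simp)).hasFDerivAt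
  have h1 := ((hG.hasFDerivAt.comp y hφ1).clm_apply
    (hA.clm_apply (hasFDerivAt_const v y))).clm_apply (hA.clm_apply (hasFDerivAt_const w y))
  have h2 := (hG'.hasFDerivAt.clm_apply (hasFDerivAt_const v y)).clm_apply (hasFDerivAt_const w y)
  have h3 := h2.unique (h1.congr_of_eventuallyEq
    (by filter_upwards [h] with z hz using hz v w))
  have h4 := congrArg (fun L : E →L[ℝ] ℝ ↦ L u) h3
  simp at h4
  rw [h4]
  ring

/-- Transformation of the Christoffel symbols under a change of coordinates. -/
theorem christoffel_pullback [FiniteDimensional ℝ E] {G G' : E → E →L[ℝ] E →L[ℝ] ℝ} {φ : E → E}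
    {y : E} (hφ : ContDiffAt ℝ ∞ φ y) (hinv : (fderiv ℝ φ y).IsInvertible)
    (hG : DifferentiableAt ℝ G (φ y)) (hG' : DifferentiableAt ℝ G' y)
    (hm : IsMetricForm (G (φ y))) (hm' : IsMetricForm (G' y))
    (h : ∀ᶠ z in 𝓝 y, ∀ v w, G' z v w = G (φ z) (fderiv ℝ φ z v) (fderiv ℝ φ z w)) (u v : E) :
    fderiv ℝ φ y (christoffel G' y u v) =
      christoffel G (φ y) (fderiv ℝ φ y u) (fderiv ℝ φ y v) + fderiv ℝ (fderiv ℝ φ) y u v := by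
  have hs : IsSymmSndFDerivAt ℝ φ y := hφ.isSymmSndFDerivAt (by simp; norm_cast)
  -- Both sides are tested against `w' = dφ(w)`. Of the six terms of the Koszul formula with second
  -- derivatives of `φ`, four cancel by symmetry and two add up to `2 G(D²φ(u, v), dφ(w))`.
  refine hm.eq_of_forall fun w' ↦ ?_
  obtain ⟨A, hA⟩ := hinv
  obtain ⟨w, rfl⟩ : ∃ w, w' = fderiv ℝ φ y w := ⟨A.symm w', by rw [← hA]; simp⟩
  rw [← h.self_of_nhds, metric_christoffel_apply hm', map_add, add_apply,
    metric_christoffel_apply hm, christoffelFirst_apply, christoffelFirst_apply,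
    fderiv_pullback hφ hG hG' h, fderiv_pullback hφ hG hG' h, fderiv_pullback hφ hG hG' h,
    hs.eq u v, hs.eq w u, hs.eq w v, hm.symm (fderiv ℝ φ y v), hm.symm (fderiv ℝ φ y u),
    hm.symm (fderiv ℝ (fderiv ℝ φ) y u w)]
  ring

/-- The curvature endomorphism of a connection given by its Christoffel symbols. -/
def connectionCurvatureEnd (Γ : E → E →L[ℝ] E →L[ℝ] E) (y v w : E) : E →L[ℝ] E :=
  ((fderiv ℝ Γ y).flip v).flip w - (fderiv ℝ Γ y v).flip w + (Γ y).flip (Γ y v w) -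
    (Γ y v) ∘L ((Γ y).flip w)

theorem connectionCurvatureEnd_apply (Γ : E → E →L[ℝ] E →L[ℝ] E) (y u v w : E) :
    connectionCurvatureEnd Γ y v w u =
      fderiv ℝ Γ y u v w - fderiv ℝ Γ y v u w + Γ y u (Γ y v w) - Γ y v (Γ y u w) := by
  simp [connectionCurvatureEnd]

/-- Transformation of the derivatives of Christoffel symbols under a change of coordinates. -/
theorem fderiv_connection_pullback {Γ Γ' : E → E →L[ℝ] E →L[ℝ] E} {φ : E → E} {y : E}
    (hφ : ContDiffAt ℝ ∞ φ y) (hΓ : DifferentiableAt ℝ Γ (φ y)) (hΓ' : DifferentiableAt ℝ Γ' y)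
    (h : ∀ᶠ z in 𝓝 y, ∀ v w, fderiv ℝ φ z (Γ' z v w) =
      Γ (φ z) (fderiv ℝ φ z v) (fderiv ℝ φ z w) + fderiv ℝ (fderiv ℝ φ) z v w) (u v w : E) :
    fderiv ℝ (fderiv ℝ φ) y u (Γ' y v w) + fderiv ℝ φ y (fderiv ℝ Γ' y u v w) =
      fderiv ℝ Γ (φ y) (fderiv ℝ φ y u) (fderiv ℝ φ y v) (fderiv ℝ φ y w) +
      Γ (φ y) (fderiv ℝ (fderiv ℝ φ) y u v) (fderiv ℝ φ y w) +
      Γ (φ y) (fderiv ℝ φ y v) (fderiv ℝ (fderiv ℝ φ) y u w) +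
      fderiv ℝ (fderiv ℝ (fderiv ℝ φ)) y u v w := by
  have hA' : ContDiffAt ℝ ∞ (fderiv ℝ φ) y := hφ.fderiv_right (by simp)
  have hA : HasFDerivAt (fderiv ℝ φ) (fderiv ℝ (fderiv ℝ φ) y) y :=
    (hA'.differentiableAt (by simp)).hasFDerivAt
  have hH : HasFDerivAt (fderiv ℝ (fderiv ℝ φ)) (fderiv ℝ (fderiv ℝ (fderiv ℝ φ)) y) y :=
    ((hA'.fderiv_right (m := ∞) (by simp)).differentiableAt (by simp)).hasFDerivAt
  have hφ1 : HasFDerivAt φ (fderiv ℝ φ y) y := (hφ.differentiableAt (by simp)).hasFDerivAt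
  have hv := hasFDerivAt_const (𝕜 := ℝ) v y
  have hw := hasFDerivAt_const (𝕜 := ℝ) w y
  have h1 := (((hΓ.hasFDerivAt.comp y hφ1).clm_apply (hA.clm_apply hv)).clm_apply
    (hA.clm_apply hw)).add ((hH.clm_apply hv).clm_apply hw)
  have h2 := hA.clm_apply ((hΓ'.hasFDerivAt.clm_apply hv).clm_apply hw)
  have h3 := h2.unique (h1.congr_of_eventuallyEq
    (by filter_upwards [h] with z hz using hz v w))
  have h4 := congrArg (fun L : E →L[ℝ] E ↦ L u) h3
  simp at h4
  rw [add_comm, h4]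
  abel

/-- The Ricci tensor is natural under changes of coordinates. -/
theorem ricciCoord_pullback [FiniteDimensional ℝ E] {G G' : E → E →L[ℝ] E →L[ℝ] ℝ} {φ : E → E}
    {y : E} (hφ : ∀ᶠ z in 𝓝 y, ContDiffAt ℝ ∞ φ z) (hinv : (fderiv ℝ φ y).IsInvertible)
    (hG : ∀ᶠ z in 𝓝 (φ y), ContDiffAt ℝ ∞ G z ∧ IsMetricForm (G z))
    (hG' : ∀ᶠ z in 𝓝 y, ContDiffAt ℝ ∞ G' z ∧ IsMetricForm (G' z))
    (h : ∀ᶠ z in 𝓝 y, ∀ v w, G' z v w = G (φ z) (fderiv ℝ φ z v) (fderiv ℝ φ z w)) (v w : E) :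
    ricciCoord G' y v w = ricciCoord G (φ y) (fderiv ℝ φ y v) (fderiv ℝ φ y w) := by
  have hφy := hφ.self_of_nhds
  have hφc : ContinuousAt φ y := hφy.continuousAt
  have hs (u v : E) := (hφy.isSymmSndFDerivAt (by simp; norm_cast)).eq u v
  have hA' : ContDiffAt ℝ ∞ (fderiv ℝ φ) y := hφy.fderiv_right (by simp)
  -- Invertibility is an open condition. The transformation law of the Christoffel symbols is thus
  -- available near `y` and can be differentiated.
  have hinv' : ∀ᶠ z in 𝓝 y, (fderiv ℝ φ z).IsInvertible := by
    obtain ⟨A, hA⟩ := hinv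
    have := hA'.continuousAt.eventually_mem (hA ▸ A.nhds)
    filter_upwards [this] with z ⟨B, hB⟩ using ⟨B, hB⟩
  have hΓ : ∀ᶠ z in 𝓝 y, ∀ v w, fderiv ℝ φ z (christoffel G' z v w) =
      christoffel G (φ z) (fderiv ℝ φ z v) (fderiv ℝ φ z w) + fderiv ℝ (fderiv ℝ φ) z v w := by
    filter_upwards [hφ, hinv', hφc.eventually hG, hG', eventually_eventually_nhds.2 h]
      with z h1 h2 h3 h4 h5 v w
    exact christoffel_pullback h1 h2 (h3.1.differentiableAt (by simp))
      (h4.1.differentiableAt (by simp)) h3.2 h4.2 h5 v w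
  have hd := (contDiffAt_christoffel hG.self_of_nhds.2 hG.self_of_nhds.1).differentiableAt
    (by simp)
  have hd' := (contDiffAt_christoffel hG'.self_of_nhds.2 hG'.self_of_nhds.1).differentiableAt
    (by simp)
  have hD := fderiv_connection_pullback hφy hd hd' hΓ
  have hT (u v : E) : fderiv ℝ (fderiv ℝ (fderiv ℝ φ)) y u v =
      fderiv ℝ (fderiv ℝ (fderiv ℝ φ)) y v u :=
    (hA'.isSymmSndFDerivAt (by simp; norm_cast)).eq u v
  obtain ⟨A, hA⟩ := hinv
  -- The curvature is a tensor: antisymmetrizing the differentiated transformation law in `u`, `v`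
  -- cancels the third derivatives of `φ`. The second derivatives cancel against those produced by
  -- the quadratic terms (`f1`, `f2`).
  have key (u : E) : A (curvatureEnd G' y v w u) =
      curvatureEnd G (φ y) (fderiv ℝ φ y v) (fderiv ℝ φ y w) (A u) := by
    change A (connectionCurvatureEnd (christoffel G') y v w u) =
      connectionCurvatureEnd (christoffel G) (φ y) _ _ (A u)
    have e1 := hD u v w
    have e2 := hD v u w
    have f1 := hΓ.self_of_nhds u (christoffel G' y v w)
    have f2 := hΓ.self_of_nhds v (christoffel G' y u w)
    rw [hΓ.self_of_nhds v w, map_add] at f1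
    rw [hΓ.self_of_nhds u w, map_add] at f2
    rw [hs v u, hT v u] at e2
    have hAe (x : E) : A x = fderiv ℝ φ y x := by rw [← hA]; rfl
    rw [connectionCurvatureEnd_apply, connectionCurvatureEnd_apply, hAe, hAe, map_sub, map_add,
      map_sub, f1, f2, eq_sub_of_add_eq' e1, eq_sub_of_add_eq' e2]
    abel
  unfold ricciCoord
  -- The two curvature endomorphisms are conjugate by `dφ`, so they have the same trace.
  rw [← LinearMap.trace_conj' _ A.toLinearEquiv]
  congr 1
  ext u
  rw [LinearEquiv.conj_apply_apply]
  refine (key (A.symm u)).trans ?_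
  simp

end CoordinateRicci
end

noncomputable section

/-! ### The metric of the sphere bundle in stereographic coordinates -/

section Adiabatic

/-- A vector bundle with base metric, fibre metric and compatible connection over an open subset of
a normed space: the coefficients `g` and `k` of the metrics and the connection form `A`. -/
structure LocalBundleData (EB F : Type*) [NormedAddCommGroup EB] [NormedSpace ℝ EB]
    [NormedAddCommGroup F] [NormedSpace ℝ F] where
  U : Set EB
  isOpen : IsOpen U
  g : EB → EB →L[ℝ] EB →L[ℝ] ℝ
  k : EB → F →L[ℝ] F →L[ℝ] ℝ
  A : EB → EB →L[ℝ] F →L[ℝ] F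
  contDiffOn_g : ContDiffOn ℝ ∞ g U
  contDiffOn_k : ContDiffOn ℝ ∞ k U
  contDiffOn_A : ContDiffOn ℝ ∞ A U
  metric_g : ∀ x ∈ U, IsMetricForm (g x)
  metric_k : ∀ x ∈ U, IsMetricForm (k x)
  compat : ∀ x ∈ U, ∀ X a b, fderiv ℝ k x X a b = k x (A x X a) b + k x a (A x X b)

namespace LocalBundleData

variable {EB F : Type*} [NormedAddCommGroup EB] [NormedSpace ℝ EB]
  [NormedAddCommGroup F] [NormedSpace ℝ F] (d : LocalBundleData EB F)

/-- The square of the fibre norm. -/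
def normSq (z : EB × F) : ℝ := d.k z.1 z.2 z.2

/-- The vertical part of a tangent vector. -/
def θ (z : EB × F) : EB × F →L[ℝ] F :=
  ContinuousLinearMap.snd ℝ EB F +
    ((d.A z.1).flip z.2) ∘L ContinuousLinearMap.fst ℝ EB F

theorem θ_apply (z Z : EB × F) : d.θ z Z = Z.2 + d.A z.1 Z.1 z.2 := by simp [θ]

/-- The metric of the sphere bundle of radius `√ε` in stereographic coordinates of the fibres. -/
def sphereMetric (ε : ℝ) (z : EB × F) : EB × F →L[ℝ] EB × F →L[ℝ] ℝ :=
  (d.g z.1).bilinearComp (ContinuousLinearMap.fst ℝ EB F) (ContinuousLinearMap.fst ℝ EB F) +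
    (ε * (4 / (1 + d.normSq z) ^ 2)) • (d.k z.1).bilinearComp (d.θ z) (d.θ z)

theorem sphereMetric_apply (ε : ℝ) (z Z W : EB × F) : d.sphereMetric ε z Z W =
    d.g z.1 Z.1 W.1 + ε * (4 / (1 + d.normSq z) ^ 2) * d.k z.1 (d.θ z Z) (d.θ z W) := by
  simp [sphereMetric]

/-- The derivative in direction `Z` of the vertical part of the constant vector field `W`. -/
def dθ (z Z W : EB × F) : F := fderiv ℝ d.A z.1 Z.1 W.1 z.2 + d.A z.1 W.1 Z.2

/-- The covariant derivative in direction `Z` of the vertical part of `W`. -/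
def Dθ (z Z W : EB × F) : F := d.A z.1 Z.1 (d.θ z W) + d.dθ z Z W

/-- The Christoffel symbols of the fibres. -/
def fibreΓ (z : EB × F) (a b : F) : F :=
  (-2 / (1 + d.normSq z)) • (d.k z.1 z.2 a • b + d.k z.1 z.2 b • a - d.k z.1 a b • z.2)

/-- The vertical part of the Christoffel symbols. -/
def vertΓ (z Z W : EB × F) : F :=
  d.fibreΓ z (d.θ z Z) (d.θ z W) + (1 / 2 : ℝ) • (d.Dθ z Z W + d.Dθ z W Z)

variable {d} {z : EB × F}

theorem normSq_nonneg (hz : z.1 ∈ d.U) : 0 ≤ d.normSq z := by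
  by_cases h : z.2 = 0
  · simp [normSq, h]
  · exact ((d.metric_k _ hz).pos _ h).le

theorem one_add_normSq_pos (hz : z.1 ∈ d.U) : 0 < 1 + d.normSq z := by
  linarith [normSq_nonneg hz]

theorem contDiffAt_g {x : EB} (hx : x ∈ d.U) : ContDiffAt ℝ ∞ d.g x :=
  d.contDiffOn_g.contDiffAt (d.isOpen.mem_nhds hx)

theorem contDiffAt_k {x : EB} (hx : x ∈ d.U) : ContDiffAt ℝ ∞ d.k x :=
  d.contDiffOn_k.contDiffAt (d.isOpen.mem_nhds hx)

theorem contDiffAt_A {x : EB} (hx : x ∈ d.U) : ContDiffAt ℝ ∞ d.A x :=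
  d.contDiffOn_A.contDiffAt (d.isOpen.mem_nhds hx)

variable (d) in
theorem isOpen_domain : IsOpen {z : EB × F | z.1 ∈ d.U} := d.isOpen.preimage continuous_fst

theorem contDiffAt_normSq (hz : z.1 ∈ d.U) : ContDiffAt ℝ ∞ d.normSq z :=
  (((contDiffAt_k hz).comp z contDiffAt_fst).clm_apply contDiffAt_snd).clm_apply contDiffAt_snd

theorem contDiffAt_θ (hz : z.1 ∈ d.U) : ContDiffAt ℝ ∞ d.θ z := by
  refine contDiffAt_const.add (ContDiffAt.clm_comp ?_ contDiffAt_const)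
  refine ContDiffAt.clm_apply ?_ contDiffAt_snd
  exact (ContinuousLinearMap.flipₗᵢ ℝ EB F F).contDiff.contDiffAt.comp z
    ((contDiffAt_A hz).comp z contDiffAt_fst)

theorem contDiffAt_sphereMetric [FiniteDimensional ℝ EB] [FiniteDimensional ℝ F] (ε : ℝ)
    (hz : z.1 ∈ d.U) : ContDiffAt ℝ ∞ (d.sphereMetric ε) z := by
  have h : ContDiffOn ℝ ∞ (d.sphereMetric ε) {z | z.1 ∈ d.U} := by
    refine contDiffOn_clm_apply.2 fun Z ↦ contDiffOn_clm_apply.2 fun W ↦ ?_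
    intro z hz
    refine ContDiffAt.contDiffWithinAt ?_
    simp only [sphereMetric_apply]
    have hk := (contDiffAt_k hz).comp z contDiffAt_fst
    have hg := (contDiffAt_g hz).comp z contDiffAt_fst
    have hu := contDiffAt_normSq hz
    have hp := (one_add_normSq_pos hz).ne'
    have hθ := contDiffAt_θ hz
    refine ((hg.clm_apply contDiffAt_const).clm_apply contDiffAt_const).add ?_
    refine (contDiffAt_const.mul (contDiffAt_const.div ((contDiffAt_const.add hu).pow 2)
      (pow_ne_zero 2 hp))).mul ?_
    exact (hk.clm_apply (hθ.clm_apply contDiffAt_const)).clm_apply (hθ.clm_apply contDiffAt_const)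
  exact h.contDiffAt (d.isOpen_domain.mem_nhds hz)

theorem isMetricForm_sphereMetric {ε : ℝ} (hε : 0 < ε) (hz : z.1 ∈ d.U) :
    IsMetricForm (d.sphereMetric ε z) := by
  have hp := one_add_normSq_pos hz
  refine ⟨fun Z W ↦ ?_, fun Z hZ ↦ ?_⟩
  · rw [sphereMetric_apply, sphereMetric_apply, (d.metric_g _ hz).symm,
      (d.metric_k _ hz).symm (d.θ z Z)]
  · rw [sphereMetric_apply]
    have hc : 0 < ε * (4 / (1 + d.normSq z) ^ 2) := by positivity
    by_cases h1 : Z.1 = 0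
    · have h2 : Z.2 ≠ 0 := fun h2 ↦ hZ (Prod.ext h1 h2)
      have : 0 < d.k z.1 Z.2 Z.2 := (d.metric_k _ hz).pos _ h2
      simp only [h1, θ_apply]
      simp
      positivity
    · have := (d.metric_g _ hz).pos _ h1
      have h3 : 0 ≤ d.k z.1 (d.θ z Z) (d.θ z Z) := by
        by_cases h : d.θ z Z = 0
        · rw [h]; simp
        · exact ((d.metric_k _ hz).pos _ h).le
      positivity

/-! ### Derivatives along lines -/

theorem hasDerivAt_line {W : Type*} [NormedAddCommGroup W] [NormedSpace ℝ W]
    {f : EB × F → W} (hf : DifferentiableAt ℝ f z) (V : EB × F) :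
    HasDerivAt (fun t : ℝ ↦ f (z + t • V)) (fderiv ℝ f z V) 0 :=
  hf.hasFDerivAt.hasLineDerivAt V

/-- Metric compatibility as a product rule: the derivative of `⟨a, b⟩` is `⟨∇a, b⟩ + ⟨a, ∇b⟩`. After
this, the derivative of `k` no longer occurs in the computations. -/
theorem hasDerivAt_k_apply (hz : z.1 ∈ d.U) (V : EB × F) {a b : ℝ → F} {a' b' : F}
    (ha : HasDerivAt a a' 0) (hb : HasDerivAt b b' 0) :
    HasDerivAt (fun t : ℝ ↦ d.k (z + t • V).1 (a t) (b t))
      (d.k z.1 (d.A z.1 V.1 (a 0) + a') (b 0) + d.k z.1 (a 0) (d.A z.1 V.1 (b 0) + b')) 0 := by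
  have h1 : HasDerivAt (fun t : ℝ ↦ d.k (z + t • V).1) (fderiv ℝ d.k z.1 V.1) 0 := by
    have := ((contDiffAt_k hz).differentiableAt (by simp)).hasFDerivAt.hasLineDerivAt V.1
    simpa [HasLineDerivAt] using this
  refine ((h1.clm_apply ha).clm_apply hb).congr_deriv ?_
  simp [d.compat _ hz]
  ring

theorem hasDerivAt_snd (z V : EB × F) : HasDerivAt (fun t : ℝ ↦ (z + t • V).2) V.2 0 := by
  simpa using ((hasDerivAt_id (0 : ℝ)).smul_const V.2).const_add z.2

/-- The covariant derivative of the tautological section `y` is `θ`. In particular `|y|²` is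
constant in horizontal directions. -/
theorem hasDerivAt_normSq (hz : z.1 ∈ d.U) (V : EB × F) :
    HasDerivAt (fun t : ℝ ↦ d.normSq (z + t • V)) (2 * d.k z.1 z.2 (d.θ z V)) 0 := by
  refine (hasDerivAt_k_apply hz V (hasDerivAt_snd z V) (hasDerivAt_snd z V)).congr_deriv ?_
  rw [(d.metric_k _ hz).symm]
  simp [θ_apply]
  ring

theorem hasDerivAt_A (hz : z.1 ∈ d.U) (V : EB × F) :
    HasDerivAt (fun t : ℝ ↦ d.A (z + t • V).1) (fderiv ℝ d.A z.1 V.1) 0 := by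
  have := ((contDiffAt_A hz).differentiableAt (by simp)).hasFDerivAt.hasLineDerivAt V.1
  simpa [HasLineDerivAt] using this

theorem hasDerivAt_θ (hz : z.1 ∈ d.U) (V W : EB × F) :
    HasDerivAt (fun t : ℝ ↦ d.θ (z + t • V) W) (d.dθ z V W) 0 := by
  simp only [θ_apply]
  have h := (((hasDerivAt_A hz V).clm_apply (hasDerivAt_const 0 W.1)).clm_apply
    (hasDerivAt_snd z V)).const_add W.2
  refine h.congr_deriv ?_
  simp [dθ]

theorem hasDerivAt_k_θ (hz : z.1 ∈ d.U) (V P Q : EB × F) :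
    HasDerivAt (fun t : ℝ ↦ d.k (z + t • V).1 (d.θ (z + t • V) P) (d.θ (z + t • V) Q))
      (d.k z.1 (d.Dθ z V P) (d.θ z Q) + d.k z.1 (d.θ z P) (d.Dθ z V Q)) 0 := by
  refine (hasDerivAt_k_apply hz V (hasDerivAt_θ hz V P) (hasDerivAt_θ hz V Q)).congr_deriv ?_
  simp [Dθ]

/-- The factor `-4/(1+|y|²) · k(y, θ V)` is the logarithmic derivative of the conformal factor
`4/(1+|y|²)²`. The rest is the product rule for the metric connection. -/
theorem fderiv_sphereMetric [FiniteDimensional ℝ EB] [FiniteDimensional ℝ F] (ε : ℝ)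
    (hz : z.1 ∈ d.U) (V P Q : EB × F) :
    fderiv ℝ (d.sphereMetric ε) z V P Q = fderiv ℝ d.g z.1 V.1 P.1 Q.1 +
      ε * (4 / (1 + d.normSq z) ^ 2) *
        (-4 / (1 + d.normSq z) * d.k z.1 z.2 (d.θ z V) * d.k z.1 (d.θ z P) (d.θ z Q) +
        (d.k z.1 (d.Dθ z V P) (d.θ z Q) + d.k z.1 (d.θ z P) (d.Dθ z V Q))) := by
  have hp := (one_add_normSq_pos hz).ne'
  have h1 := (((hasDerivAt_line ((contDiffAt_sphereMetric ε hz).differentiableAt (by simp))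
    V).clm_apply (hasDerivAt_const 0 P)).clm_apply (hasDerivAt_const 0 Q))
  have hg : HasDerivAt (fun t : ℝ ↦ d.g (z + t • V).1) (fderiv ℝ d.g z.1 V.1) 0 := by
    have := ((contDiffAt_g hz).differentiableAt (by simp)).hasFDerivAt.hasLineDerivAt V.1
    simpa [HasLineDerivAt] using this
  have hg2 := (hg.clm_apply (hasDerivAt_const 0 P.1)).clm_apply (hasDerivAt_const 0 Q.1)
  have hu := ((hasDerivAt_normSq hz V).const_add 1).pow 2
  have hq := (((hasDerivAt_const (0 : ℝ) (4 : ℝ)).div hu (by simpa using pow_ne_zero 2 hp)).const_mul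
    ε).mul (hasDerivAt_k_θ hz V P Q)
  have h2 := h1.unique ((hg2.add hq).congr_of_eventuallyEq (Filter.Eventually.of_forall fun t ↦ by
    simp [sphereMetric_apply]))
  simp at h2
  rw [h2]
  field_simp
  ring

end LocalBundleData

end Adiabatic
end

noncomputable section

/-! ### The adiabatic limit of the Christoffel symbols -/

namespace LocalBundleData

variable {EB F : Type*} [NormedAddCommGroup EB] [NormedSpace ℝ EB]
  [NormedAddCommGroup F] [NormedSpace ℝ F] {d : LocalBundleData EB F} {z : EB × F}

theorem θ_vert (Y : F) : d.θ z (0, Y) = Y := by simp [θ_apply]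

theorem θ_horizontal (X : EB) : d.θ z (X, -d.A z.1 X z.2) = 0 := by simp [θ_apply]

theorem Dθ_vert_left (Y : F) (W : EB × F) : d.Dθ z (0, Y) W = d.A z.1 W.1 Y := by
  simp [Dθ, dθ]

theorem Dθ_vert_right (Z : EB × F) (Y : F) : d.Dθ z Z (0, Y) = d.A z.1 Z.1 Y := by
  simp [Dθ, dθ, θ_vert]

/-- Base component and vertical part are linear coordinates on the tangent vectors at a point. The
Christoffel symbols are compared in these, because `ε` enters each of them in a simple way. -/
theorem ext_of_fst_of_θ {Z W : EB × F} (h1 : Z.1 = W.1) (h2 : d.θ z Z = d.θ z W) : Z = W := by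
  refine Prod.ext h1 ?_
  simpa [θ_apply, h1] using h2

variable (d) in
/-- The contribution of the fibre metric to the Christoffel symbols of the first kind, up to the
conformal factor. -/
def fibreFirst (z Z W T : EB × F) : ℝ :=
  -2 / (1 + d.normSq z) * (d.k z.1 z.2 (d.θ z Z) * d.k z.1 (d.θ z W) (d.θ z T) +
    d.k z.1 z.2 (d.θ z W) * d.k z.1 (d.θ z Z) (d.θ z T) -
    d.k z.1 z.2 (d.θ z T) * d.k z.1 (d.θ z Z) (d.θ z W)) +
  1 / 2 * (d.k z.1 (d.Dθ z Z W) (d.θ z T) + d.k z.1 (d.θ z W) (d.Dθ z Z T) +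
    (d.k z.1 (d.Dθ z W Z) (d.θ z T) + d.k z.1 (d.θ z Z) (d.Dθ z W T)) -
    (d.k z.1 (d.Dθ z T Z) (d.θ z W) + d.k z.1 (d.θ z Z) (d.Dθ z T W)))

/-- For a vertical test vector `Y`, the terms `k(θ W, A_Z Y)` and `k(θ Z, A_W Y)` of the Koszul
formula occur twice with opposite signs. What remains is a scalar product with `Y`. -/
theorem fibreFirst_vert (hz : z.1 ∈ d.U) (Z W : EB × F) (Y : F) :
    d.fibreFirst z Z W (0, Y) = d.k z.1 (d.vertΓ z Z W) Y := by
  have hs := (d.metric_k _ hz).symm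
  simp only [fibreFirst, θ_vert, Dθ_vert_left, Dθ_vert_right, vertΓ, fibreΓ, map_add, map_sub,
    map_smul, add_apply, sub_apply, smul_apply, smul_eq_mul, hs (d.θ z W) (d.A z.1 Z.1 Y),
    hs (d.θ z Z) Y, hs (d.θ z W) Y, hs z.2 Y]
  ring

theorem vertΓ_comm (hz : z.1 ∈ d.U) (Z W : EB × F) : d.vertΓ z Z W = d.vertΓ z W Z := by
  simp only [vertΓ, fibreΓ, (d.metric_k _ hz).symm (d.θ z Z) (d.θ z W)]
  module

variable [FiniteDimensional ℝ EB] [FiniteDimensional ℝ F]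

theorem christoffelFirst_sphereMetric (ε : ℝ) (hz : z.1 ∈ d.U) (Z W T : EB × F) :
    christoffelFirst (d.sphereMetric ε) z Z W T = christoffelFirst d.g z.1 Z.1 W.1 T.1 +
      ε * (4 / (1 + d.normSq z) ^ 2) * d.fibreFirst z Z W T := by
  rw [christoffelFirst_apply, christoffelFirst_apply, fderiv_sphereMetric ε hz,
    fderiv_sphereMetric ε hz, fderiv_sphereMetric ε hz, fibreFirst]
  ring

/-- Against a vertical test vector the base metric contributes nothing, and the positive factor `ε ·
4/(1+|y|²)²` is common to both sides. The vertical part therefore does not depend on `ε`. -/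
theorem θ_christoffel {ε : ℝ} (hε : 0 < ε) (hz : z.1 ∈ d.U) (Z W : EB × F) :
    d.θ z (christoffel (d.sphereMetric ε) z Z W) = d.vertΓ z Z W := by
  refine (d.metric_k _ hz).eq_of_forall fun Y ↦ ?_
  have h := metric_christoffel_apply (isMetricForm_sphereMetric hε hz) Z W (0, Y)
  rw [christoffelFirst_sphereMetric ε hz, fibreFirst_vert hz, sphereMetric_apply, θ_vert] at h
  have hp := one_add_normSq_pos hz
  have hc : ε * (4 / (1 + d.normSq z) ^ 2) ≠ 0 := by positivity
  simp only [map_zero, zero_add] at h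
  exact mul_left_cancel₀ hc h

/-- Against the horizontal lift of `X` the fibre term of the metric vanishes, so no division by `ε`
takes place and the base component is affine in `ε`. -/
theorem fst_christoffel {ε : ℝ} (hε : 0 < ε) (hz : z.1 ∈ d.U) (Z W : EB × F) (X : EB) :
    d.g z.1 (christoffel (d.sphereMetric ε) z Z W).1 X = christoffelFirst d.g z.1 Z.1 W.1 X +
      ε * (4 / (1 + d.normSq z) ^ 2 * d.fibreFirst z Z W (X, -d.A z.1 X z.2)) := by
  have h := metric_christoffel_apply (isMetricForm_sphereMetric hε hz) Z W (X, -d.A z.1 X z.2)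
  rw [christoffelFirst_sphereMetric ε hz, sphereMetric_apply, θ_horizontal] at h
  simp only [map_zero, mul_zero, add_zero] at h
  rw [h]
  ring

variable (d) in
/-- The limit of the Christoffel symbols for `ε → 0`. -/
def limitΓ (z : EB × F) : EB × F →L[ℝ] EB × F →L[ℝ] EB × F :=
  -- Affine extrapolation to `ε = 0` from the two genuine metrics at `ε = 1` and `ε = 2`, so that
  -- smoothness is inherited from them.
  (2 : ℝ) • christoffel (d.sphereMetric 1) z - christoffel (d.sphereMetric 2) z

variable (d) in
/-- The derivative of the Christoffel symbols with respect to `ε`. -/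
def slopeΓ (z : EB × F) : EB × F →L[ℝ] EB × F →L[ℝ] EB × F :=
  christoffel (d.sphereMetric 2) z - christoffel (d.sphereMetric 1) z

theorem contDiffAt_limitΓ (hz : z.1 ∈ d.U) : ContDiffAt ℝ ∞ d.limitΓ z :=
  ((contDiffAt_christoffel (isMetricForm_sphereMetric one_pos hz)
    (contDiffAt_sphereMetric 1 hz)).const_smul (2 : ℝ)).sub
  (contDiffAt_christoffel (isMetricForm_sphereMetric two_pos hz) (contDiffAt_sphereMetric 2 hz))

theorem contDiffAt_slopeΓ (hz : z.1 ∈ d.U) : ContDiffAt ℝ ∞ d.slopeΓ z :=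
  (contDiffAt_christoffel (isMetricForm_sphereMetric two_pos hz)
    (contDiffAt_sphereMetric 2 hz)).sub
  (contDiffAt_christoffel (isMetricForm_sphereMetric one_pos hz) (contDiffAt_sphereMetric 1 hz))

/-- The vertical part is constant and the base component is affine in `ε`, so the symbols are the
affine function determined by their values at `1` and `2`. This turns the collapse of the fibres
into a regular perturbation. -/
theorem christoffel_sphereMetric {ε : ℝ} (hε : 0 < ε) (hz : z.1 ∈ d.U) :
    christoffel (d.sphereMetric ε) z = d.limitΓ z + ε • d.slopeΓ z := by
  refine ContinuousLinearMap.ext fun Z ↦ ContinuousLinearMap.ext fun W ↦ ?_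
  refine ext_of_fst_of_θ (d := d) (z := z) ((d.metric_g _ hz).eq_of_forall fun X ↦ ?_) ?_
  · simp only [limitΓ, slopeΓ, add_apply, sub_apply, smul_apply, Prod.fst_add, Prod.fst_sub,
      Prod.smul_fst, map_add, map_sub, map_smul, smul_eq_mul, fst_christoffel hε hz,
      fst_christoffel one_pos hz, fst_christoffel two_pos hz]
    ring
  · simp only [limitΓ, slopeΓ, add_apply, sub_apply, smul_apply, map_add, map_sub, map_smul,
      θ_christoffel hε hz, θ_christoffel one_pos hz, θ_christoffel two_pos hz]
    module

/-- The limit connection projects to the Levi-Civita connection of the base. This is why the base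
block of its curvature is the curvature of the base. -/
theorem fst_limitΓ (hz : z.1 ∈ d.U) (Z W : EB × F) :
    (d.limitΓ z Z W).1 = christoffel d.g z.1 Z.1 W.1 := by
  refine (d.metric_g _ hz).eq_of_forall fun X ↦ ?_
  rw [metric_christoffel_apply (d.metric_g _ hz)]
  simp only [limitΓ, sub_apply, smul_apply, Prod.fst_sub,
    Prod.smul_fst, map_sub, map_smul, smul_eq_mul,
    fst_christoffel one_pos hz, fst_christoffel two_pos hz]
  ring

theorem θ_limitΓ (hz : z.1 ∈ d.U) (Z W : EB × F) :
    d.θ z (d.limitΓ z Z W) = d.vertΓ z Z W := by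
  simp only [limitΓ, sub_apply, smul_apply, map_sub, map_smul,
    θ_christoffel one_pos hz, θ_christoffel two_pos hz]
  module

theorem snd_limitΓ (hz : z.1 ∈ d.U) (Z W : EB × F) :
    (d.limitΓ z Z W).2 = d.vertΓ z Z W - d.A z.1 (christoffel d.g z.1 Z.1 W.1) z.2 := by
  rw [← θ_limitΓ hz, θ_apply, fst_limitΓ hz]
  abel

theorem snd_limitΓ_vert_left (hz : z.1 ∈ d.U) (Y : F) (W : EB × F) :
    (d.limitΓ z (0, Y) W).2 = d.fibreΓ z Y (d.θ z W) + d.A z.1 W.1 Y := by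
  rw [snd_limitΓ hz, vertΓ, θ_vert, Dθ_vert_left, Dθ_vert_right]
  simp only [map_zero, zero_apply]
  module

theorem snd_limitΓ_vert_right (hz : z.1 ∈ d.U) (W : EB × F) (Y : F) :
    (d.limitΓ z W (0, Y)).2 = d.fibreΓ z Y (d.θ z W) + d.A z.1 W.1 Y := by
  rw [← snd_limitΓ_vert_left hz, snd_limitΓ hz, snd_limitΓ hz, vertΓ_comm hz]
  simp

end LocalBundleData
end

noncomputable section

/-! ### The Ricci tensor of the adiabatic limit -/

/-! ### Traces of rank-one maps, of the fibre curvature and of block endomorphisms -/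

section Trace

variable {F : Type*} [AddCommGroup F] [Module ℝ F]

theorem smulRight_comp (l : F →ₗ[ℝ] ℝ) (v : F) (f : F →ₗ[ℝ] F) :
    l.smulRight v ∘ₗ f = (l ∘ₗ f).smulRight v := by ext; simp

theorem comp_smulRight (l : F →ₗ[ℝ] ℝ) (v : F) (f : F →ₗ[ℝ] F) :
    f ∘ₗ l.smulRight v = l.smulRight (f v) := by ext; simp

variable [FiniteDimensional ℝ F]

theorem trace_smulRight (l : F →ₗ[ℝ] ℝ) (v : F) : LinearMap.trace ℝ F (l.smulRight v) = l v := by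
  have := LinearMap.trace_comp_comm' (l : F →ₗ[ℝ] ℝ) (LinearMap.toSpanSingleton ℝ F v)
  have h1 : LinearMap.toSpanSingleton ℝ F v ∘ₗ l = l.smulRight v := by ext; simp
  have h2 : l ∘ₗ LinearMap.toSpanSingleton ℝ F v = l v • LinearMap.id := by ext; simp
  rw [h1, h2] at this
  simp [this]

/-- The trace computation behind the Ricci curvature of a round sphere in stereographic
coordinates, in the presence of a connection. -/
theorem trace_fibreRicci (κ : F →ₗ[ℝ] F →ₗ[ℝ] ℝ) (hκ : ∀ v w, κ v w = κ w v)
    (w : F →ₗ[ℝ] F) (y a q b D : F) (hpos : 1 + κ y y ≠ 0) (s : ℝ) (hs : s = -2 / (1 + κ y y))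
    (hD : D = w a + q) (hb : b = s • ((2 * κ y a) • a - κ a a • y) + D)
    (Q : F →ₗ[ℝ] F)
    (hQ : Q = s • ((κ y).smulRight a + κ y a • LinearMap.id - (κ a).smulRight y) + w) :
    LinearMap.trace ℝ F
      ((s ^ 2 • (κ y).smulRight ((2 * κ y a) • a - κ a a • y) +
        s • ((2 : ℝ) • (κ a + κ y ∘ₗ w).smulRight a + (2 * κ y a) • w -
          (2 : ℝ) • (κ a ∘ₗ w).smulRight y - κ a a • LinearMap.id) + w ∘ₗ w) -
      ((s ^ 2 * κ y a) • ((κ y).smulRight a + κ y a • LinearMap.id - (κ a).smulRight y) +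
        s • ((κ a + κ y ∘ₗ w).smulRight a + (κ y).smulRight q +
          (κ a a + κ y D) • LinearMap.id - (κ a ∘ₗ w + κ D).smulRight y -
          (κ a).smulRight (a - w y))) +
      s • ((κ y).smulRight b + κ y b • LinearMap.id - (κ b).smulRight y) -
      Q ∘ₗ Q) =
    (Module.finrank ℝ F - 1) * (4 / (1 + κ y y) ^ 2) * κ a a := by
  subst hQ
  simp only [LinearMap.comp_add, LinearMap.add_comp, LinearMap.comp_sub, LinearMap.sub_comp,
    LinearMap.comp_smul, LinearMap.smul_comp, smulRight_comp, comp_smulRight, LinearMap.comp_id,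
    LinearMap.id_comp, map_add, map_sub, map_smul, trace_smulRight, LinearMap.trace_id, smul_eq_mul,
    LinearMap.add_apply, LinearMap.comp_apply, LinearMap.smulRight_apply]
  subst hb hD
  simp only [map_add, map_sub, map_smul, LinearMap.add_apply, LinearMap.sub_apply,
    LinearMap.smul_apply, smul_eq_mul, hκ a y, hκ (w a) y, hκ q y]
  -- All terms with `w`, `q` and `D` cancel in the trace. The remaining identity needs only this
  -- relation between `s` and `|y|²`, and `4/(1+|y|²)² = s²`.
  have hs2 : s * (1 + κ y y) = -2 := by rw [hs]; field_simp
  have h4 : 4 / (1 + κ y y) ^ 2 = s ^ 2 := by rw [hs]; field_simp; norm_num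
  rw [h4]
  generalize (Module.finrank ℝ F : ℝ) = n
  linear_combination (-(n - 1) * s * κ a a) * hs2

theorem trace_prod {E : Type*} [AddCommGroup E] [Module ℝ E] [FiniteDimensional ℝ E]
    (L : E × F →ₗ[ℝ] E × F) : LinearMap.trace ℝ (E × F) L =
      LinearMap.trace ℝ E (LinearMap.fst ℝ E F ∘ₗ L ∘ₗ LinearMap.inl ℝ E F) +
      LinearMap.trace ℝ F (LinearMap.snd ℝ E F ∘ₗ L ∘ₗ LinearMap.inr ℝ E F) := by
  have h : L = (L ∘ₗ LinearMap.inl ℝ E F) ∘ₗ LinearMap.fst ℝ E F +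
      (L ∘ₗ LinearMap.inr ℝ E F) ∘ₗ LinearMap.snd ℝ E F := by
    refine LinearMap.ext fun z ↦ ?_
    simp [← map_add]
  conv_lhs => rw [h]
  rw [map_add, LinearMap.trace_comp_comm', LinearMap.trace_comp_comm' (LinearMap.snd ℝ E F)]

end Trace

namespace LocalBundleData

variable {EB F : Type*} [NormedAddCommGroup EB] [NormedSpace ℝ EB]
  [NormedAddCommGroup F] [NormedSpace ℝ F] {d : LocalBundleData EB F} {z : EB × F}

/-- Product rule in covariant form. With `s = -2/(1+|y|²)` the derivative of the coefficient is `s²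
k(y, θ V)`, which keeps everything polynomial in `s`. -/
theorem hasDerivAt_fibreΓ (hz : z.1 ∈ d.U) (V : EB × F) {a b : ℝ → F} {a₀ b₀ a' b' : F}
    (ha : HasDerivAt a a' 0) (hb : HasDerivAt b b' 0) (ha0 : a 0 = a₀) (hb0 : b 0 = b₀) :
    HasDerivAt (fun t : ℝ ↦ d.fibreΓ (z + t • V) (a t) (b t))
      (((-2 / (1 + d.normSq z)) ^ 2 * d.k z.1 z.2 (d.θ z V)) •
        (d.k z.1 z.2 a₀ • b₀ + d.k z.1 z.2 b₀ • a₀ - d.k z.1 a₀ b₀ • z.2) +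
      (-2 / (1 + d.normSq z)) •
        (((d.k z.1 (d.θ z V) a₀ + d.k z.1 z.2 (d.A z.1 V.1 a₀ + a')) • b₀ + d.k z.1 z.2 a₀ • b') +
        ((d.k z.1 (d.θ z V) b₀ + d.k z.1 z.2 (d.A z.1 V.1 b₀ + b')) • a₀ + d.k z.1 z.2 b₀ • a') -
        ((d.k z.1 (d.A z.1 V.1 a₀ + a') b₀ + d.k z.1 a₀ (d.A z.1 V.1 b₀ + b')) • z.2 +
          d.k z.1 a₀ b₀ • V.2))) 0 := by
  subst ha0 hb0
  have hp := (one_add_normSq_pos hz).ne'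
  have hy := hasDerivAt_snd z V
  have hs := (hasDerivAt_const (0 : ℝ) (-2 : ℝ)).div ((hasDerivAt_normSq hz V).const_add 1)
    (by simpa using hp)
  have h := hs.smul ((((hasDerivAt_k_apply hz V hy ha).smul hb).add
    ((hasDerivAt_k_apply hz V hy hb).smul ha)).sub ((hasDerivAt_k_apply hz V ha hb).smul hy))
  refine h.congr_deriv ?_
  simp only [zero_smul, add_zero, Pi.div_apply, Pi.add_apply, Pi.sub_apply]
  have e1 : d.A z.1 V.1 z.2 + V.2 = d.θ z V := by rw [θ_apply, add_comm]
  have e2 : (0 * (1 + d.normSq z) - -2 * (2 * d.k z.1 z.2 (d.θ z V))) / (1 + d.normSq z) ^ 2 =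
      (-2 / (1 + d.normSq z)) ^ 2 * d.k z.1 z.2 (d.θ z V) := by
    field_simp; ring
  rw [e1, e2]
  simp
  module

theorem eventually_line_mem (hz : z.1 ∈ d.U) (V : EB × F) :
    ∀ᶠ t : ℝ in 𝓝 0, (z + t • V).1 ∈ d.U := by
  have hc : Continuous fun t : ℝ ↦ (z + t • V).1 := by fun_prop
  exact hc.continuousAt.eventually_mem (d.isOpen.mem_nhds (by simpa using hz))

variable [FiniteDimensional ℝ EB] [FiniteDimensional ℝ F]

theorem hasDerivAt_limitΓ (hz : z.1 ∈ d.U) (V P Q : EB × F) :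
    HasDerivAt (fun t : ℝ ↦ d.limitΓ (z + t • V) P Q) (fderiv ℝ d.limitΓ z V P Q) 0 := by
  have h := ((hasDerivAt_line ((contDiffAt_limitΓ hz).differentiableAt (by simp)) V).clm_apply
    (hasDerivAt_const 0 P)).clm_apply (hasDerivAt_const 0 Q)
  refine h.congr_deriv ?_
  simp

theorem fst_fderiv_limitΓ (hz : z.1 ∈ d.U) (V P Q : EB × F) :
    (fderiv ℝ d.limitΓ z V P Q).1 = fderiv ℝ (christoffel d.g) z.1 V.1 P.1 Q.1 := by
  have hc := (contDiffAt_christoffel (d.metric_g _ hz) (contDiffAt_g hz)).differentiableAt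
    (by simp)
  have h1 : HasDerivAt (fun t : ℝ ↦ christoffel d.g (z + t • V).1)
      (fderiv ℝ (christoffel d.g) z.1 V.1) 0 := by
    simpa [HasLineDerivAt] using hc.hasFDerivAt.hasLineDerivAt V.1
  have h2 := (h1.clm_apply (hasDerivAt_const 0 P.1)).clm_apply (hasDerivAt_const 0 Q.1)
  have h3 := (ContinuousLinearMap.fst ℝ EB F).hasFDerivAt.comp_hasDerivAt 0
    (hasDerivAt_limitΓ hz V P Q)
  have h4 := h3.unique (h2.congr_of_eventuallyEq (by
    filter_upwards [eventually_line_mem hz V] with t ht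
    exact fst_limitΓ ht P Q))
  simpa using h4

/-- The vertical component of `∂_Y Γ₀(V, V)` for a fibre direction `Y`, the first term of the
curvature endomorphism on the fibre block. Only `y` moves, so `g`, `k` and `A` are constant along
the line. -/
theorem snd_fderiv_limitΓ_vert (hz : z.1 ∈ d.U) (V : EB × F) (Y : F) :
    (fderiv ℝ d.limitΓ z (0, Y) V V).2 =
      ((-2 / (1 + d.normSq z)) ^ 2 * d.k z.1 z.2 Y) •
        ((2 * d.k z.1 z.2 (d.θ z V)) • d.θ z V - d.k z.1 (d.θ z V) (d.θ z V) • z.2) +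
      (-2 / (1 + d.normSq z)) •
        ((2 : ℝ) • ((d.k z.1 (d.θ z V) Y + d.k z.1 z.2 (d.A z.1 V.1 Y)) • d.θ z V) +
        (2 * d.k z.1 z.2 (d.θ z V)) • d.A z.1 V.1 Y -
        (2 : ℝ) • (d.k z.1 (d.θ z V) (d.A z.1 V.1 Y) • z.2) - d.k z.1 (d.θ z V) (d.θ z V) • Y) +
      d.A z.1 V.1 (d.A z.1 V.1 Y) + fderiv ℝ d.A z.1 V.1 V.1 Y -
      d.A z.1 (christoffel d.g z.1 V.1 V.1) Y := by
  have hsymm := (d.metric_k _ hz).symm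
  have hθ := hasDerivAt_θ hz (0, Y) V
  have hy := hasDerivAt_snd z (0, Y)
  have hf := hasDerivAt_fibreΓ hz (0, Y) (a₀ := d.θ z V) (b₀ := d.θ z V) hθ hθ
    (by simp) (by simp)
  have hA (L : F →L[ℝ] F) {c : ℝ → F} {c' : F} (hc : HasDerivAt c c' 0) :
      HasDerivAt (fun t ↦ L (c t)) (L c') 0 := L.hasFDerivAt.comp_hasDerivAt 0 hc
  have hD := ((hA (d.A z.1 V.1) hθ).add (hA (fderiv ℝ d.A z.1 V.1 V.1) hy)).add_const
    (d.A z.1 V.1 V.2)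
  have h1 := (hf.add hD).sub (hA (d.A z.1 (christoffel d.g z.1 V.1 V.1)) hy)
  have h2 := (ContinuousLinearMap.snd ℝ EB F).hasFDerivAt.comp_hasDerivAt 0
    (hasDerivAt_limitΓ hz (0, Y) V V)
  have h3 := h2.unique (h1.congr_of_eventuallyEq (by
    filter_upwards [eventually_line_mem hz (0, Y)] with t ht
    refine (snd_limitΓ ht V V).trans ?_
    have e : (z + t • ((0, Y) : EB × F)).1 = z.1 := by simp
    simp only [vertΓ, Dθ, dθ, e, Pi.add_apply, Pi.sub_apply]
    module))
  refine h3.trans ?_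
  have e : d.dθ z (0, Y) V = d.A z.1 V.1 Y := by simp [dθ]
  simp only [e, θ_vert, map_zero, zero_apply, zero_add, hsymm Y (d.θ z V),
    hsymm (d.A z.1 V.1 Y) (d.θ z V)]
  module

/-- The vertical component of `∂_V Γ₀(Y, V)`, the second term of the curvature endomorphism on the
fibre block. The direction `V` is arbitrary. -/
theorem snd_fderiv_limitΓ_horizontal (hz : z.1 ∈ d.U) (V : EB × F) (Y : F) :
    (fderiv ℝ d.limitΓ z V (0, Y) V).2 =
      ((-2 / (1 + d.normSq z)) ^ 2 * d.k z.1 z.2 (d.θ z V)) •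
        (d.k z.1 z.2 Y • d.θ z V + d.k z.1 z.2 (d.θ z V) • Y - d.k z.1 (d.θ z V) Y • z.2) +
      (-2 / (1 + d.normSq z)) •
        ((d.k z.1 (d.θ z V) Y + d.k z.1 z.2 (d.A z.1 V.1 Y)) • d.θ z V +
        d.k z.1 z.2 Y • d.dθ z V V +
        (d.k z.1 (d.θ z V) (d.θ z V) + d.k z.1 z.2 (d.Dθ z V V)) • Y -
        (d.k z.1 (d.θ z V) (d.A z.1 V.1 Y) + d.k z.1 (d.Dθ z V V) Y) • z.2 -
        d.k z.1 (d.θ z V) Y • (d.θ z V - d.A z.1 V.1 z.2)) +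
      fderiv ℝ d.A z.1 V.1 V.1 Y := by
  have hsymm := (d.metric_k _ hz).symm
  have hf := hasDerivAt_fibreΓ hz V (a₀ := Y) (b₀ := d.θ z V) (hasDerivAt_const 0 Y)
    (hasDerivAt_θ hz V V) rfl (by simp)
  have hA := ((hasDerivAt_A hz V).clm_apply (hasDerivAt_const 0 V.1)).clm_apply
    (hasDerivAt_const 0 Y)
  have h2 := (ContinuousLinearMap.snd ℝ EB F).hasFDerivAt.comp_hasDerivAt 0
    (hasDerivAt_limitΓ hz V (0, Y) V)
  have h3 := h2.unique ((hf.add hA).congr_of_eventuallyEq (by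
    filter_upwards [eventually_line_mem hz V] with t ht
    exact snd_limitΓ_vert_left ht Y V))
  refine h3.trans ?_
  have e : V.2 = d.θ z V - d.A z.1 V.1 z.2 := by rw [θ_apply]; abel
  have e' : d.A z.1 V.1 (d.θ z V) + d.dθ z V V = d.Dθ z V V := rfl
  rw [e', ← e]
  simp only [map_zero, add_zero, hsymm Y (d.θ z V), hsymm Y (d.Dθ z V V),
    hsymm (d.A z.1 V.1 Y) (d.θ z V)]
  module

/-- The limit of the Ricci tensors is the sum of the Ricci tensors of the base and the fibres. -/
theorem trace_curvature_limitΓ (hz : z.1 ∈ d.U) (V : EB × F) :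
    LinearMap.trace ℝ (EB × F) (connectionCurvatureEnd d.limitΓ z V V : EB × F →ₗ[ℝ] EB × F) =
      ricciCoord d.g z.1 V.1 V.1 +
      (Module.finrank ℝ F - 1) * (4 / (1 + d.normSq z) ^ 2) * d.k z.1 (d.θ z V) (d.θ z V) := by
  have hsymm := (d.metric_k _ hz).symm
  rw [trace_prod]
  -- Only the diagonal blocks contribute to the trace: the base block yields the Ricci tensor of the
  -- base and the fibre block that of the round sphere.
  congr 1
  · unfold ricciCoord
    congr 1
    refine LinearMap.ext fun X ↦ ?_
    change (connectionCurvatureEnd d.limitΓ z V V (X, 0)).1 =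
      connectionCurvatureEnd (christoffel d.g) z.1 V.1 V.1 X
    rw [connectionCurvatureEnd_apply, connectionCurvatureEnd_apply]
    simp only [Prod.fst_add, Prod.fst_sub, fst_fderiv_limitΓ hz, fst_limitΓ hz]
  · have hb : d.vertΓ z V V = (-2 / (1 + d.normSq z)) •
        ((2 * d.k z.1 z.2 (d.θ z V)) • d.θ z V - d.k z.1 (d.θ z V) (d.θ z V) • z.2) +
        d.Dθ z V V := by
      rw [vertΓ, fibreΓ]; module
    let κ : F →ₗ[ℝ] F →ₗ[ℝ] ℝ := (ContinuousLinearMap.coeLM ℝ) ∘ₗ (d.k z.1 : F →ₗ[ℝ] (F →L[ℝ] ℝ))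
    -- The four groups of terms in the trace lemma are `∂_Y Γ(V, V)`, `∂_V Γ(Y, V)`, `Γ(Y, Γ(V, V))`
    -- and `Γ(V, Γ(V, Y))` on the fibre. The terms with the derivative of `A`, and those with `A`
    -- applied to the Christoffel symbols of the base, are absent from it because they cancel in
    -- pairs.
    have h := trace_fibreRicci κ hsymm (d.A z.1 V.1 : F →ₗ[ℝ] F) z.2 (d.θ z V) (d.dθ z V V)
      (d.vertΓ z V V) (d.Dθ z V V) (one_add_normSq_pos hz).ne' (-2 / (1 + d.normSq z)) rfl rfl hb
      _ rfl
    refine Eq.trans ?_ h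
    congr 1
    refine LinearMap.ext fun Y ↦ ?_
    change (connectionCurvatureEnd d.limitΓ z V V (0, Y)).2 = _
    have hv : d.limitΓ z (0, Y) V = (0, d.fibreΓ z Y (d.θ z V) + d.A z.1 V.1 Y) := by
      refine Prod.ext ?_ (snd_limitΓ_vert_left hz Y V)
      rw [fst_limitΓ hz]; simp
    rw [connectionCurvatureEnd_apply, hv]
    simp only [Prod.snd_add, Prod.snd_sub, snd_fderiv_limitΓ_vert hz,
      snd_fderiv_limitΓ_horizontal hz, snd_limitΓ_vert_left hz, snd_limitΓ_vert_right hz,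
      fst_limitΓ hz, θ_limitΓ hz]
    simp only [LinearMap.add_apply, LinearMap.sub_apply, LinearMap.smul_apply,
      LinearMap.smulRight_apply, LinearMap.comp_apply, LinearMap.id_apply,
      ContinuousLinearMap.coe_coe]
    have hκ (a b : F) : κ a b = d.k z.1 a b := rfl
    simp only [hκ, fibreΓ, hsymm (d.vertΓ z V V) Y, hsymm _ (d.θ z V)]
    module

end LocalBundleData
end

noncomputable section

/-! ### Positivity of the Ricci tensor for small fibres -/

section

variable {E : Type*} [NormedAddCommGroup E] [NormedSpace ℝ E]

/-- The trace of the curvature endomorphism in terms of the Christoffel symbols `Γ` and their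
derivative `D`. -/
def curvatureTrace (D : E →L[ℝ] E →L[ℝ] E →L[ℝ] E) (Γ : E →L[ℝ] E →L[ℝ] E) (V : E) : ℝ :=
  LinearMap.trace ℝ E (((D.flip V).flip V - (D V).flip V + Γ.flip (Γ V V) -
    (Γ V) ∘L (Γ.flip V) : E →L[ℝ] E) : E →ₗ[ℝ] E)

theorem trace_connectionCurvatureEnd (Γ : E → E →L[ℝ] E →L[ℝ] E) (y V : E) :
    LinearMap.trace ℝ E (connectionCurvatureEnd Γ y V V : E →ₗ[ℝ] E) =
      curvatureTrace (fderiv ℝ Γ y) (Γ y) V := rfl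

/-- Quadratic homogeneity, which reduces positivity to the compact unit sphere. -/
theorem curvatureTrace_smul (D : E →L[ℝ] E →L[ℝ] E →L[ℝ] E) (Γ : E →L[ℝ] E →L[ℝ] E) (c : ℝ)
    (V : E) : curvatureTrace D Γ (c • V) = c ^ 2 * curvatureTrace D Γ V := by
  unfold curvatureTrace
  rw [← smul_eq_mul, ← map_smul]
  congr 1
  refine LinearMap.ext fun u ↦ ?_
  simp
  module

theorem ricciCoord_eq_curvatureTrace (G : E → E →L[ℝ] E →L[ℝ] ℝ) (y V : E) :
    ricciCoord G y V V = curvatureTrace (fderiv ℝ (christoffel G) y) (christoffel G y) V := rfl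

theorem continuous_curvatureTrace [FiniteDimensional ℝ E] :
    Continuous fun p : (E →L[ℝ] E →L[ℝ] E →L[ℝ] E) × (E →L[ℝ] E →L[ℝ] E) × E ↦
      curvatureTrace p.1 p.2.1 p.2.2 := by
  have htr : Continuous fun L : E →L[ℝ] E ↦ LinearMap.trace ℝ E (L : E →ₗ[ℝ] E) :=
    (LinearMap.trace ℝ E ∘ₗ ContinuousLinearMap.coeLM ℝ).continuous_of_finiteDimensional
  have hf1 : Continuous fun L : E →L[ℝ] E →L[ℝ] E →L[ℝ] E ↦ L.flip :=
    (ContinuousLinearMap.flipₗᵢ ℝ E E (E →L[ℝ] E)).continuous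
  have hf2 : Continuous fun L : E →L[ℝ] E →L[ℝ] E ↦ L.flip :=
    (ContinuousLinearMap.flipₗᵢ ℝ E E E).continuous
  refine htr.comp ?_
  have h1 : Continuous fun p : (E →L[ℝ] E →L[ℝ] E →L[ℝ] E) × (E →L[ℝ] E →L[ℝ] E) × E ↦ p.1 :=
    continuous_fst
  have h2 : Continuous fun p : (E →L[ℝ] E →L[ℝ] E →L[ℝ] E) × (E →L[ℝ] E →L[ℝ] E) × E ↦ p.2.1 :=
    continuous_fst.comp continuous_snd
  have h3 : Continuous fun p : (E →L[ℝ] E →L[ℝ] E →L[ℝ] E) × (E →L[ℝ] E →L[ℝ] E) × E ↦ p.2.2 :=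
    continuous_snd.comp continuous_snd
  refine ((((hf2.comp ((hf1.comp h1).clm_apply h3)).clm_apply h3).sub
    ((hf2.comp (h1.clm_apply h3)).clm_apply h3)).add
    ((hf2.comp h2).clm_apply ((h2.clm_apply h3).clm_apply h3))).sub ?_
  exact (h2.clm_apply h3).clm_comp ((hf2.comp h2).clm_apply h3)

/-- Positivity at `ε = 0` on the compact unit sphere persists for `(ε, z')` near `(0, z)`. The bound
`δ` is uniform in `z'` near `z`, as the later covering argument requires. -/
theorem exists_curvatureTrace_pos [FiniteDimensional ℝ E] {Γ₀ Γ₁ : E → E →L[ℝ] E →L[ℝ] E} {z : E}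
    (h₀ : ContDiffAt ℝ ∞ Γ₀ z) (h₁ : ContDiffAt ℝ ∞ Γ₁ z)
    (hpos : ∀ V, V ≠ 0 → 0 < curvatureTrace (fderiv ℝ Γ₀ z) (Γ₀ z) V) :
    ∃ δ : ℝ, 0 < δ ∧ ∀ᶠ z' in 𝓝 z, ∀ ε : ℝ, 0 < ε → ε < δ → ∀ V, V ≠ 0 →
      0 < curvatureTrace (fderiv ℝ Γ₀ z' + ε • fderiv ℝ Γ₁ z') (Γ₀ z' + ε • Γ₁ z') V := by
  have hcont (V : E) : ContinuousAt (fun q : (ℝ × E) × E ↦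
      curvatureTrace (fderiv ℝ Γ₀ q.1.2 + q.1.1 • fderiv ℝ Γ₁ q.1.2)
        (Γ₀ q.1.2 + q.1.1 • Γ₁ q.1.2) q.2) ((0, z), V) := by
    have hz2 : ContinuousAt (fun q : (ℝ × E) × E ↦ q.1.2) ((0, z), V) := by fun_prop
    have hε2 : ContinuousAt (fun q : (ℝ × E) × E ↦ q.1.1) ((0, z), V) := by fun_prop
    have hl' : ContinuousAt (fderiv ℝ Γ₀) z := (h₀.fderiv_right (m := 0) (by simp)).continuousAt
    have hs' : ContinuousAt (fderiv ℝ Γ₁) z := (h₁.fderiv_right (m := 0) (by simp)).continuousAt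
    have hD : ContinuousAt (fun q : (ℝ × E) × E ↦
        fderiv ℝ Γ₀ q.1.2 + q.1.1 • fderiv ℝ Γ₁ q.1.2) ((0, z), V) :=
      (hl'.comp_of_eq hz2 rfl).add (hε2.smul (hs'.comp_of_eq hz2 rfl))
    have hΓ : ContinuousAt (fun q : (ℝ × E) × E ↦ Γ₀ q.1.2 + q.1.1 • Γ₁ q.1.2) ((0, z), V) :=
      (h₀.continuousAt.comp_of_eq hz2 rfl).add (hε2.smul (h₁.continuousAt.comp_of_eq hz2 rfl))
    have h := hD.prodMk (hΓ.prodMk (continuousAt_snd (p := (((0 : ℝ), z), V))))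
    exact ContinuousAt.comp (g := fun p : (E →L[ℝ] E →L[ℝ] E →L[ℝ] E) × (E →L[ℝ] E →L[ℝ] E) × E ↦
      curvatureTrace p.1 p.2.1 p.2.2) (f := fun q : (ℝ × E) × E ↦
        (fderiv ℝ Γ₀ q.1.2 + q.1.1 • fderiv ℝ Γ₁ q.1.2, Γ₀ q.1.2 + q.1.1 • Γ₁ q.1.2, q.2))
      continuous_curvatureTrace.continuousAt h
  -- The tube lemma around `{(0, z)}` times the unit sphere.
  have hev := (isCompact_sphere (0 : E) 1).eventually_forall_of_forall_eventually
    (P := fun (p : ℝ × E) V ↦ 0 < curvatureTrace (fderiv ℝ Γ₀ p.2 + p.1 • fderiv ℝ Γ₁ p.2)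
      (Γ₀ p.2 + p.1 • Γ₁ p.2) V) (x₀ := ((0, z) : ℝ × E)) (fun V hV ↦
      (hcont V).eventually (lt_mem_nhds (by
        have := hpos V (by rintro rfl; simp at hV)
        simpa using this)))
  rw [nhds_prod_eq, Filter.eventually_prod_iff] at hev
  obtain ⟨p, hp, q, hq, hpq⟩ := hev
  obtain ⟨δ, hδ, hball⟩ := Metric.eventually_nhds_iff.1 hp
  refine ⟨δ, hδ, ?_⟩
  filter_upwards [hq] with z' hz1 ε hε hεδ V hV
  have hε' : p ε := hball (by rw [Real.dist_eq, sub_zero, abs_of_pos hε]; exact hεδ)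
  have h1 := hpq hε' hz1 (‖V‖⁻¹ • V) (by
    rw [mem_sphere_zero_iff_norm, norm_smul, norm_inv, norm_norm,
      inv_mul_cancel₀ (norm_ne_zero_iff.2 hV)])
  rw [curvatureTrace_smul] at h1
  exact pos_of_mul_pos_right h1 (by positivity)

end

namespace LocalBundleData

variable {EB F : Type*} [NormedAddCommGroup EB] [NormedSpace ℝ EB]
  [NormedAddCommGroup F] [NormedSpace ℝ F] {d : LocalBundleData EB F} {z : EB × F}

/-! ### The height function -/

variable (d) in
/-- The last coordinate in stereographic coordinates on the sphere of radius `|c|`. -/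
def height (c : ℝ) (z : EB × F) : ℝ := c * ((1 - d.normSq z) / (1 + d.normSq z))

theorem contDiffAt_height (c : ℝ) (hz : z.1 ∈ d.U) : ContDiffAt ℝ ∞ (d.height c) z := by
  have hu := contDiffAt_normSq hz
  exact contDiffAt_const.mul ((contDiffAt_const.sub hu).div (contDiffAt_const.add hu)
    (one_add_normSq_pos hz).ne')

/-- The height is a function of `|y|²`, so its differential sees a tangent vector only through `k(y,
θ V)` and vanishes on horizontal vectors. -/
theorem fderiv_height (c : ℝ) (hz : z.1 ∈ d.U) (V : EB × F) :
    fderiv ℝ (d.height c) z V = -4 * c / (1 + d.normSq z) ^ 2 * d.k z.1 z.2 (d.θ z V) := by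
  have hp := (one_add_normSq_pos hz).ne'
  have h1 := hasDerivAt_line ((contDiffAt_height c hz).differentiableAt (by simp)) V
  have hu := hasDerivAt_normSq hz V
  have h2 := ((hu.const_sub 1).div (hu.const_add 1) (by simpa using hp)).const_mul c
  have h3 := h1.unique h2
  rw [h3]
  simp only [zero_smul, add_zero]
  field_simp
  ring

variable [FiniteDimensional ℝ EB] [FiniteDimensional ℝ F]

/-- In the limit a vector with nonzero base component is handled by the Ricci curvature of the base,
and a nonzero vertical vector by the factor `n - 1 > 0` of the round `n`-sphere. This is where rank
at least two is needed. -/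
theorem exists_ricciCoord_sphereMetric_pos (hn : 2 ≤ Module.finrank ℝ F) (hz : z.1 ∈ d.U)
    (hg : ∀ X, X ≠ 0 → 0 < ricciCoord d.g z.1 X X) :
    ∃ δ : ℝ, 0 < δ ∧ ∀ᶠ z' in 𝓝 z, ∀ ε : ℝ, 0 < ε → ε < δ → ∀ V, V ≠ 0 →
      0 < ricciCoord (d.sphereMetric ε) z' V V := by
  have hpos (V : EB × F) (hV : V ≠ 0) :
      0 < curvatureTrace (fderiv ℝ d.limitΓ z) (d.limitΓ z) V := by
    rw [← trace_connectionCurvatureEnd, trace_curvature_limitΓ hz]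
    have hn' : (0 : ℝ) < Module.finrank ℝ F - 1 := by
      have : (2 : ℝ) ≤ Module.finrank ℝ F := by exact_mod_cast hn
      linarith
    have hp := one_add_normSq_pos hz
    by_cases h1 : V.1 = 0
    · have h2 : V.2 ≠ 0 := fun h2 ↦ hV (Prod.ext h1 h2)
      have h3 := (d.metric_k _ hz).pos _ h2
      have h4 : d.θ z V = V.2 := by simp [θ_apply, h1]
      rw [h4, h1]
      -- Homogeneity with the scalar `0`.
      have h5 : ricciCoord d.g z.1 0 0 = 0 := by
        rw [ricciCoord_eq_curvatureTrace]
        simpa using curvatureTrace_smul (fderiv ℝ (christoffel d.g) z.1) (christoffel d.g z.1) 0 0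
      rw [h5]
      positivity
    · have h3 : 0 ≤ d.k z.1 (d.θ z V) (d.θ z V) := by
        by_cases h : d.θ z V = 0
        · rw [h]; simp
        · exact ((d.metric_k _ hz).pos _ h).le
      have := hg _ h1
      positivity
  obtain ⟨δ, hδ, h⟩ := exists_curvatureTrace_pos (contDiffAt_limitΓ hz) (contDiffAt_slopeΓ hz) hpos
  refine ⟨δ, hδ, ?_⟩
  filter_upwards [h, d.isOpen_domain.mem_nhds hz] with z' h1 hz' ε hε hεδ V hV
  -- The affine formula holds on a whole neighbourhood, hence also for the first derivatives of the
  -- symbols.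
  have he : christoffel (d.sphereMetric ε) =ᶠ[𝓝 z'] d.limitΓ + ε • d.slopeΓ := by
    filter_upwards [d.isOpen_domain.mem_nhds hz'] with w hw
    exact christoffel_sphereMetric hε hw
  have h2 : DifferentiableAt ℝ d.slopeΓ z' := (contDiffAt_slopeΓ hz').differentiableAt (by simp)
  rw [ricciCoord_eq_curvatureTrace, he.fderiv_eq, he.eq_of_nhds,
    fderiv_add ((contDiffAt_limitΓ hz').differentiableAt (by simp)) (h2.const_smul ε),
    fderiv_const_smul h2]
  exact h1 ε hε hεδ V hV

/-- The gradient is vertical and radial, since `df` depends only on `k(y, θ V)`. Here `ε = c ^ 2`,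
and the sign of `c` records the disc. -/
theorem gradientCoord_height {c : ℝ} (hc : c ≠ 0) (hz : z.1 ∈ d.U) :
    gradientCoord (d.sphereMetric (c ^ 2)) (d.height c) z = (0, -c⁻¹ • z.2) := by
  have hp := (one_add_normSq_pos hz).ne'
  refine (isMetricForm_sphereMetric (by positivity) hz).inverse_eq fun W ↦ ?_
  rw [sphereMetric_apply, θ_vert, fderiv_height c hz]
  simp only [map_zero, zero_apply, map_smul, smul_apply, smul_eq_mul, zero_add, neg_smul, map_neg,
    neg_apply]
  field_simp

theorem normSq_gradientCoord_height {c : ℝ} (hc : c ≠ 0) (hz : z.1 ∈ d.U) :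
    d.sphereMetric (c ^ 2) z (gradientCoord (d.sphereMetric (c ^ 2)) (d.height c) z)
      (gradientCoord (d.sphereMetric (c ^ 2)) (d.height c) z) = 1 - (d.height c z) ^ 2 / c ^ 2 := by
  have hp := (one_add_normSq_pos hz).ne'
  rw [gradientCoord_height hc hz, sphereMetric_apply, θ_vert, height]
  have e : d.k z.1 (-c⁻¹ • z.2) (-c⁻¹ • z.2) = (c⁻¹) ^ 2 * d.normSq z := by
    simp only [neg_smul, map_neg, map_smul, neg_apply, smul_apply, smul_eq_mul, normSq]
    ring
  simp only [e, map_zero, zero_add]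
  field_simp
  ring

/-- Because `df` vanishes on horizontal vectors, only the vertical part of the Christoffel symbols
matters. Its term `Dθ V V` cancels the one in the second derivative of `f`, leaving the Hessian of
the height on a round sphere. -/
theorem hessianCoord_height_self {c : ℝ} (hc : c ≠ 0) (hz : z.1 ∈ d.U) (V : EB × F) :
    hessianCoord (d.sphereMetric (c ^ 2)) (d.height c) z V V =
      -(d.height c z) * (4 / (1 + d.normSq z) ^ 2) * d.k z.1 (d.θ z V) (d.θ z V) := by
  have hp := (one_add_normSq_pos hz).ne'
  have hd : DifferentiableAt ℝ (fderiv ℝ (d.height c)) z :=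
    ((contDiffAt_height c hz).fderiv_right (m := 1) (by norm_cast)).differentiableAt (by simp)
  have h1 := (hasDerivAt_line hd V).clm_apply (hasDerivAt_const 0 V)
  have hu := ((hasDerivAt_normSq hz V).const_add 1).pow 2
  have hk := hasDerivAt_k_apply hz V (hasDerivAt_snd z V) (hasDerivAt_θ hz V V)
  have h2 := ((hasDerivAt_const (0 : ℝ) (-4 * c)).div hu (by simpa using pow_ne_zero 2 hp)).mul hk
  have h3 := h1.unique (h2.congr_of_eventuallyEq (by
    filter_upwards [eventually_line_mem hz V] with t ht
    exact fderiv_height c ht V))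
  have e1 : d.A z.1 V.1 z.2 + V.2 = d.θ z V := by rw [θ_apply, add_comm]
  have e2 : d.A z.1 V.1 (d.θ z V) + d.dθ z V V = d.Dθ z V V := rfl
  simp only [zero_smul, add_zero, e1, e2, map_zero] at h3
  have e3 : hessianCoord (d.sphereMetric (c ^ 2)) (d.height c) z V V =
      fderiv ℝ (fderiv ℝ (d.height c)) z V V -
        fderiv ℝ (d.height c) z (christoffel (d.sphereMetric (c ^ 2)) z V V) := rfl
  have e4 : d.k z.1 z.2 (d.vertΓ z V V) = -2 / (1 + d.normSq z) *
      (2 * d.k z.1 z.2 (d.θ z V) ^ 2 - d.k z.1 (d.θ z V) (d.θ z V) * d.normSq z) +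
      d.k z.1 z.2 (d.Dθ z V V) := by
    simp only [vertΓ, fibreΓ, map_add, map_sub, map_smul, smul_eq_mul, normSq]
    ring
  rw [e3, h3, fderiv_height c hz, θ_christoffel (by positivity) hz, e4, height]
  simp
  field_simp
  ring

/-- Polarization of the quadratic form; the symmetry of the Hessian comes from that of the second
derivative and of the Christoffel symbols. -/
theorem hessianCoord_height {c : ℝ} (hc : c ≠ 0) (hz : z.1 ∈ d.U) (V W : EB × F) :
    hessianCoord (d.sphereMetric (c ^ 2)) (d.height c) z V W =
      -(d.height c z) * (4 / (1 + d.normSq z) ^ 2) * d.k z.1 (d.θ z V) (d.θ z W) := by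
  have hs : hessianCoord (d.sphereMetric (c ^ 2)) (d.height c) z V W =
      hessianCoord (d.sphereMetric (c ^ 2)) (d.height c) z W V := by
    change fderiv ℝ (fderiv ℝ (d.height c)) z V W -
        fderiv ℝ (d.height c) z (christoffel (d.sphereMetric (c ^ 2)) z V W) =
      fderiv ℝ (fderiv ℝ (d.height c)) z W V -
        fderiv ℝ (d.height c) z (christoffel (d.sphereMetric (c ^ 2)) z W V)
    rw [((contDiffAt_height c hz).isSymmSndFDerivAt (by simp; norm_cast)).eq V W,
      christoffel_symm _ ((contDiffAt_sphereMetric _ hz).differentiableAt (by simp))]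
    filter_upwards [d.isOpen_domain.mem_nhds hz] with z' hz'
    exact isMetricForm_sphereMetric (by positivity) hz'
  have h := hessianCoord_height_self hc hz (V + W)
  simp only [map_add, add_apply, hessianCoord_height_self hc hz V,
    hessianCoord_height_self hc hz W, ← hs, (d.metric_k _ hz).symm (d.θ z W) (d.θ z V)] at h
  linarith

/-- Raised with the metric, the Hessian is `-f/c²` times the projection onto the fibre directions
along the horizontal ones, whose trace is the rank. -/
theorem laplacianCoord_height {c : ℝ} (hc : c ≠ 0) (hz : z.1 ∈ d.U) :
    laplacianCoord (d.sphereMetric (c ^ 2)) (d.height c) z =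
      -(Module.finrank ℝ F) / c ^ 2 * d.height c z := by
  have hp := (one_add_normSq_pos hz).ne'
  have h (V : EB × F) : (d.sphereMetric (c ^ 2) z).inverse
      (hessianCoord (d.sphereMetric (c ^ 2)) (d.height c) z V) =
        (0, (-(d.height c z) / c ^ 2) • d.θ z V) := by
    refine (isMetricForm_sphereMetric (by positivity) hz).inverse_eq fun W ↦ ?_
    rw [sphereMetric_apply, θ_vert, hessianCoord_height hc hz]
    simp only [map_zero, zero_apply, map_smul, smul_apply, smul_eq_mul, zero_add]
    field_simp
  unfold laplacianCoord
  rw [trace_prod]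
  have h1 : LinearMap.fst ℝ EB F ∘ₗ ((d.sphereMetric (c ^ 2) z).inverse ∘L
      hessianCoord (d.sphereMetric (c ^ 2)) (d.height c) z : EB × F →L[ℝ] EB × F) ∘ₗ
      LinearMap.inl ℝ EB F = 0 := by
    refine LinearMap.ext fun X ↦ ?_
    exact congrArg Prod.fst (h (X, 0))
  have h2 : LinearMap.snd ℝ EB F ∘ₗ ((d.sphereMetric (c ^ 2) z).inverse ∘L
      hessianCoord (d.sphereMetric (c ^ 2)) (d.height c) z : EB × F →L[ℝ] EB × F) ∘ₗ
      LinearMap.inr ℝ EB F = (-(d.height c z) / c ^ 2) • LinearMap.id := by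
    refine LinearMap.ext fun Y ↦ ?_
    refine (congrArg Prod.snd (h (0, Y))).trans ?_
    simp [θ_vert]
  rw [h1, h2, map_zero, zero_add, map_smul, LinearMap.trace_id, smul_eq_mul]
  ring

end LocalBundleData
end

noncomputable section

/-! ### Metrics in charts of a manifold -/

section Charts

variable {E : Type*} [NormedAddCommGroup E] [NormedSpace ℝ E]
  {H : Type*} [TopologicalSpace H] {I : ModelWithCorners ℝ E H}
  {N : Type*} [TopologicalSpace N] {e : OpenPartialHomeomorph N H} {y : E}

theorem extend_symm_mem_source (hy : y ∈ (e.extend I).target) : (e.extend I).symm y ∈ e.source := by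
  simpa using (e.extend I).map_target hy

variable [ChartedSpace H N] [IsManifold I ∞ N]

theorem contMDiffAt_extend_of_mem (he : e ∈ atlas H N) {x : N} (hx : x ∈ e.source) :
    ContMDiffAt I 𝓘(ℝ, E) ∞ (e.extend I) x :=
  (e.contMDiffOn_extend (IsManifold.subset_maximalAtlas he)).contMDiffAt (e.open_source.mem_nhds hx)

theorem metricInChart_apply (g : SmoothMetric I N) (e : OpenPartialHomeomorph N H) (y v w : E) :
    metricInChart g e y v w = g.inner ((e.extend I).symm y)
      (mfderiv 𝓘(ℝ, E) I (e.extend I).symm y v) (mfderiv 𝓘(ℝ, E) I (e.extend I).symm y w) := rfl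

variable [I.Boundaryless]

theorem contMDiffAt_extend_symm (he : e ∈ atlas H N) (hy : y ∈ (e.extend I).target) :
    ContMDiffAt 𝓘(ℝ, E) I ∞ (e.extend I).symm y := by
  have h := contMDiffOn_extend_symm (I := I) (n := ∞) (IsManifold.subset_maximalAtlas he)
  have h2 : I '' e.target = (e.extend I).target := by
    rw [OpenPartialHomeomorph.extend_target, I.range_eq_univ, inter_univ, I.image_eq, I.range_eq_univ, inter_univ]
  rw [h2] at h
  exact h.contMDiffAt ((e.isOpen_extend_target (I := I)).mem_nhds hy)

/-- The derivative of a chart is a left inverse of the derivative of its inverse. -/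
theorem mfderiv_extend_comp_mfderiv_symm (he : e ∈ atlas H N) (hy : y ∈ (e.extend I).target)
    (v : E) : mfderiv I 𝓘(ℝ, E) (e.extend I) ((e.extend I).symm y)
      (mfderiv 𝓘(ℝ, E) I (e.extend I).symm y v) = v := by
  have h1 := (contMDiffAt_extend_of_mem (I := I) he
    (extend_symm_mem_source hy)).mdifferentiableAt (by simp)
  have h2 := (contMDiffAt_extend_symm he hy).mdifferentiableAt (by simp)
  have h3 := mfderiv_comp y h1 h2
  have h4 : (e.extend I) ∘ (e.extend I).symm =ᶠ[𝓝 y] id := by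
    filter_upwards [(e.isOpen_extend_target (I := I)).mem_nhds hy] with z hz
    exact (e.extend I).right_inv hz
  rw [h4.mfderiv_eq, mfderiv_id] at h3
  exact (congrArg (fun L : E →L[ℝ] E ↦ L v) h3).symm

/-- The derivative of the inverse of a chart is a left inverse of the derivative of the chart. -/
theorem mfderiv_symm_comp_mfderiv_extend (he : e ∈ atlas H N) {x : N} (hx : x ∈ e.source)
    (v : TangentSpace I x) : mfderiv 𝓘(ℝ, E) I (e.extend I).symm (e.extend I x)
      (mfderiv I 𝓘(ℝ, E) (e.extend I) x v) = v := by
  have hx' : x ∈ (e.extend I).source := by simpa using hx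
  have h1 := (contMDiffAt_extend_of_mem (I := I) he hx).mdifferentiableAt (by simp)
  have h2 := (contMDiffAt_extend_symm he ((e.extend I).map_source hx')).mdifferentiableAt (by simp)
  have h3 := mfderiv_comp x h2 h1
  have h4 : (e.extend I).symm ∘ (e.extend I) =ᶠ[𝓝 x] id := by
    filter_upwards [e.open_source.mem_nhds hx] with z hz
    exact (e.extend I).left_inv (by simpa using hz)
  rw [h4.mfderiv_eq, mfderiv_id] at h3
  exact (congrArg (fun L : E →L[ℝ] E ↦ L v) h3).symm

theorem isMetricForm_metricInChart (g : SmoothMetric I N) (he : e ∈ atlas H N)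
    (hy : y ∈ (e.extend I).target) : IsMetricForm (metricInChart g e y) := by
  refine ⟨fun v w ↦ g.symm _ _ _, fun v hv ↦ g.pos _ _ fun h0 ↦ hv ?_⟩
  rw [← mfderiv_extend_comp_mfderiv_symm he hy v]
  have h0' : mfderiv 𝓘(ℝ, E) I (e.extend I).symm y v = 0 := h0
  rw [h0']
  exact map_zero (mfderiv I 𝓘(ℝ, E) (e.extend I) ((e.extend I).symm y))

/-- Coordinate vector fields of a chart are smooth. -/
theorem contMDiffAt_coordinateField (he : e ∈ atlas H N) (hy : y ∈ (e.extend I).target) (v : E) :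
    ContMDiffAt 𝓘(ℝ, E) I.tangent ∞ (fun z ↦ (⟨(e.extend I).symm z,
      mfderiv 𝓘(ℝ, E) I (e.extend I).symm z v⟩ : TangentBundle I N)) y := by
  have ho := e.isOpen_extend_target (I := I)
  have hon : ContMDiffOn 𝓘(ℝ, E) I ∞ (e.extend I).symm (e.extend I).target := fun z hz ↦
    (contMDiffAt_extend_symm he hz).contMDiffWithinAt
  have h1 := hon.contMDiffOn_tangentMapWithin (m := ∞) (by simp) ho.uniqueMDiffOn
  have h2 : ContMDiffAt 𝓘(ℝ, E) 𝓘(ℝ, E).tangent ∞ (fun z ↦ (⟨z, v⟩ : TangentBundle 𝓘(ℝ, E) E)) y :=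
    contMDiffAt_vectorSpace_iff_contDiffAt.2 contDiffAt_const
  have h3 : ContMDiffAt 𝓘(ℝ, E).tangent I.tangent ∞
      (tangentMapWithin 𝓘(ℝ, E) I (e.extend I).symm (e.extend I).target)
      (⟨y, v⟩ : TangentBundle 𝓘(ℝ, E) E) :=
    h1.contMDiffAt ((ho.preimage (FiberBundle.continuous_proj E _)).mem_nhds hy)
  refine (h3.comp y h2).congr_of_eventuallyEq ?_
  filter_upwards [ho.mem_nhds hy] with z hz
  simp only [Function.comp, tangentMapWithin, mfderivWithin_of_isOpen ho hz]

variable [FiniteDimensional ℝ E]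

theorem contDiffAt_metricInChart (g : SmoothMetric I N) (he : e ∈ atlas H N)
    (hy : y ∈ (e.extend I).target) : ContDiffAt ℝ ∞ (metricInChart g e) y := by
  have h : ContDiffOn ℝ ∞ (metricInChart g e) (e.extend I).target := by
    refine contDiffOn_clm_apply.2 fun v ↦ contDiffOn_clm_apply.2 fun w ↦ ?_
    intro z hz
    refine ContDiffAt.contDiffWithinAt ?_
    have h1 : ContMDiffAt 𝓘(ℝ, E) (I.prod 𝓘(ℝ, E →L[ℝ] E →L[ℝ] ℝ)) ∞
        (fun z ↦ (⟨(e.extend I).symm z, g.inner ((e.extend I).symm z)⟩ :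
          TotalSpace (E →L[ℝ] E →L[ℝ] ℝ)
            (fun x : N ↦ TangentSpace I x →L[ℝ] TangentSpace I x →L[ℝ] ℝ))) z :=
      (g.contMDiff _).comp z (contMDiffAt_extend_symm he hz)
    have h2 := ContMDiffAt.clm_bundle_apply₂ (F₃ := ℝ) (E₃ := Bundle.Trivial N ℝ) h1
      (contMDiffAt_coordinateField he hz v) (contMDiffAt_coordinateField he hz w)
    have h3 := ((Bundle.contMDiffAt_totalSpace).1 h2).2
    exact contMDiffAt_iff_contDiffAt.1 h3
  exact h.contDiffAt ((e.isOpen_extend_target (I := I)).mem_nhds hy)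

/-- Positivity of the Ricci tensor at a point is independent of the chart. -/
theorem ricciCoord_metricInChart_pos (g : SmoothMetric I N) {e e' : OpenPartialHomeomorph N H}
    (he : e ∈ atlas H N) (he' : e' ∈ atlas H N) {x : N} (hx : x ∈ e.source) (hx' : x ∈ e'.source)
    (h : ∀ v : E, v ≠ 0 → 0 < ricciCoord (metricInChart g e) (e.extend I x) v v)
    (v : E) (hv : v ≠ 0) : 0 < ricciCoord (metricInChart g e') (e'.extend I x) v v := by
  have hxe : x ∈ (e.extend I).source := by simpa using hx
  have hxe' : x ∈ (e'.extend I).source := by simpa using hx'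
  set y := e'.extend I x with hy
  have hyt : y ∈ (e'.extend I).target := (e'.extend I).map_source hxe'
  have hsy : (e'.extend I).symm y = x := (e'.extend I).left_inv hxe'
  -- The metric in `e'` is the pull-back of the metric in `e` by the transition map `φ`, so
  -- naturality of the Ricci tensor applies.
  let φ : E → E := (e.extend I) ∘ (e'.extend I).symm
  have hc : ContinuousAt (e'.extend I).symm y := (contMDiffAt_extend_symm he' hyt).continuousAt
  have hnear : ∀ᶠ z in 𝓝 y, z ∈ (e'.extend I).target ∧ (e'.extend I).symm z ∈ e.source := by
    refine Filter.Eventually.and ((e'.isOpen_extend_target (I := I)).mem_nhds hyt) ?_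
    exact hc.eventually_mem (e.open_source.mem_nhds (hsy ▸ hx))
  have hφm {z : E} (hz : z ∈ (e'.extend I).target ∧ (e'.extend I).symm z ∈ e.source) :
      ContMDiffAt 𝓘(ℝ, E) 𝓘(ℝ, E) ∞ φ z :=
    (contMDiffAt_extend_of_mem he hz.2).comp z (contMDiffAt_extend_symm he' hz.1)
  have hφd {z : E} (hz : z ∈ (e'.extend I).target ∧ (e'.extend I).symm z ∈ e.source) (v : E) :
      fderiv ℝ φ z v = mfderiv I 𝓘(ℝ, E) (e.extend I) ((e'.extend I).symm z)
        (mfderiv 𝓘(ℝ, E) I (e'.extend I).symm z v) := by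
    rw [← mfderiv_eq_fderiv]
    have := mfderiv_comp z ((contMDiffAt_extend_of_mem (I := I) he hz.2).mdifferentiableAt (by simp))
      ((contMDiffAt_extend_symm he' hz.1).mdifferentiableAt (by simp))
    exact congrArg (fun L : E →L[ℝ] E ↦ L v) this
  have hφy : φ y = e.extend I x := congrArg (e.extend I) hsy
  have hφt {z : E} (hz : z ∈ (e'.extend I).target ∧ (e'.extend I).symm z ∈ e.source) :
      φ z ∈ (e.extend I).target := (e.extend I).map_source (by simpa using hz.2)
  have hinj : Function.Injective (fderiv ℝ φ y) := by
    rw [injective_iff_map_eq_zero]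
    intro v hv
    rw [hφd hnear.self_of_nhds] at hv
    have h2 := mfderiv_symm_comp_mfderiv_extend (I := I) he hnear.self_of_nhds.2
      (mfderiv 𝓘(ℝ, E) I (e'.extend I).symm y v)
    have h3 := mfderiv_extend_comp_mfderiv_symm he' hyt v
    have hv' : mfderiv I 𝓘(ℝ, E) (e.extend I) ((e'.extend I).symm y)
        (mfderiv 𝓘(ℝ, E) I (e'.extend I).symm y v) = 0 := hv
    rw [hv', map_zero] at h2
    rw [← h3, ← h2]
    exact map_zero (mfderiv I 𝓘(ℝ, E) (e'.extend I) ((e'.extend I).symm y))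
  have hinv : (fderiv ℝ φ y).IsInvertible :=
    ⟨(LinearEquiv.ofInjectiveEndo (fderiv ℝ φ y : E →ₗ[ℝ] E) hinj).toContinuousLinearEquiv,
      by ext; rfl⟩
  have hpull : ∀ᶠ z in 𝓝 y, ∀ v w, metricInChart g e' z v w =
      metricInChart g e (φ z) (fderiv ℝ φ z v) (fderiv ℝ φ z w) := by
    filter_upwards [hnear] with z hz v w
    have hs : (e.extend I).symm (φ z) = (e'.extend I).symm z :=
      (e.extend I).left_inv (by simpa using hz.2)
    have hd (v : E) : mfderiv 𝓘(ℝ, E) I (e.extend I).symm (φ z) (fderiv ℝ φ z v) =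
        mfderiv 𝓘(ℝ, E) I (e'.extend I).symm z v := by
      rw [hφd hz]
      exact mfderiv_symm_comp_mfderiv_extend he hz.2 _
    rw [metricInChart_apply, metricInChart_apply, hd, hd, hs]
  have key := ricciCoord_pullback (G := metricInChart g e) (G' := metricInChart g e') (φ := φ)
    (y := y) (hnear.mono fun z hz ↦ contMDiffAt_iff_contDiffAt.1 (hφm hz)) hinv
    (Filter.eventually_of_mem ((e.isOpen_extend_target (I := I)).mem_nhds
      (hφt hnear.self_of_nhds)) fun z hz ↦
        ⟨contDiffAt_metricInChart g he hz, isMetricForm_metricInChart g he hz⟩)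
    (hnear.mono fun z hz ↦
        ⟨contDiffAt_metricInChart g he' hz.1, isMetricForm_metricInChart g he' hz.1⟩)
    hpull v v
  rw [key, hφy]
  exact h _ fun h0 ↦ hv (hinj (h0.trans (map_zero _).symm))

end Charts
end

noncomputable section

/-! ### Riemannian metrics given by their coefficients in charts -/

section OfCharts

/-- Compactness of the unit sphere gives `b v v ≥ c |v|²` with `c > 0`. Boundedness of the unit ball
of `b` is part of the data of a Riemannian metric. -/
theorem IsMetricForm.isVonNBounded {E : Type*} [NormedAddCommGroup E] [NormedSpace ℝ E]
    [FiniteDimensional ℝ E] {b : E →L[ℝ] E →L[ℝ] ℝ} (hb : IsMetricForm b) :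
    Bornology.IsVonNBounded ℝ {v | b v v < 1} := by
  rw [NormedSpace.isVonNBounded_iff]
  have hc : Continuous fun v : E ↦ b v v := by fun_prop
  obtain ⟨c, hc0, hc1⟩ : ∃ c : ℝ, 0 < c ∧ ∀ v ∈ Metric.sphere (0 : E) 1, c ≤ b v v := by
    -- The sphere is empty in dimension zero, where any constant serves.
    rcases (Metric.sphere (0 : E) 1).eq_empty_or_nonempty with h | h
    · exact ⟨1, one_pos, by simp [h]⟩
    · obtain ⟨v, hv, hmin⟩ := (isCompact_sphere (0 : E) 1).exists_isMinOn h hc.continuousOn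
      refine ⟨b v v, hb.pos v ?_, fun w hw ↦ hmin hw⟩
      rintro rfl
      simp at hv
  -- The radius `1 + c⁻¹` avoids square roots: `|v|² < c⁻¹` forces `|v| < 1 + c⁻¹`.
  refine (Metric.isBounded_iff_subset_ball (0 : E)).2 ⟨1 + c⁻¹, fun v hv ↦ ?_⟩
  rw [mem_ball_zero_iff]
  by_cases h0 : v = 0
  · rw [h0, norm_zero]; positivity
  have h1 := hc1 (‖v‖⁻¹ • v) (by
    rw [mem_sphere_zero_iff_norm, norm_smul, norm_inv, norm_norm,
      inv_mul_cancel₀ (norm_ne_zero_iff.2 h0)])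
  have h2 : b v v < 1 := hv
  have hn : 0 < ‖v‖ := norm_pos_iff.2 h0
  simp only [map_smul, smul_apply, smul_eq_mul] at h1
  have h3 : c * ‖v‖ ^ 2 ≤ b v v := by
    calc c * ‖v‖ ^ 2 ≤ (‖v‖⁻¹ * (‖v‖⁻¹ * b v v)) * ‖v‖ ^ 2 := by gcongr
      _ = b v v := by field_simp
  have h4 : ‖v‖ ^ 2 < c⁻¹ := by
    rw [← one_div, lt_div_iff₀ hc0]; linarith
  have h5 : 0 < c⁻¹ := by positivity
  nlinarith

variable {E : Type*} [NormedAddCommGroup E] [NormedSpace ℝ E] [FiniteDimensional ℝ E]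
  {H : Type*} [TopologicalSpace H] {I : ModelWithCorners ℝ E H} [I.Boundaryless]
  {N : Type*} [TopologicalSpace N] [ChartedSpace H N] [IsManifold I ∞ N]

/-- In the trivialization of the bundle of bilinear forms at `x₀`, the field `b` is represented by
its coefficients in the preferred chart at `x₀`. Smoothness of these coefficients for the preferred
charts is therefore enough. -/
theorem contMDiff_of_charts (b : ∀ x : N, TangentSpace I x →L[ℝ] TangentSpace I x →L[ℝ] ℝ)
    (hsmooth : ∀ x₀ : N, ∀ y ∈ ((chartAt H x₀).extend I).target, ∀ v w : E,
      ContDiffAt ℝ ∞ (fun z ↦ b (((chartAt H x₀).extend I).symm z)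
        (mfderiv 𝓘(ℝ, E) I ((chartAt H x₀).extend I).symm z v)
        (mfderiv 𝓘(ℝ, E) I ((chartAt H x₀).extend I).symm z w)) y) :
    ContMDiff I (I.prod 𝓘(ℝ, E →L[ℝ] E →L[ℝ] ℝ)) ∞
      (fun x ↦ (⟨x, b x⟩ : TotalSpace (E →L[ℝ] E →L[ℝ] ℝ)
        (fun x : N ↦ TangentSpace I x →L[ℝ] TangentSpace I x →L[ℝ] ℝ))) := by
  intro x₀
  let σ := ((chartAt H x₀).extend I).symm
  let Ψ : E → E →L[ℝ] E →L[ℝ] ℝ := fun z ↦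
    let L : E →L[ℝ] TangentSpace I (σ z) := mfderiv 𝓘(ℝ, E) I σ z
    (ContinuousLinearMap.precomp ℝ L) ∘L (b (σ z) ∘L L)
  have ho := (chartAt H x₀).isOpen_extend_target (I := I)
  have hx₀ : x₀ ∈ ((chartAt H x₀).extend I).source := by simp
  have hΨ : ContDiffOn ℝ ∞ Ψ ((chartAt H x₀).extend I).target :=
    contDiffOn_clm_apply.2 fun v ↦ contDiffOn_clm_apply.2 fun w ↦ fun y hy ↦
      (hsmooth x₀ y hy v w).contDiffWithinAt
  have hΨ' : ContMDiffAt I 𝓘(ℝ, E →L[ℝ] E →L[ℝ] ℝ) ∞ (Ψ ∘ (chartAt H x₀).extend I) x₀ := by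
    refine ContMDiffAt.comp x₀ (I' := 𝓘(ℝ, E)) ?_
      (contMDiffAt_extend_of_mem (chart_mem_atlas H x₀) (mem_chart_source H x₀))
    exact (hΨ.contDiffAt (ho.mem_nhds (((chartAt H x₀).extend I).map_source hx₀))).contMDiffAt
  refine (contMDiffAt_hom_bundle _).2 ⟨contMDiffAt_id, hΨ'.congr_of_eventuallyEq ?_⟩
  filter_upwards [(chartAt H x₀).open_source.mem_nhds (mem_chart_source H x₀)] with x hx
  have hsx : σ ((chartAt H x₀).extend I x) = x :=
    ((chartAt H x₀).extend I).left_inv (by simpa using hx)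
  ext v w
  have hbs : x ∈ (trivializationAt E (TangentSpace I : N → Type _) x₀).baseSet := by simpa using hx
  -- The inverse of the tangent trivialization is the derivative of the inverse chart.
  have hT (v : E) : (trivializationAt E (TangentSpace I : N → Type _) x₀).symm x v =
      mfderiv 𝓘(ℝ, E) I σ ((chartAt H x₀).extend I x) v := by
    have h1 := TangentBundle.symmL_trivializationAt (I := I) hx
    rw [I.range_eq_univ, mfderivWithin_univ] at h1
    rw [← Bundle.Trivialization.symmL_apply (R := ℝ) _ hbs]
    exact congrArg (fun L : E →L[ℝ] TangentSpace I x ↦ L v) h1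
  have h := inCoordinates_apply_eq₂ (𝕜 := ℝ) (F₁ := E) (F₂ := E) (F₃ := ℝ)
    (E₁ := (TangentSpace I : N → Type _)) (E₂ := (TangentSpace I : N → Type _))
    (E₃ := Bundle.Trivial N ℝ) (x₀ := x₀) (x := x) (ϕ := b x) (v := v) (w := w) hbs hbs trivial
  refine h.trans ?_
  have htr (c : ℝ) : (trivializationAt ℝ (Bundle.Trivial N ℝ) x₀).linearMapAt ℝ x c = c :=
    congrFun (Bundle.Trivialization.coe_linearMapAt_of_mem
      (trivializationAt ℝ (Bundle.Trivial N ℝ) x₀) (mem_univ x)) c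
  refine (htr _).trans ?_
  rw [hT, hT]
  change b x _ _ = b (σ ((chartAt H x₀).extend I x)) _ _
  rw [hsx]
  rfl

/-- A Riemannian metric given by a family of scalar products with smooth coefficients in charts. -/
def SmoothMetric.ofCharts (b : ∀ x : N, TangentSpace I x →L[ℝ] TangentSpace I x →L[ℝ] ℝ)
    (hsymm : ∀ x v w, b x v w = b x w v) (hpos : ∀ x v, v ≠ 0 → 0 < b x v v)
    (hsmooth : ∀ x₀ : N, ∀ y ∈ ((chartAt H x₀).extend I).target, ∀ v w : E,
      ContDiffAt ℝ ∞ (fun z ↦ b (((chartAt H x₀).extend I).symm z)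
        (mfderiv 𝓘(ℝ, E) I ((chartAt H x₀).extend I).symm z v)
        (mfderiv 𝓘(ℝ, E) I ((chartAt H x₀).extend I).symm z w)) y) : SmoothMetric I N where
  inner := b
  symm := hsymm
  pos := hpos
  isVonNBounded x := IsMetricForm.isVonNBounded (E := E) (b := b x) ⟨hsymm x, hpos x⟩
  contMDiff := contMDiff_of_charts b hsmooth

end OfCharts
end

noncomputable section

/-! ### The fibre metric in a trivialization and dual sections -/

section BundleForm

/-- A linear map on a finite-dimensional space is a fixed linear expression in its values on a
basis. -/
theorem contMDiffAt_clm_of_apply {E : Type*} [NormedAddCommGroup E] [NormedSpace ℝ E]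
    {H : Type*} [TopologicalSpace H] {I : ModelWithCorners ℝ E H}
    {N : Type*} [TopologicalSpace N] [ChartedSpace H N]
    {F G : Type*} [NormedAddCommGroup F] [NormedSpace ℝ F] [FiniteDimensional ℝ F]
    [NormedAddCommGroup G] [NormedSpace ℝ G] {L : N → F →L[ℝ] G} {x : N}
    (h : ∀ v, ContMDiffAt I 𝓘(ℝ, G) ∞ (fun y ↦ L y v) x) :
    ContMDiffAt I 𝓘(ℝ, F →L[ℝ] G) ∞ L x := by
  let b := Module.finBasis ℝ F
  have hL : L = fun y ↦ ∑ i, ContinuousLinearMap.smulRightL ℝ F G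
      (LinearMap.toContinuousLinearMap (b.coord i)) (L y (b i)) := by
    funext y
    ext v
    conv_lhs => rw [← b.sum_repr v, map_sum]
    simp
  rw [hL]
  refine contMDiffAt_finsetSum fun i _ ↦ ?_
  exact (ContinuousLinearMap.contMDiff _).contMDiffAt.comp x (h (b i))

variable {EB : Type*} [NormedAddCommGroup EB] [NormedSpace ℝ EB]
  {B : Type*} [TopologicalSpace B] [ChartedSpace EB B]
  {F : Type*} [NormedAddCommGroup F] [NormedSpace ℝ F]
  {V : B → Type*} [TopologicalSpace (TotalSpace F V)] [∀ x, NormedAddCommGroup (V x)]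
  [∀ x, InnerProductSpace ℝ (V x)] [FiberBundle F V] [VectorBundle ℝ F V]
  (e : Bundle.Trivialization F (TotalSpace.proj : TotalSpace F V → B))
  [MemTrivializationAtlas e]

/-- The coefficients of the fibre metric in a trivialization. -/
def fibreForm (x : B) : F →L[ℝ] F →L[ℝ] ℝ :=
  (innerSL ℝ : V x →L[ℝ] V x →L[ℝ] ℝ).bilinearComp (e.symmL ℝ x) (e.symmL ℝ x)

variable {e} {x : B}

theorem fibreForm_apply (a b : F) :
    fibreForm e x a b = inner ℝ (e.symmL ℝ x a) (e.symmL ℝ x b) := by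
  rfl

theorem continuousLinearMapAt_eq_snd (hx : x ∈ e.baseSet) (v : V x) :
    e.continuousLinearMapAt ℝ x v = (e ⟨x, v⟩).2 :=
  congrFun (Bundle.Trivialization.coe_linearMapAt_of_mem (R := ℝ) e hx) v

theorem isMetricForm_fibreForm (hx : x ∈ e.baseSet) : IsMetricForm (fibreForm e x) := by
  refine ⟨fun a b ↦ real_inner_comm _ _, fun a ha ↦ ?_⟩
  rw [fibreForm_apply, real_inner_self_eq_norm_sq]
  have : e.symmL ℝ x a ≠ 0 := fun h ↦ ha (by
    rw [← e.continuousLinearMapAt_symmL (R := ℝ) hx a, h, map_zero])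
  positivity

variable [ContMDiffVectorBundle ∞ F V 𝓘(ℝ, EB)]

theorem contMDiffAt_symmL (hx : x ∈ e.baseSet) {f : B → F}
    (hf : ContMDiffAt 𝓘(ℝ, EB) 𝓘(ℝ, F) ∞ f x) :
    ContMDiffAt 𝓘(ℝ, EB) (𝓘(ℝ, EB).prod 𝓘(ℝ, F)) ∞
      (fun y ↦ (⟨y, e.symmL ℝ y (f y)⟩ : TotalSpace F V)) x := by
  rw [Bundle.Trivialization.contMDiffAt_section_iff e hx]
  refine hf.congr_of_eventuallyEq ?_
  filter_upwards [e.open_baseSet.mem_nhds hx] with y hy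
  have := e.continuousLinearMapAt_symmL (R := ℝ) hy (f y)
  rwa [continuousLinearMapAt_eq_snd hy] at this

variable [FiniteDimensional ℝ F] [IsContMDiffRiemannianBundle 𝓘(ℝ, EB) ∞ F V]

theorem contMDiffAt_fibreForm (hx : x ∈ e.baseSet) :
    ContMDiffAt 𝓘(ℝ, EB) 𝓘(ℝ, F →L[ℝ] F →L[ℝ] ℝ) ∞ (fibreForm e) x := by
  refine contMDiffAt_clm_of_apply fun a ↦ contMDiffAt_clm_of_apply fun b ↦ ?_
  exact ContMDiffAt.inner_bundle (b := fun y : B ↦ y)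
    (contMDiffAt_symmL (EB := EB) hx contMDiffAt_const)
    (contMDiffAt_symmL (EB := EB) hx contMDiffAt_const)

variable (e) in
/-- The section dual, by means of the fibre metric, to a functional of the model fibre. -/
def dualSection (φ : F →L[ℝ] ℝ) (x : B) : V x := e.symmL ℝ x ((fibreForm e x).inverse φ)

theorem contMDiffAt_dualSection (hx : x ∈ e.baseSet) (φ : F →L[ℝ] ℝ) :
    ContMDiffAt 𝓘(ℝ, EB) (𝓘(ℝ, EB).prod 𝓘(ℝ, F)) ∞
      (fun y ↦ (⟨y, dualSection e φ y⟩ : TotalSpace F V)) x := by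
  refine contMDiffAt_symmL hx ?_
  obtain ⟨L, hL⟩ := (isMetricForm_fibreForm hx).isInvertible
  have h1 : ContDiffAt ℝ ∞ (ContinuousLinearMap.inverse : (F →L[ℝ] F →L[ℝ] ℝ) → _)
      (fibreForm e x) := by
    rw [← hL]
    exact contDiffAt_map_inverse L
  exact (h1.contMDiffAt.comp x (contMDiffAt_fibreForm (EB := EB) hx)).clm_apply contMDiffAt_const

/-- Riesz representation in the fibre: this is the property that makes `exists_dualFrame` reproduce
a vector from its coordinates. -/
theorem inner_dualSection (hx : x ∈ e.baseSet) (φ : F →L[ℝ] ℝ) (v : V x) :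
    inner ℝ v (dualSection e φ x) = φ (e.continuousLinearMapAt ℝ x v) := by
  rw [← e.symmL_continuousLinearMapAt (R := ℝ) hx v, dualSection, real_inner_comm,
    ← fibreForm_apply, (isMetricForm_fibreForm hx).inverse_apply,
    e.symmL_continuousLinearMapAt (R := ℝ) hx v]

end BundleForm
end

noncomputable section

/-! ### Metric connections -/

section Connection

variable {EB : Type*} [NormedAddCommGroup EB] [NormedSpace ℝ EB]
  {B : Type*} [TopologicalSpace B] [ChartedSpace EB B]
  {F : Type*} [NormedAddCommGroup F] [NormedSpace ℝ F]
  {V : B → Type*} [TopologicalSpace (TotalSpace F V)] [∀ x, NormedAddCommGroup (V x)]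
  [∀ x, InnerProductSpace ℝ (V x)] [FiberBundle F V] [VectorBundle ℝ F V]

/-- On a compact manifold there are finitely many global sections `s i` and `t i` with
`v = ∑ i, ⟪v, s i⟫ t i` for all vectors `v` of the bundle. -/
theorem exists_dualFrame [IsManifold 𝓘(ℝ, EB) ∞ B] [FiniteDimensional ℝ EB] [T2Space B]
    [CompactSpace B] [ContMDiffVectorBundle ∞ F V 𝓘(ℝ, EB)] [FiniteDimensional ℝ F]
    [IsContMDiffRiemannianBundle 𝓘(ℝ, EB) ∞ F V] :
    ∃ (J : Finset B) (s t : J × Fin (Module.finrank ℝ F) → ∀ x, V x),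
      (∀ i, ContMDiff 𝓘(ℝ, EB) (𝓘(ℝ, EB).prod 𝓘(ℝ, F)) ∞
        (fun x ↦ (⟨x, s i x⟩ : TotalSpace F V))) ∧
      (∀ i, ContMDiff 𝓘(ℝ, EB) (𝓘(ℝ, EB).prod 𝓘(ℝ, F)) ∞
        (fun x ↦ (⟨x, t i x⟩ : TotalSpace F V))) ∧
      ∀ x (v : V x), ∑ i, (inner ℝ v (s i x) : ℝ) • t i x = v := by
  obtain ⟨J, hJ⟩ := CompactSpace.elim_nhds_subcover (X := B)
    (fun x ↦ (trivializationAt F V x).baseSet)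
    (fun x ↦ (trivializationAt F V x).open_baseSet.mem_nhds (FiberBundle.mem_baseSet_trivializationAt' x))
  obtain ⟨f, hf⟩ := SmoothPartitionOfUnity.exists_isSubordinate 𝓘(ℝ, EB) isClosed_univ
    (fun j : J ↦ (trivializationAt F V j.1).baseSet) (fun j ↦ (trivializationAt F V j.1).open_baseSet)
    (by
      intro x _
      have : x ∈ ⋃ y ∈ J, (trivializationAt F V y).baseSet := by rw [hJ]; trivial
      simpa using this)
  let b := Module.finBasis ℝ F
  -- Both members of a local dual pair are cut off with `f j`, so the patch `j` reproduces `f j ^ 2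
  -- • v`. Dividing the sections `t` by `S` normalizes the total weight to one.
  let S : B → ℝ := fun x ↦ ∑ j, f j x ^ 2
  have hS : ∀ x, 0 < S x := by
    intro x
    obtain ⟨j, hj⟩ := f.exists_pos_of_mem (mem_univ x)
    exact Finset.sum_pos' (fun i _ ↦ sq_nonneg _) ⟨j, Finset.mem_univ _, by positivity⟩
  have hSs : ContMDiff 𝓘(ℝ, EB) 𝓘(ℝ, ℝ) ∞ S :=
    contMDiff_finsetSum fun j _ ↦ (f j).contMDiff.pow 2
  have hSi : ContMDiff 𝓘(ℝ, EB) 𝓘(ℝ, ℝ) ∞ (fun x ↦ (S x)⁻¹) := hSs.inv₀ fun x ↦ (hS x).ne'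
  refine ⟨J, fun i ↦ (f i.1 : B → ℝ) • dualSection (trivializationAt F V i.1.1)
      (LinearMap.toContinuousLinearMap (b.coord i.2)),
    fun i ↦ (fun x ↦ (S x)⁻¹) • (f i.1 : B → ℝ) •
      fun x ↦ (trivializationAt F V i.1.1).symmL ℝ x (b i.2), fun i ↦ ?_, fun i ↦ ?_, fun x v ↦ ?_⟩
  · exact (f i.1).contMDiff.contMDiffOn.smul_section_of_tsupport
      (trivializationAt F V i.1.1).open_baseSet (hf i.1)
      (fun x hx ↦ (contMDiffAt_dualSection hx _).contMDiffWithinAt)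
  · refine hSi.smul_section ?_
    exact (f i.1).contMDiff.contMDiffOn.smul_section_of_tsupport
      (trivializationAt F V i.1.1).open_baseSet (hf i.1)
      (fun x hx ↦ (contMDiffAt_symmL hx contMDiffAt_const).contMDiffWithinAt)
  · have key (j : J) : ∑ a, (inner ℝ v ((f j x) • dualSection (trivializationAt F V j.1)
        (LinearMap.toContinuousLinearMap (b.coord a)) x) : ℝ) • (S x)⁻¹ • f j x •
          (trivializationAt F V j.1).symmL ℝ x (b a) = ((S x)⁻¹ * f j x ^ 2) • v := by
      by_cases hx : x ∈ (trivializationAt F V j.1).baseSet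
      · have h1 := (trivializationAt F V j.1).symmL_continuousLinearMapAt (R := ℝ) hx v
        conv_rhs => rw [← h1, ← b.sum_repr ((trivializationAt F V j.1).continuousLinearMapAt ℝ x v),
          map_sum, Finset.smul_sum]
        refine Finset.sum_congr rfl fun a _ ↦ ?_
        rw [inner_smul_right, inner_dualSection hx, map_smul, smul_smul, smul_smul, smul_smul]
        congr 1
        simp only [LinearMap.coe_toContinuousLinearMap', Module.Basis.coord_apply]
        ring
      · have : f j x = 0 := image_eq_zero_of_notMem_tsupport fun h ↦ hx (hf j h)
        simp [this]
    rw [Fintype.sum_prod_type]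
    refine (Finset.sum_congr rfl fun j _ ↦ key j).trans ?_
    rw [← Finset.sum_smul, ← Finset.mul_sum, inv_mul_cancel₀ (hS x).ne', one_smul]

/-- The metric connection determined by a pair of dual frames. -/
def dualFrameConnection [IsManifold 𝓘(ℝ, EB) ∞ B] [IsContMDiffRiemannianBundle 𝓘(ℝ, EB) ∞ F V]
    {ι : Type*} [Fintype ι] (s t : ι → ∀ x, V x)
    (hs : ∀ i, ContMDiff 𝓘(ℝ, EB) (𝓘(ℝ, EB).prod 𝓘(ℝ, F)) ∞
        (fun x ↦ (⟨x, s i x⟩ : TotalSpace F V)))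
    (ht : ∀ i, ContMDiff 𝓘(ℝ, EB) (𝓘(ℝ, EB).prod 𝓘(ℝ, F)) ∞
        (fun x ↦ (⟨x, t i x⟩ : TotalSpace F V)))
    (h1 : ∀ x (v : V x), ∑ i, (inner ℝ v (s i x) : ℝ) • t i x = v)
    (h2 : ∀ x (v : V x), ∑ i, (inner ℝ v (t i x) : ℝ) • s i x = v) :
    CovariantDerivative 𝓘(ℝ, EB) F V where
  -- The average of the connection `∑ d⟪σ, s i⟫ t i` and its adjoint `∑ d⟪σ, t i⟫ s i`; the average
  -- of a connection and its adjoint is metric.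
  toFun σ x := (1 / 2 : ℝ) • ∑ i,
    ((mvfderiv 𝓘(ℝ, EB) (fun y ↦ (inner ℝ (σ y) (s i y) : ℝ)) x).smulRight (t i x) +
      (mvfderiv 𝓘(ℝ, EB) (fun y ↦ (inner ℝ (σ y) (t i y) : ℝ)) x).smulRight (s i x))
  isCovariantDerivativeOnUniv := by
    have hs' i x := (hs i).mdifferentiableAt (x := x) (by simp)
    have ht' i x := (ht i).mdifferentiableAt (x := x) (by simp)
    refine ⟨fun {σ σ' x} hσ hσ' _ ↦ ?_, fun {σ g x} hσ hg _ ↦ ?_⟩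
    · rw [← smul_add, ← Finset.sum_add_distrib]
      congr 2
      funext i
      simp only [Pi.add_apply, inner_add_left]
      rw [mvfderiv_fun_add (hσ.inner_bundle (hs' i x)) (hσ'.inner_bundle (hs' i x)),
        mvfderiv_fun_add (hσ.inner_bundle (ht' i x)) (hσ'.inner_bundle (ht' i x))]
      ext X
      simp only [add_apply, ContinuousLinearMap.smulRight_apply, add_smul]
      abel
    · ext X
      have e1 : ∀ i, mvfderiv 𝓘(ℝ, EB) (fun y ↦ (inner ℝ ((g • σ) y) (s i y) : ℝ)) x X =
          g x * mvfderiv 𝓘(ℝ, EB) (fun y ↦ (inner ℝ (σ y) (s i y) : ℝ)) x X +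
          mvfderiv 𝓘(ℝ, EB) g x X * inner ℝ (σ x) (s i x) := fun i ↦ by
        simp only [Pi.smul_apply', real_inner_smul_left]
        rw [mvfderiv_fun_mul hg (hσ.inner_bundle (hs' i x))]
        simp [mul_comm]
      have e2 : ∀ i, mvfderiv 𝓘(ℝ, EB) (fun y ↦ (inner ℝ ((g • σ) y) (t i y) : ℝ)) x X =
          g x * mvfderiv 𝓘(ℝ, EB) (fun y ↦ (inner ℝ (σ y) (t i y) : ℝ)) x X +
          mvfderiv 𝓘(ℝ, EB) g x X * inner ℝ (σ x) (t i x) := fun i ↦ by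
        simp only [Pi.smul_apply', real_inner_smul_left]
        rw [mvfderiv_fun_mul hg (hσ.inner_bundle (ht' i x))]
        simp [mul_comm]
      simp only [smul_apply, add_apply, sum_apply, ContinuousLinearMap.smulRight_apply, e1, e2]
      -- The Leibniz rule uses that `σ` is reproduced by both expansions, hence by their average.
      conv_rhs => rw [show σ x = (1 / 2 : ℝ) • (∑ i, (inner ℝ (σ x) (s i x) : ℝ) • t i x +
        ∑ i, (inner ℝ (σ x) (t i x) : ℝ) • s i x) by rw [h1, h2]; module]
      rw [← Finset.sum_add_distrib, smul_comm (g x), smul_comm (mvfderiv 𝓘(ℝ, EB) g x X),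
        ← smul_add]
      congr 1
      rw [Finset.smul_sum, Finset.smul_sum, ← Finset.sum_add_distrib]
      exact Finset.sum_congr rfl fun i _ ↦ by module

/-- The derivative of a smooth function is smooth along coordinate vector fields. -/
theorem contMDiffAt_mvfderiv_symmL [IsManifold 𝓘(ℝ, EB) ∞ B] {f : B → ℝ} {x : B}
    (hf : ContMDiffAt 𝓘(ℝ, EB) 𝓘(ℝ, ℝ) ∞ f x) (v : EB) :
    ContMDiffAt 𝓘(ℝ, EB) 𝓘(ℝ, ℝ) ∞ (fun y ↦ mvfderiv 𝓘(ℝ, EB) f y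
      ((trivializationAt EB (TangentSpace 𝓘(ℝ, EB) : B → Type _) x).symmL ℝ y v)) x := by
  let c := (chartAt EB x).extend 𝓘(ℝ, EB)
  have hx : x ∈ c.source := by simp [c]
  have hct : c x ∈ c.target := c.map_source hx
  have hcx : c.symm (c x) = x := c.left_inv hx
  have h1 : ContMDiffAt 𝓘(ℝ, EB) 𝓘(ℝ, ℝ) ∞ (f ∘ c.symm) (c x) :=
    ContMDiffAt.comp (c x) (by rw [hcx]; exact hf)
      (contMDiffAt_extend_symm (chart_mem_atlas EB x) hct)
  have h2 : ContDiffAt ℝ ∞ (fun y ↦ fderiv ℝ (f ∘ c.symm) y v) (c x) :=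
    ((contMDiffAt_iff_contDiffAt.1 h1).fderiv_right (m := ∞) le_rfl).clm_apply contDiffAt_const
  refine (h2.contMDiffAt.comp x (contMDiffAt_extend_of_mem (I := 𝓘(ℝ, EB)) (chart_mem_atlas EB x)
    (mem_chart_source EB x))).congr_of_eventuallyEq ?_
  have hev : ∀ᶠ y in 𝓝 x, MDifferentiableAt 𝓘(ℝ, EB) 𝓘(ℝ, ℝ) f y := by
    have h0 : ContMDiffAt 𝓘(ℝ, EB) 𝓘(ℝ, ℝ) 1 f x := hf.of_le (by exact_mod_cast le_top)
    obtain ⟨u, hu, hfu⟩ := (contMDiffAt_iff_contMDiffOn_nhds (by simp)).1 h0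
    filter_upwards [eventually_mem_nhds_iff.2 hu] with y hy
    exact (hfu.contMDiffAt hy).mdifferentiableAt (by simp)
  filter_upwards [hev, (chartAt EB x).open_source.mem_nhds (mem_chart_source EB x)] with y hy hys
  have hyc : y ∈ c.source := by simpa [c] using hys
  have h3 := TangentBundle.symmL_trivializationAt (I := 𝓘(ℝ, EB)) hys
  rw [ModelWithCorners.range_eq_univ, mfderivWithin_univ] at h3
  have hcy : c.symm (c y) = y := c.left_inv hyc
  have h4 := mfderiv_comp (c y) (g := f) (f := c.symm) (I' := 𝓘(ℝ, EB)) (by rw [hcy]; exact hy)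
    ((contMDiffAt_extend_symm (chart_mem_atlas EB x) (c.map_source hyc)).mdifferentiableAt (by simp))
  rw [mfderiv_eq_fderiv] at h4
  change _ = fderiv ℝ (f ∘ c.symm) (c y) v
  rw [h4, h3]
  change mfderiv 𝓘(ℝ, EB) 𝓘(ℝ, ℝ) f y _ = mfderiv 𝓘(ℝ, EB) 𝓘(ℝ, ℝ) f (c.symm (c y)) _
  rw [hcy]
  rfl

/-- Smoothness of a bundle map is tested on the local frames of the tangent bundle, which suffices
in finite dimension. -/
theorem contMDiffAt_hom_of_apply [IsManifold 𝓘(ℝ, EB) ∞ B] [FiniteDimensional ℝ EB]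
    {φ : ∀ x : B, TangentSpace 𝓘(ℝ, EB) x →L[ℝ] V x} {x : B}
    (h : ∀ v : EB, ContMDiffAt 𝓘(ℝ, EB) (𝓘(ℝ, EB).prod 𝓘(ℝ, F)) ∞ (fun y ↦ (⟨y, φ y
      ((trivializationAt EB (TangentSpace 𝓘(ℝ, EB) : B → Type _) x).symmL ℝ y v)⟩ :
        TotalSpace F V)) x) :
    ContMDiffAt 𝓘(ℝ, EB) (𝓘(ℝ, EB).prod 𝓘(ℝ, EB →L[ℝ] F)) ∞ (fun y ↦ (⟨y, φ y⟩ :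
      TotalSpace (EB →L[ℝ] F) (fun x : B ↦ TangentSpace 𝓘(ℝ, EB) x →L[ℝ] V x))) x := by
  refine (contMDiffAt_hom_bundle _).2 ⟨contMDiffAt_id, contMDiffAt_clm_of_apply fun v ↦ ?_⟩
  refine ((Bundle.contMDiffAt_totalSpace).1 (h v)).2.congr_of_eventuallyEq ?_
  filter_upwards [(trivializationAt F V x).open_baseSet.mem_nhds
    (FiberBundle.mem_baseSet_trivializationAt' x)] with y hy
  exact continuousLinearMapAt_eq_snd hy _

theorem mvfderiv_sum {ι : Type*} (T : Finset ι) {f : ι → B → ℝ} {x : B}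
    (h : ∀ i, MDifferentiableAt 𝓘(ℝ, EB) 𝓘(ℝ, ℝ) (f i) x) :
    MDifferentiableAt 𝓘(ℝ, EB) 𝓘(ℝ, ℝ) (fun y ↦ ∑ i ∈ T, f i y) x ∧
      mvfderiv 𝓘(ℝ, EB) (fun y ↦ ∑ i ∈ T, f i y) x = ∑ i ∈ T, mvfderiv 𝓘(ℝ, EB) (f i) x := by
  classical
  induction T using Finset.induction_on with
  | empty =>
    simp only [Finset.sum_empty]
    exact ⟨mdifferentiableAt_const, mvfderiv_const 0⟩
  | insert a T ha ih =>
    simp only [Finset.sum_insert ha]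
    exact ⟨(h a).add ih.1, by rw [mvfderiv_fun_add (h a) ih.1, ih.2]⟩

/-- Existence of a metric connection. -/
theorem exists_metricConnection [IsManifold 𝓘(ℝ, EB) ∞ B] [FiniteDimensional ℝ EB] [T2Space B]
    [CompactSpace B] [ContMDiffVectorBundle ∞ F V 𝓘(ℝ, EB)] [FiniteDimensional ℝ F]
    [IsContMDiffRiemannianBundle 𝓘(ℝ, EB) ∞ F V] :
    ∃ cov : CovariantDerivative 𝓘(ℝ, EB) F V, cov.IsMetricCompatible ∧
      ∀ (σ : ∀ x, V x) (x : B), ContMDiffAt 𝓘(ℝ, EB) (𝓘(ℝ, EB).prod 𝓘(ℝ, F)) ∞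
          (fun y ↦ (⟨y, σ y⟩ : TotalSpace F V)) x →
        ContMDiffAt 𝓘(ℝ, EB) (𝓘(ℝ, EB).prod 𝓘(ℝ, EB →L[ℝ] F)) ∞ (fun y ↦ (⟨y, cov σ y⟩ :
          TotalSpace (EB →L[ℝ] F) (fun x : B ↦ TangentSpace 𝓘(ℝ, EB) x →L[ℝ] V x))) x := by
  obtain ⟨J, s, t, hs, ht, h1⟩ := exists_dualFrame (EB := EB) (F := F) (V := V)
  -- The reproducing formula as an expansion of the scalar product. Its symmetry yields the
  -- reproducing formula with `s` and `t` exchanged.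
  have hsum (x : B) (v w : V x) :
      inner ℝ v w = ∑ i, (inner ℝ v (s i x) : ℝ) * inner ℝ w (t i x) := by
    conv_lhs => rw [← h1 x v, sum_inner]
    refine Finset.sum_congr rfl fun i _ ↦ ?_
    rw [real_inner_smul_left, real_inner_comm w]
  have h2 (x : B) (v : V x) : ∑ i, (inner ℝ v (t i x) : ℝ) • s i x = v := by
    refine ext_inner_left ℝ fun w ↦ ?_
    rw [hsum x w v, inner_sum]
    simp only [real_inner_smul_right, mul_comm]
  have hs' i x := (hs i).mdifferentiableAt (x := x) (by simp)
  have ht' i x := (ht i).mdifferentiableAt (x := x) (by simp)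
  refine ⟨dualFrameConnection s t hs ht h1 h2, ?_, fun σ x hσ ↦ ?_⟩
  · rw [CovariantDerivative.isMetricCompatible_iff]
    intro x X σ τ _ hσ hτ
    have e2 {σ τ : ∀ x, V x} (hσ : MDifferentiableAt 𝓘(ℝ, EB) (𝓘(ℝ, EB).prod 𝓘(ℝ, F))
        (fun y ↦ (⟨y, σ y⟩ : TotalSpace F V)) x) (hτ : MDifferentiableAt 𝓘(ℝ, EB)
        (𝓘(ℝ, EB).prod 𝓘(ℝ, F)) (fun y ↦ (⟨y, τ y⟩ : TotalSpace F V)) x) :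
        mvfderiv 𝓘(ℝ, EB) (fun y ↦ (inner ℝ (σ y) (τ y) : ℝ)) x (X x) = ∑ i,
        ((inner ℝ (σ x) (s i x) : ℝ) *
          mvfderiv 𝓘(ℝ, EB) (fun y ↦ (inner ℝ (τ y) (t i y) : ℝ)) x (X x) +
        (inner ℝ (τ x) (t i x) : ℝ) *
          mvfderiv 𝓘(ℝ, EB) (fun y ↦ (inner ℝ (σ y) (s i y) : ℝ)) x (X x)) := by
      have e1 : (fun y ↦ (inner ℝ (σ y) (τ y) : ℝ)) =
          fun y ↦ ∑ i, (inner ℝ (σ y) (s i y) : ℝ) * inner ℝ (τ y) (t i y) :=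
        funext fun y ↦ hsum y _ _
      rw [e1, (mvfderiv_sum _ (f := fun i y ↦ (inner ℝ (σ y) (s i y) : ℝ) * inner ℝ (τ y) (t i y))
        fun i ↦ (hσ.inner_bundle (hs' i x)).mul (hτ.inner_bundle (ht' i x))).2, sum_apply]
      refine Finset.sum_congr rfl fun i _ ↦ ?_
      rw [mvfderiv_fun_mul (hσ.inner_bundle (hs' i x)) (hτ.inner_bundle (ht' i x))]
      simp
    -- The derivative of `⟪σ, τ⟫` is expanded twice, with the roles of `σ` and `τ` exchanged. Half
    -- the sum of the two expansions regroups into `⟪∇σ, τ⟫ + ⟪σ, ∇τ⟫`.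
    have e4 := e2 hτ hσ
    rw [show (fun y ↦ (inner ℝ (τ y) (σ y) : ℝ)) = fun y ↦ inner ℝ (σ y) (τ y) from
      funext fun y ↦ real_inner_comm _ _] at e4
    have e5 : mvfderiv 𝓘(ℝ, EB) (fun y ↦ (inner ℝ (σ y) (τ y) : ℝ)) x (X x) =
        (1 / 2 : ℝ) * (mvfderiv 𝓘(ℝ, EB) (fun y ↦ (inner ℝ (σ y) (τ y) : ℝ)) x (X x) +
          mvfderiv 𝓘(ℝ, EB) (fun y ↦ (inner ℝ (σ y) (τ y) : ℝ)) x (X x)) := by ring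
    have e6 (σ τ : ∀ x, V x) : inner ℝ (dualFrameConnection s t hs ht h1 h2 σ x (X x)) (τ x) =
        (1 / 2 : ℝ) * ∑ i, (mvfderiv 𝓘(ℝ, EB) (fun y ↦ (inner ℝ (σ y) (s i y) : ℝ)) x (X x) *
          inner ℝ (τ x) (t i x) + mvfderiv 𝓘(ℝ, EB) (fun y ↦ (inner ℝ (σ y) (t i y) : ℝ)) x (X x) *
          inner ℝ (τ x) (s i x)) := by
      simp only [dualFrameConnection, smul_apply, sum_apply, add_apply,
        ContinuousLinearMap.smulRight_apply, real_inner_smul_left, sum_inner, inner_add_left]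
      simp only [real_inner_comm (τ x)]
    refine (e5.trans (congrArg (fun c ↦ (1 / 2 : ℝ) * c) (congrArg₂ (· + ·) (e2 hσ hτ) e4))).trans ?_
    change _ = inner ℝ (dualFrameConnection s t hs ht h1 h2 σ x (X x)) (τ x) +
      inner ℝ (σ x) (dualFrameConnection s t hs ht h1 h2 τ x (X x))
    rw [e6, real_inner_comm, e6, ← mul_add]
    simp only [← Finset.sum_add_distrib]
    congr 1
    exact Finset.sum_congr rfl fun i _ ↦ by ring
  · refine contMDiffAt_hom_of_apply fun v ↦ ?_
    have h (i) := (((contMDiffAt_mvfderiv_symmL (hσ.inner_bundle (hs i x)) v).smul_section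
      (ht i x)).add_section ((contMDiffAt_mvfderiv_symmL (hσ.inner_bundle (ht i x))
        v).smul_section (hs i x)))
    have h3 := (ContMDiffAt.sum_section (s := Finset.univ) fun i _ ↦ h i).const_smul_section
      (a := (1 / 2 : ℝ))
    refine h3.congr_of_eventuallyEq (Filter.Eventually.of_forall fun y ↦ ?_)
    simp [dualFrameConnection]

end Connection
end

noncomputable section

/-! ### The connection form in a trivialization -/

section ConnectionForm

variable {EB : Type*} [NormedAddCommGroup EB] [NormedSpace ℝ EB]
  {B : Type*} [TopologicalSpace B] [ChartedSpace EB B]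
  {F : Type*} [NormedAddCommGroup F] [NormedSpace ℝ F] [FiniteDimensional ℝ F]
  {V : B → Type*} [TopologicalSpace (TotalSpace F V)] [∀ x, NormedAddCommGroup (V x)]
  [∀ x, InnerProductSpace ℝ (V x)] [FiberBundle F V] [VectorBundle ℝ F V]
  (cov : CovariantDerivative 𝓘(ℝ, EB) F V)
  (e : Bundle.Trivialization F (TotalSpace.proj : TotalSpace F V → B))
  [MemTrivializationAtlas e]

/-- The connection form in a trivialization. -/
def connectionForm (p : B) : TangentSpace 𝓘(ℝ, EB) p →L[ℝ] F →L[ℝ] F :=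
  ∑ i, (ContinuousLinearMap.smulRightL ℝ F F
      (LinearMap.toContinuousLinearMap ((Module.finBasis ℝ F).coord i))) ∘L
    (e.continuousLinearMapAt ℝ p ∘L cov (fun y ↦ e.symmL ℝ y (Module.finBasis ℝ F i)) p)

theorem connectionForm_apply (p : B) (X : TangentSpace 𝓘(ℝ, EB) p) (a : F) :
    connectionForm cov e p X a = ∑ i, (Module.finBasis ℝ F).repr a i •
      e.continuousLinearMapAt ℝ p (cov (fun y ↦ e.symmL ℝ y (Module.finBasis ℝ F i)) p X) := by
  simp [connectionForm]

theorem CovariantDerivative.sum_apply {ι : Type*} (T : Finset ι) {σ : ι → ∀ x, V x} {x : B}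
    (h : ∀ i, MDifferentiableAt 𝓘(ℝ, EB) (𝓘(ℝ, EB).prod 𝓘(ℝ, F))
      (fun y ↦ (⟨y, σ i y⟩ : TotalSpace F V)) x) :
    MDifferentiableAt 𝓘(ℝ, EB) (𝓘(ℝ, EB).prod 𝓘(ℝ, F))
      (fun y ↦ (⟨y, (∑ i ∈ T, σ i) y⟩ : TotalSpace F V)) x ∧
    cov (∑ i ∈ T, σ i) x = ∑ i ∈ T, cov (σ i) x := by
  classical
  induction T using Finset.induction_on with
  | empty =>
    simp only [Finset.sum_empty]
    exact ⟨Bundle.mdifferentiableAt_zeroSection .., by simp⟩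
  | insert a T ha ih =>
    simp only [Finset.sum_insert ha]
    exact ⟨mdifferentiableAt_add_section (h a) ih.1, by
      rw [cov.isCovariantDerivativeOnUniv.add (h a) ih.1, ih.2]⟩

variable [ContMDiffVectorBundle ∞ F V 𝓘(ℝ, EB)] {e} {p : B}

theorem mdifferentiableAt_continuousLinearMapAt (hp : p ∈ e.baseSet) {σ : ∀ x, V x}
    (hσ : MDifferentiableAt 𝓘(ℝ, EB) (𝓘(ℝ, EB).prod 𝓘(ℝ, F))
      (fun y ↦ (⟨y, σ y⟩ : TotalSpace F V)) p) :
    MDifferentiableAt 𝓘(ℝ, EB) 𝓘(ℝ, F) (fun y ↦ e.continuousLinearMapAt ℝ y (σ y)) p := by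
  have h := (e.mdifferentiableAt_section_iff 𝓘(ℝ, EB) σ hp).1 hσ
  refine h.congr_of_eventuallyEq ?_
  filter_upwards [e.open_baseSet.mem_nhds hp] with y hy
  exact continuousLinearMapAt_eq_snd hy _

/-- The covariant derivative in a trivialization. -/
theorem continuousLinearMapAt_cov (hp : p ∈ e.baseSet) {σ : ∀ x, V x}
    (hσ : MDifferentiableAt 𝓘(ℝ, EB) (𝓘(ℝ, EB).prod 𝓘(ℝ, F))
      (fun y ↦ (⟨y, σ y⟩ : TotalSpace F V)) p) (X : TangentSpace 𝓘(ℝ, EB) p) :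
    e.continuousLinearMapAt ℝ p (cov σ p X) =
      mvfderiv 𝓘(ℝ, EB) (fun y ↦ e.continuousLinearMapAt ℝ y (σ y)) p X +
        connectionForm cov e p X (e.continuousLinearMapAt ℝ p (σ p)) := by
  let b := Module.finBasis ℝ F
  let s : B → F := fun y ↦ e.continuousLinearMapAt ℝ y (σ y)
  let f : Fin (Module.finrank ℝ F) → B → ℝ := fun i y ↦ b.repr (s y) i
  have hs : MDifferentiableAt 𝓘(ℝ, EB) 𝓘(ℝ, F) s p := mdifferentiableAt_continuousLinearMapAt hp hσ
  have hcoord (i) : MDifferentiableAt 𝓘(ℝ, F) 𝓘(ℝ, ℝ)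
      (LinearMap.toContinuousLinearMap (b.coord i)) (s p) :=
    (ContinuousLinearMap.contMDiff (n := 1) _).mdifferentiableAt (by simp)
  have hf (i) : MDifferentiableAt 𝓘(ℝ, EB) 𝓘(ℝ, ℝ) (f i) p := (hcoord i).comp p hs
  have hdf (i) : mvfderiv 𝓘(ℝ, EB) (f i) p X = b.repr (mvfderiv 𝓘(ℝ, EB) s p X) i := by
    have h1 := mfderiv_comp p (hcoord i) hs
    rw [mfderiv_eq_fderiv, ContinuousLinearMap.fderiv] at h1
    exact congrArg (fun L : TangentSpace 𝓘(ℝ, EB) p →L[ℝ] ℝ ↦ L X) h1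
  have hfr (i) : MDifferentiableAt 𝓘(ℝ, EB) (𝓘(ℝ, EB).prod 𝓘(ℝ, F))
      (fun y ↦ (⟨y, e.symmL ℝ y (b i)⟩ : TotalSpace F V)) p :=
    (contMDiffAt_symmL hp contMDiffAt_const).mdifferentiableAt (by simp)
  have hfs (i) : MDifferentiableAt 𝓘(ℝ, EB) (𝓘(ℝ, EB).prod 𝓘(ℝ, F))
      (fun y ↦ (⟨y, (f i • fun y ↦ e.symmL ℝ y (b i) : ∀ y, V y) y⟩ : TotalSpace F V)) p :=
    (hf i).smul_section (hfr i)
  -- Near `p` the section is a combination of the local frame, and a covariant derivative is local;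
  -- it remains to apply the Leibniz rule to each term.
  have hσ' : ∀ᶠ y in 𝓝 p, σ y = (∑ i, (f i • fun y ↦ e.symmL ℝ y (b i) : ∀ y, V y)) y := by
    filter_upwards [e.open_baseSet.mem_nhds hp] with y hy
    conv_lhs => rw [← e.symmL_continuousLinearMapAt (R := ℝ) hy (σ y),
      ← b.sum_repr (e.continuousLinearMapAt ℝ y (σ y)), map_sum]
    simp [f, s]
  have hsum := cov.sum_apply Finset.univ hfs
  rw [cov.isCovariantDerivativeOnUniv.congr_of_eventuallyEq hσ hsum.1 Filter.univ_mem hσ', hsum.2,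
    _root_.sum_apply, map_sum]
  have hl (i) := cov.isCovariantDerivativeOnUniv.leibniz (hfr i) (hf i) (mem_univ p)
  have hterm (i) : e.continuousLinearMapAt ℝ p
      (cov (f i • fun y ↦ e.symmL ℝ y (b i)) p X) =
      b.repr (s p) i • e.continuousLinearMapAt ℝ p (cov (fun y ↦ e.symmL ℝ y (b i)) p X) +
        b.repr (mvfderiv 𝓘(ℝ, EB) s p X) i • b i := by
    rw [hl i, add_apply, map_add, smul_apply, ContinuousLinearMap.smulRight_apply, map_smul,
      map_smul, hdf i, e.continuousLinearMapAt_symmL (R := ℝ) hp]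
  rw [Finset.sum_congr rfl fun i _ ↦ hterm i, Finset.sum_add_distrib, b.sum_repr,
    connectionForm_apply, add_comm]

/-- The connection form is the covariant derivative of the constant sections. -/
theorem connectionForm_eq (hp : p ∈ e.baseSet) (X : TangentSpace 𝓘(ℝ, EB) p) (a : F) :
    connectionForm cov e p X a =
      e.continuousLinearMapAt ℝ p (cov (fun y ↦ e.symmL ℝ y a) p X) := by
  rw [continuousLinearMapAt_cov cov hp
    ((contMDiffAt_symmL hp contMDiffAt_const).mdifferentiableAt (by simp)),
    e.continuousLinearMapAt_symmL (R := ℝ) hp]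
  have h : (fun y ↦ e.continuousLinearMapAt ℝ y (e.symmL ℝ y a)) =ᶠ[𝓝 p] fun _ ↦ a := by
    filter_upwards [e.open_baseSet.mem_nhds hp] with y hy
    exact e.continuousLinearMapAt_symmL (R := ℝ) hy a
  have h2 : mvfderiv 𝓘(ℝ, EB) (fun y ↦ e.continuousLinearMapAt ℝ y (e.symmL ℝ y a)) p X = 0 := by
    have := h.mfderiv_eq (I := 𝓘(ℝ, EB)) (I' := 𝓘(ℝ, F))
    rw [mfderiv_const] at this
    exact congrArg (fun L : TangentSpace 𝓘(ℝ, EB) p →L[ℝ] F ↦ L X) this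
  rw [h2, zero_add]

variable {cov}

/-- Metric compatibility for the constant sections of the trivialization; in a chart it becomes the
field `compat` of `LocalBundleData`. -/
theorem mfderiv_fibreForm [IsContMDiffRiemannianBundle 𝓘(ℝ, EB) ∞ F V]
    (hcov : cov.IsMetricCompatible) (hp : p ∈ e.baseSet)
    (X : TangentSpace 𝓘(ℝ, EB) p) (a b : F) :
    mvfderiv 𝓘(ℝ, EB) (fun y ↦ fibreForm e y a b) p X =
      fibreForm e p (connectionForm cov e p X a) b +
        fibreForm e p a (connectionForm cov e p X b) := by
  classical
  have h (a : F) : MDifferentiableAt 𝓘(ℝ, EB) (𝓘(ℝ, EB).prod 𝓘(ℝ, F))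
      (fun y ↦ (⟨y, e.symmL ℝ y a⟩ : TotalSpace F V)) p :=
    (contMDiffAt_symmL hp contMDiffAt_const).mdifferentiableAt (by simp)
  -- Compatibility is stated for vector fields, but only the value at `p` enters, so the field may
  -- vanish at all other points.
  have h1 := hcov.mvfderiv_inner_eq (Pi.single p X) (h a) (h b)
  rw [Pi.single_eq_same] at h1
  refine h1.trans ?_
  simp only [fibreForm_apply, connectionForm_eq cov hp, e.symmL_continuousLinearMapAt (R := ℝ) hp,
    Pi.single_eq_same]

end ConnectionForm
end

noncomputable section

/-! ### Coordinates of the bundle given by a chart and a trivialization -/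

section BundleChart

variable {EB : Type*} [NormedAddCommGroup EB] [NormedSpace ℝ EB]
  {B : Type*} [TopologicalSpace B] [ChartedSpace EB B] [IsManifold 𝓘(ℝ, EB) ∞ B]
  {F : Type*} [NormedAddCommGroup F] [NormedSpace ℝ F]
  {V : B → Type*} [TopologicalSpace (TotalSpace F V)] [∀ x, NormedAddCommGroup (V x)]
  [∀ x, InnerProductSpace ℝ (V x)] [FiberBundle F V] [VectorBundle ℝ F V]

/-- A covariant derivative which maps sections smooth at a point to forms smooth at this point. -/
def CovariantDerivative.PreservesSmoothAt (cov : CovariantDerivative 𝓘(ℝ, EB) F V) : Prop :=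
  ∀ (σ : ∀ x, V x) (x : B), ContMDiffAt 𝓘(ℝ, EB) (𝓘(ℝ, EB).prod 𝓘(ℝ, F)) ∞
      (fun y ↦ (⟨y, σ y⟩ : TotalSpace F V)) x →
    ContMDiffAt 𝓘(ℝ, EB) (𝓘(ℝ, EB).prod 𝓘(ℝ, EB →L[ℝ] F)) ∞ (fun y ↦ (⟨y, cov σ y⟩ :
      TotalSpace (EB →L[ℝ] F) (fun x : B ↦ TangentSpace 𝓘(ℝ, EB) x →L[ℝ] V x))) x

/-- The pointwise notion is the one that applies to constant sections of a trivialization, which are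
known to be smooth only over its base set. It implies the global notion. -/
theorem CovariantDerivative.PreservesSmoothAt.contMDiffCovariantDerivative
    {cov : CovariantDerivative 𝓘(ℝ, EB) F V} (h : cov.PreservesSmoothAt) :
    cov.ContMDiffCovariantDerivative ∞ := by
  refine ⟨⟨fun {σ} hσ x _ ↦ (h σ x ?_).contMDiffWithinAt⟩⟩
  exact (hσ.contMDiffAt Filter.univ_mem).of_le (by simp)

variable (c : OpenPartialHomeomorph B EB)
  (e : Bundle.Trivialization F (TotalSpace.proj : TotalSpace F V → B))
  [MemTrivializationAtlas e]

/-- The domain of the coordinates given by a chart of the base and a trivialization. -/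
def bundleChartDomain : Set EB :=
  (c.extend 𝓘(ℝ, EB)).target ∩ (c.extend 𝓘(ℝ, EB)).symm ⁻¹' e.baseSet

/-- The parametrization of the total space given by a chart of the base and a trivialization. -/
def bundlePoint (z : EB × F) : TotalSpace F V :=
  ⟨(c.extend 𝓘(ℝ, EB)).symm z.1, e.symmL ℝ ((c.extend 𝓘(ℝ, EB)).symm z.1) z.2⟩

variable {c e}

theorem isOpen_bundleChartDomain (hc : c ∈ atlas EB B) : IsOpen (bundleChartDomain c e) := by
  have h : ContinuousOn (c.extend 𝓘(ℝ, EB)).symm (c.extend 𝓘(ℝ, EB)).target := fun x hx ↦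
    (contMDiffAt_extend_symm hc hx).continuousAt.continuousWithinAt
  exact h.isOpen_inter_preimage (c.isOpen_extend_target (I := 𝓘(ℝ, EB))) e.open_baseSet

variable [ContMDiffVectorBundle ∞ F V 𝓘(ℝ, EB)]

/-- Smoothness of maps into the total space given in a trivialization. -/
theorem contMDiffAt_mk_symmL {E' H' N : Type*} [NormedAddCommGroup E'] [NormedSpace ℝ E']
    [TopologicalSpace H'] {I' : ModelWithCorners ℝ E' H'} [TopologicalSpace N] [ChartedSpace H' N]
    {f : N → B} {g : N → F} {x : N} (hx : f x ∈ e.baseSet)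
    (hf : ContMDiffAt I' 𝓘(ℝ, EB) ∞ f x) (hg : ContMDiffAt I' 𝓘(ℝ, F) ∞ g x) :
    ContMDiffAt I' (𝓘(ℝ, EB).prod 𝓘(ℝ, F)) ∞
      (fun y ↦ (⟨f y, e.symmL ℝ (f y) (g y)⟩ : TotalSpace F V)) x := by
  have hev : ∀ᶠ y in 𝓝 x, (e (⟨f y, e.symmL ℝ (f y) (g y)⟩ : TotalSpace F V)).2 = g y := by
    filter_upwards [hf.continuousAt.eventually_mem (e.open_baseSet.mem_nhds hx)] with y hy
    have := e.continuousLinearMapAt_symmL (R := ℝ) hy (g y)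
    rwa [continuousLinearMapAt_eq_snd hy] at this
  exact (e.contMDiffAt_iff (e.mem_source.2 hx)).2 ⟨hf, hg.congr_of_eventuallyEq hev⟩

theorem contMDiffAt_bundlePoint (hc : c ∈ atlas EB B) {z : EB × F}
    (hz : z.1 ∈ bundleChartDomain c e) :
    ContMDiffAt 𝓘(ℝ, EB × F) (𝓘(ℝ, EB).prod 𝓘(ℝ, F)) ∞ (bundlePoint c e) z :=
  contMDiffAt_mk_symmL (f := fun z : EB × F ↦ (c.extend 𝓘(ℝ, EB)).symm z.1) hz.2
    ((contMDiffAt_extend_symm hc hz.1).comp z contDiff_fst.contMDiff.contMDiffAt)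
    contDiff_snd.contMDiff.contMDiffAt

variable [FiniteDimensional ℝ F] (cov : CovariantDerivative 𝓘(ℝ, EB) F V)

variable (c e) in
/-- The connection form in a chart of the base and a trivialization. -/
def connectionFormInChart (x : EB) : EB →L[ℝ] F →L[ℝ] F :=
  let L : EB →L[ℝ] TangentSpace 𝓘(ℝ, EB) ((c.extend 𝓘(ℝ, EB)).symm x) :=
    mfderiv 𝓘(ℝ, EB) 𝓘(ℝ, EB) (c.extend 𝓘(ℝ, EB)).symm x
  connectionForm cov e ((c.extend 𝓘(ℝ, EB)).symm x) ∘L L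

theorem connectionFormInChart_apply (x X : EB) : connectionFormInChart c e cov x X =
    connectionForm cov e ((c.extend 𝓘(ℝ, EB)).symm x)
      (mfderiv 𝓘(ℝ, EB) 𝓘(ℝ, EB) (c.extend 𝓘(ℝ, EB)).symm x X) := rfl

variable {cov} [FiniteDimensional ℝ EB]

theorem contDiffAt_connectionFormInChart (hcov : cov.PreservesSmoothAt) (hc : c ∈ atlas EB B)
    {x : EB} (hx : x ∈ bundleChartDomain c e) :
    ContDiffAt ℝ ∞ (connectionFormInChart c e cov) x := by
  refine contMDiffAt_iff_contDiffAt.1 (contMDiffAt_clm_of_apply fun X ↦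
    contMDiffAt_clm_of_apply fun a ↦ ?_)
  have h1 := (hcov (fun y ↦ e.symmL ℝ y a) _ (contMDiffAt_symmL hx.2 contMDiffAt_const)).comp x
    (contMDiffAt_extend_symm hc hx.1)
  have h2 := ContMDiffAt.clm_bundle_apply (F₁ := EB) (F₂ := F) h1
    (contMDiffAt_coordinateField hc hx.1 X)
  have h3 := ((e.contMDiffAt_iff (f := fun y ↦ (⟨(c.extend 𝓘(ℝ, EB)).symm y,
    cov (fun y ↦ e.symmL ℝ y a) ((c.extend 𝓘(ℝ, EB)).symm y)
      (mfderiv 𝓘(ℝ, EB) 𝓘(ℝ, EB) (c.extend 𝓘(ℝ, EB)).symm y X)⟩ : TotalSpace F V))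
    (e.mem_source.2 hx.2)).1 h2).2
  refine h3.congr_of_eventuallyEq ?_
  filter_upwards [(isOpen_bundleChartDomain hc).mem_nhds hx] with y hy
  rw [connectionFormInChart_apply, connectionForm_eq cov hy.2, continuousLinearMapAt_eq_snd hy.2]

variable [IsContMDiffRiemannianBundle 𝓘(ℝ, EB) ∞ F V]

variable (e) in
/-- The local data of a vector bundle with base metric, fibre metric and metric connection. -/
def localBundleData (gM : SmoothMetric 𝓘(ℝ, EB) B) (hs : cov.PreservesSmoothAt)
    (hm : cov.IsMetricCompatible) (hc : c ∈ atlas EB B) : LocalBundleData EB F where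
  U := bundleChartDomain c e
  isOpen := isOpen_bundleChartDomain hc
  g := metricInChart gM c
  k x := fibreForm e ((c.extend 𝓘(ℝ, EB)).symm x)
  A := connectionFormInChart c e cov
  contDiffOn_g x hx := (contDiffAt_metricInChart gM hc hx.1).contDiffWithinAt
  contDiffOn_k x hx := (contMDiffAt_iff_contDiffAt.1 ((contMDiffAt_fibreForm hx.2).comp x
    (contMDiffAt_extend_symm hc hx.1))).contDiffWithinAt
  contDiffOn_A x hx := (contDiffAt_connectionFormInChart hs hc hx).contDiffWithinAt
  metric_g x hx := isMetricForm_metricInChart gM hc hx.1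
  metric_k x hx := isMetricForm_fibreForm hx.2
  compat x hx X a b := by
    have hk : DifferentiableAt ℝ (fun x ↦ fibreForm e ((c.extend 𝓘(ℝ, EB)).symm x)) x :=
      (contMDiffAt_iff_contDiffAt.1 ((contMDiffAt_fibreForm hx.2).comp x
        (contMDiffAt_extend_symm hc hx.1))).differentiableAt (by simp)
    have h1 : fderiv ℝ (fun x ↦ fibreForm e ((c.extend 𝓘(ℝ, EB)).symm x)) x X a b =
        fderiv ℝ (fun x ↦ fibreForm e ((c.extend 𝓘(ℝ, EB)).symm x) a b) x X := by
      have := ((hk.hasFDerivAt.clm_apply (hasFDerivAt_const a x)).clm_apply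
        (hasFDerivAt_const b x)).fderiv
      rw [this]
      simp
    have h2 : MDifferentiableAt 𝓘(ℝ, EB) 𝓘(ℝ, ℝ) (fun y ↦ fibreForm e y a b)
        ((c.extend 𝓘(ℝ, EB)).symm x) :=
      (((contMDiffAt_fibreForm (EB := EB) hx.2).clm_apply contMDiffAt_const).clm_apply
        contMDiffAt_const).mdifferentiableAt (by simp)
    have h3 := mfderiv_comp x h2
      ((contMDiffAt_extend_symm (I := 𝓘(ℝ, EB)) hc hx.1).mdifferentiableAt (by simp))
    rw [mfderiv_eq_fderiv] at h3
    have h4 := mfderiv_fibreForm hm hx.2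
      (mfderiv 𝓘(ℝ, EB) 𝓘(ℝ, EB) (c.extend 𝓘(ℝ, EB)).symm x X) a b
    rw [h1]
    refine Eq.trans ?_ h4
    exact congrArg (fun L : EB →L[ℝ] ℝ ↦ L X) h3

end BundleChart
end

noncomputable section

/-! ### The connection metric -/

section Connector

variable {EB : Type*} [NormedAddCommGroup EB] [NormedSpace ℝ EB]
  {B : Type*} [TopologicalSpace B] [ChartedSpace EB B] [IsManifold 𝓘(ℝ, EB) ∞ B]
  {F : Type*} [NormedAddCommGroup F] [NormedSpace ℝ F] [FiniteDimensional ℝ F]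
  {V : B → Type*} [TopologicalSpace (TotalSpace F V)] [∀ x, NormedAddCommGroup (V x)]
  [∀ x, InnerProductSpace ℝ (V x)] [FiberBundle F V] [VectorBundle ℝ F V]
  (cov : CovariantDerivative 𝓘(ℝ, EB) F V)

variable (EB) in
/-- The derivative of the projection of the total space. -/
def dproj (v : TotalSpace F V) :
    TangentSpace (𝓘(ℝ, EB).prod 𝓘(ℝ, F)) v →L[ℝ] TangentSpace 𝓘(ℝ, EB) v.1 :=
  mfderiv (𝓘(ℝ, EB).prod 𝓘(ℝ, F)) 𝓘(ℝ, EB) (TotalSpace.proj : TotalSpace F V → B) v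

/-- The vertical part of a tangent vector of the total space. -/
def connector (v : TotalSpace F V) :
    TangentSpace (𝓘(ℝ, EB).prod 𝓘(ℝ, F)) v →L[ℝ] V v.1 :=
  (trivializationAt F V v.1).symmL ℝ v.1 ∘L
    (mvfderiv (𝓘(ℝ, EB).prod 𝓘(ℝ, F)) (fun w : TotalSpace F V ↦ (trivializationAt F V v.1 w).2) v +
      ContinuousLinearMap.apply ℝ F (trivializationAt F V v.1 v).2 ∘L
        (connectionForm cov (trivializationAt F V v.1) v.1 ∘L dproj EB v))

variable [ContMDiffVectorBundle ∞ F V 𝓘(ℝ, EB)]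

theorem dproj_mfderiv_section {σ : ∀ x, V x} {p : B}
    (hσ : MDifferentiableAt 𝓘(ℝ, EB) (𝓘(ℝ, EB).prod 𝓘(ℝ, F))
      (fun y ↦ (⟨y, σ y⟩ : TotalSpace F V)) p) (X : TangentSpace 𝓘(ℝ, EB) p) :
    dproj EB (⟨p, σ p⟩ : TotalSpace F V) (mfderiv 𝓘(ℝ, EB) (𝓘(ℝ, EB).prod 𝓘(ℝ, F))
      (fun y ↦ (⟨y, σ y⟩ : TotalSpace F V)) p X) = X := by
  have h1 : MDifferentiableAt (𝓘(ℝ, EB).prod 𝓘(ℝ, F)) 𝓘(ℝ, EB)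
      (TotalSpace.proj : TotalSpace F V → B) ⟨p, σ p⟩ :=
    (Bundle.contMDiff_proj V (n := 1)).mdifferentiableAt (by simp)
  have h2 := mfderiv_comp p h1 hσ
  have h3 : (TotalSpace.proj : TotalSpace F V → B) ∘ (fun y ↦ (⟨y, σ y⟩ : TotalSpace F V)) = id :=
    rfl
  rw [h3, mfderiv_id] at h2
  exact (congrArg (fun L : TangentSpace 𝓘(ℝ, EB) p →L[ℝ] TangentSpace 𝓘(ℝ, EB) p ↦ L X) h2).symm

theorem mdifferentiableAt_trivialization_snd
    {e : Bundle.Trivialization F (TotalSpace.proj : TotalSpace F V → B)} [MemTrivializationAtlas e]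
    {v : TotalSpace F V} (hv : v.1 ∈ e.baseSet) :
    MDifferentiableAt (𝓘(ℝ, EB).prod 𝓘(ℝ, F)) 𝓘(ℝ, F) (fun w : TotalSpace F V ↦ (e w).2) v :=
  ((e.contMDiffAt_iff (n := ∞) (IB := 𝓘(ℝ, EB)) (IM := 𝓘(ℝ, EB).prod 𝓘(ℝ, F)) (f := id)
    (e.mem_source.2 hv)).1 contMDiffAt_id).2.mdifferentiableAt (by simp)

/-- Together with `connector_verticalLift` this determines the connector on tangent vectors of the
form `dσ(X) + (vertical lift)`. It can then be computed in any trivialization, although it is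
defined by the preferred one. -/
theorem connector_mfderiv_section {σ : ∀ x, V x} {p : B}
    (hσ : MDifferentiableAt 𝓘(ℝ, EB) (𝓘(ℝ, EB).prod 𝓘(ℝ, F))
      (fun y ↦ (⟨y, σ y⟩ : TotalSpace F V)) p) (X : TangentSpace 𝓘(ℝ, EB) p) :
    connector cov (⟨p, σ p⟩ : TotalSpace F V) (mfderiv 𝓘(ℝ, EB) (𝓘(ℝ, EB).prod 𝓘(ℝ, F))
      (fun y ↦ (⟨y, σ y⟩ : TotalSpace F V)) p X) = cov σ p X := by
  set e := trivializationAt F V p with he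
  have hp : p ∈ e.baseSet := FiberBundle.mem_baseSet_trivializationAt' p
  rw [← e.symmL_continuousLinearMapAt (R := ℝ) hp (cov σ p X), continuousLinearMapAt_cov cov hp hσ]
  have h1 := mfderiv_comp p (mdifferentiableAt_trivialization_snd (EB := EB) (e := e)
    (v := ⟨p, σ p⟩) hp) hσ
  have h2 : (fun w : TotalSpace F V ↦ (e w).2) ∘ (fun y ↦ (⟨y, σ y⟩ : TotalSpace F V)) =ᶠ[𝓝 p]
      fun y ↦ e.continuousLinearMapAt ℝ y (σ y) := by
    filter_upwards [e.open_baseSet.mem_nhds hp] with y hy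
    exact (continuousLinearMapAt_eq_snd hy _).symm
  rw [h2.mfderiv_eq] at h1
  have h3 : mvfderiv 𝓘(ℝ, EB) (fun y ↦ e.continuousLinearMapAt ℝ y (σ y)) p X =
      mvfderiv (𝓘(ℝ, EB).prod 𝓘(ℝ, F)) (fun w : TotalSpace F V ↦ (e w).2) ⟨p, σ p⟩
        (mfderiv 𝓘(ℝ, EB) (𝓘(ℝ, EB).prod 𝓘(ℝ, F)) (fun y ↦ (⟨y, σ y⟩ : TotalSpace F V)) p X) :=
    congrArg (fun L : TangentSpace 𝓘(ℝ, EB) p →L[ℝ] F ↦ L X) h1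
  rw [h3, continuousLinearMapAt_eq_snd hp]
  change e.symmL ℝ p (_ + connectionForm cov e p (dproj EB (⟨p, σ p⟩ : TotalSpace F V) _) _) = _
  rw [dproj_mfderiv_section hσ]
  rfl

theorem contMDiff_fibreLine {p : B} (v w : V p) :
    ContMDiff 𝓘(ℝ, ℝ) (𝓘(ℝ, EB).prod 𝓘(ℝ, F)) ∞
      (fun t : ℝ ↦ (⟨p, v + t • w⟩ : TotalSpace F V)) := by
  set e := trivializationAt F V p with he
  have hp : p ∈ e.baseSet := FiberBundle.mem_baseSet_trivializationAt' p
  intro t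
  have h : (fun t : ℝ ↦ (⟨p, v + t • w⟩ : TotalSpace F V)) = fun t ↦
      ⟨p, e.symmL ℝ p (e.continuousLinearMapAt ℝ p v + t • e.continuousLinearMapAt ℝ p w)⟩ := by
    funext t
    rw [← map_smul, ← map_add, e.symmL_continuousLinearMapAt (R := ℝ) hp]
  rw [h]
  refine contMDiffAt_mk_symmL (f := fun _ : ℝ ↦ p) hp contMDiffAt_const ?_
  exact ContDiffAt.contMDiffAt (by fun_prop)

/-- The chain rule for the line `v + t w`. At `t = 0` it passes through `v + 0 • w`, equal to `v`
only propositionally, so the derivative of `f` is treated as a map between the model spaces. -/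
theorem mfderiv_comp_fibreLine {p : B} (v w : V p) {E' H' N : Type*} [NormedAddCommGroup E']
    [NormedSpace ℝ E'] [TopologicalSpace H'] {I' : ModelWithCorners ℝ E' H'} [TopologicalSpace N]
    [ChartedSpace H' N] {f : TotalSpace F V → N}
    (hf : MDifferentiableAt (𝓘(ℝ, EB).prod 𝓘(ℝ, F)) I' f ⟨p, v⟩) :
    mfderiv (𝓘(ℝ, EB).prod 𝓘(ℝ, F)) I' f ⟨p, v⟩ (verticalLift EB F v w) =
      mfderiv 𝓘(ℝ, ℝ) I' (fun t : ℝ ↦ f ⟨p, v + t • w⟩) 0 (1 : ℝ) := by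
  let L : EB × F →L[ℝ] E' := mfderiv (𝓘(ℝ, EB).prod 𝓘(ℝ, F)) I' f ⟨p, v⟩
  have hL (q : TotalSpace F V) (hq : q = ⟨p, v⟩) :
      HasMFDerivAt (𝓘(ℝ, EB).prod 𝓘(ℝ, F)) I' f q L := by
    subst hq
    exact hf.hasMFDerivAt
  have h1 := (HasMFDerivAt.comp (0 : ℝ) (hL ⟨p, v + (0 : ℝ) • w⟩ (by simp))
    (((contMDiff_fibreLine (EB := EB) v w).mdifferentiableAt (x := (0 : ℝ))
      (by simp)).hasMFDerivAt)).mfderiv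
  exact (congrArg (fun L : ℝ →L[ℝ] E' ↦ L 1) h1).symm

theorem dproj_verticalLift {p : B} (v w : V p) :
    dproj EB (⟨p, v⟩ : TotalSpace F V) (verticalLift EB F v w) = 0 := by
  have h1 : MDifferentiableAt (𝓘(ℝ, EB).prod 𝓘(ℝ, F)) 𝓘(ℝ, EB)
      (TotalSpace.proj : TotalSpace F V → B) ⟨p, v⟩ :=
    (Bundle.contMDiff_proj V (n := 1)).mdifferentiableAt (by simp)
  refine (mfderiv_comp_fibreLine v w h1).trans ?_
  change mfderiv 𝓘(ℝ, ℝ) 𝓘(ℝ, EB) (fun t : ℝ ↦ p) 0 (1 : ℝ) = 0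
  rw [mfderiv_const]
  rfl

theorem connector_verticalLift {p : B} (v w : V p) :
    connector cov (⟨p, v⟩ : TotalSpace F V) (verticalLift EB F v w) = w := by
  set e := trivializationAt F V p with he
  have hp : p ∈ e.baseSet := FiberBundle.mem_baseSet_trivializationAt' p
  change e.symmL ℝ p (_ + connectionForm cov e p (dproj EB (⟨p, v⟩ : TotalSpace F V) _) _) = _
  rw [dproj_verticalLift, map_zero, zero_apply, add_zero]
  conv_rhs => rw [← e.symmL_continuousLinearMapAt (R := ℝ) hp w]
  congr 1
  refine (mfderiv_comp_fibreLine v w (mdifferentiableAt_trivialization_snd (EB := EB) (e := e)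
    (v := ⟨p, v⟩) hp)).trans ?_
  have h : (fun t : ℝ ↦ (e (⟨p, v + t • w⟩ : TotalSpace F V)).2) =
      fun t ↦ e.continuousLinearMapAt ℝ p v + t • e.continuousLinearMapAt ℝ p w := by
    funext t
    rw [← continuousLinearMapAt_eq_snd hp, map_add, map_smul]
  rw [h, mfderiv_eq_fderiv]
  have : HasDerivAt (fun t : ℝ ↦ e.continuousLinearMapAt ℝ p v + t • e.continuousLinearMapAt ℝ p w)
      ((1 : ℝ) • e.continuousLinearMapAt ℝ p w) 0 :=
    ((hasDerivAt_id (0 : ℝ)).smul_const _).const_add _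
  have h2 := this.hasFDerivAt.fderiv
  rw [h2]
  change (1 : ℝ) • ((1 : ℝ) • e.continuousLinearMapAt ℝ p w) = _
  rw [one_smul, one_smul]

end Connector
end

noncomputable section

/-! ### The connection metric through the projection and the connector -/

section ConnectionMetric

/-- The pull-back of a bilinear form under a linear map. -/
def pullbackForm {T T' : Type*} [AddCommGroup T] [Module ℝ T] [TopologicalSpace T]
    [AddCommGroup T'] [Module ℝ T'] [TopologicalSpace T'] [IsTopologicalAddGroup T]
    [IsTopologicalAddGroup T'] [ContinuousSMul ℝ T] [ContinuousSMul ℝ T']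
    (b : T' →L[ℝ] T' →L[ℝ] ℝ) (L : T →L[ℝ] T') : T →L[ℝ] T →L[ℝ] ℝ :=
  (ContinuousLinearMap.precomp ℝ L) ∘L (b ∘L L)

/-- The chain rule at a base point known only up to propositional equality: tangent vectors are read
in the model spaces, where no transport is needed. -/
theorem mfderiv_comp_apply_of_base_eq {E H N E' H' N' E'' H'' N'' : Type*}
    [NormedAddCommGroup E] [NormedSpace ℝ E] [TopologicalSpace H] {I : ModelWithCorners ℝ E H}
    [TopologicalSpace N] [ChartedSpace H N]
    [NormedAddCommGroup E'] [NormedSpace ℝ E'] [TopologicalSpace H'] {I' : ModelWithCorners ℝ E' H'}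
    [TopologicalSpace N'] [ChartedSpace H' N'] [NormedAddCommGroup E''] [NormedSpace ℝ E'']
    [TopologicalSpace H''] {I'' : ModelWithCorners ℝ E'' H''} [TopologicalSpace N'']
    [ChartedSpace H'' N''] {f : N' → N''} {γ : N → N'} {x : N} {q : N'} (hq : γ x = q)
    (hf : MDifferentiableAt I' I'' f q) (hγ : MDifferentiableAt I I' γ x)
    (v : TangentSpace I x) : (mfderiv I I'' (f ∘ γ) x v : E'') =
      mfderiv I' I'' f q (mfderiv I I' γ x v : E') := by
  subst hq
  exact congrArg (fun L : TangentSpace I x →L[ℝ] E'' ↦ L v) (mfderiv_comp x hf hγ)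

variable {EB : Type*} [NormedAddCommGroup EB] [NormedSpace ℝ EB]
  {B : Type*} [TopologicalSpace B] [ChartedSpace EB B] [IsManifold 𝓘(ℝ, EB) ∞ B]
  {F : Type*} [NormedAddCommGroup F] [NormedSpace ℝ F]
  {V : B → Type*} [TopologicalSpace (TotalSpace F V)] [∀ x, NormedAddCommGroup (V x)]
  [∀ x, InnerProductSpace ℝ (V x)] [FiberBundle F V] [VectorBundle ℝ F V]

/-- The charts of the total space are given by charts of the base and trivializations. -/
theorem exists_bundlePoint_eq_symm {ψ : OpenPartialHomeomorph (TotalSpace F V) (ModelProd EB F)}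
    (hψ : ψ ∈ atlas (ModelProd EB F) (TotalSpace F V)) :
    ∃ c ∈ atlas EB B, ∃ (e : Bundle.Trivialization F (TotalSpace.proj : TotalSpace F V → B))
      (_ : MemTrivializationAtlas e),
      ψ.target = {z | z.1 ∈ bundleChartDomain c e} ∧
      ∀ z, z.1 ∈ bundleChartDomain c e → ψ.symm z = bundlePoint c e z := by
  obtain ⟨_, ⟨e, he, rfl⟩, _, ⟨c, hc, c', hc', rfl⟩, rfl⟩ := hψ
  -- The fibre factor of the model is charted by the identity alone, so `c'` is the identity and
  -- only `c` and `e` remain.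
  rw [chartedSpaceSelf_atlas] at hc'
  subst hc'
  have hm : MemTrivializationAtlas e := ⟨he⟩
  refine ⟨c, hc, e, hm, ?_, fun z hz ↦ ?_⟩
  · ext z
    simp only [bundleChartDomain, mfld_simps]
    exact ⟨fun h ↦ ⟨h.1.1, e.mem_target.1 h.2⟩, fun h ↦ ⟨⟨h.1, trivial⟩, e.mem_target.2 h.2⟩⟩
  · refine (e.mk_symm hz.2 z.2).symm.trans ?_
    exact congrArg (TotalSpace.mk _) (e.symmL_apply (R := ℝ) hz.2 z.2).symm

theorem extend_prod_target {N : Type*} [TopologicalSpace N]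
    (ψ : OpenPartialHomeomorph N (ModelProd EB F)) :
    (ψ.extend (𝓘(ℝ, EB).prod 𝓘(ℝ, F))).target = ψ.target := by
  rw [OpenPartialHomeomorph.extend_target, ModelWithCorners.range_eq_univ, inter_univ]
  rfl

variable {c : OpenPartialHomeomorph B EB}
  {e : Bundle.Trivialization F (TotalSpace.proj : TotalSpace F V → B)}
  [MemTrivializationAtlas e] [ContMDiffVectorBundle ∞ F V 𝓘(ℝ, EB)]

/-- In base directions `bundlePoint` moves along a constant section of the trivialization, in fibre
directions along a line of the fibre. A coordinate vector is thus written in the form used in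
`IsConnectionMetric`. -/
theorem mfderiv_bundlePoint (hc : c ∈ atlas EB B) {z : EB × F} (hz : z.1 ∈ bundleChartDomain c e)
    (Z : EB × F) :
    (mfderiv 𝓘(ℝ, EB × F) (𝓘(ℝ, EB).prod 𝓘(ℝ, F)) (bundlePoint c e) z Z : EB × F) =
      mfderiv 𝓘(ℝ, EB) (𝓘(ℝ, EB).prod 𝓘(ℝ, F)) (fun y ↦ (⟨y, e.symmL ℝ y z.2⟩ : TotalSpace F V))
        ((c.extend 𝓘(ℝ, EB)).symm z.1)
        (mfderiv 𝓘(ℝ, EB) 𝓘(ℝ, EB) (c.extend 𝓘(ℝ, EB)).symm z.1 Z.1) +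
      verticalLift EB F (e.symmL ℝ ((c.extend 𝓘(ℝ, EB)).symm z.1) z.2)
        (e.symmL ℝ ((c.extend 𝓘(ℝ, EB)).symm z.1) Z.2) := by
  have hb : MDifferentiableAt 𝓘(ℝ, EB × F) (𝓘(ℝ, EB).prod 𝓘(ℝ, F)) (bundlePoint c e) z :=
    (contMDiffAt_bundlePoint hc hz).mdifferentiableAt (by simp)
  let D : EB × F →L[ℝ] EB × F :=
    mfderiv 𝓘(ℝ, EB × F) (𝓘(ℝ, EB).prod 𝓘(ℝ, F)) (bundlePoint c e) z
  have hsplit : D Z = D (Z.1, 0) + D (0, Z.2) := by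
    rw [← map_add]
    simp
  have h1 : D (Z.1, 0) = mfderiv 𝓘(ℝ, EB) (𝓘(ℝ, EB).prod 𝓘(ℝ, F))
      (fun y ↦ (⟨y, e.symmL ℝ y z.2⟩ : TotalSpace F V)) ((c.extend 𝓘(ℝ, EB)).symm z.1)
        (mfderiv 𝓘(ℝ, EB) 𝓘(ℝ, EB) (c.extend 𝓘(ℝ, EB)).symm z.1 Z.1) := by
    have hi : HasFDerivAt (fun x : EB ↦ (x, z.2)) (ContinuousLinearMap.inl ℝ EB F) z.1 :=
      hasFDerivAt_prodMk_left z.1 z.2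
    have e1 := mfderiv_comp_apply_of_base_eq (I := 𝓘(ℝ, EB)) (γ := fun x : EB ↦ (x, z.2))
      (x := z.1) (q := z) rfl hb hi.differentiableAt.mdifferentiableAt Z.1
    rw [mfderiv_eq_fderiv, hi.fderiv] at e1
    refine e1.symm.trans ?_
    exact mfderiv_comp_apply_of_base_eq (I := 𝓘(ℝ, EB)) (I' := 𝓘(ℝ, EB))
      (γ := (c.extend 𝓘(ℝ, EB)).symm) (f := fun y ↦ (⟨y, e.symmL ℝ y z.2⟩ : TotalSpace F V))
      (x := z.1) rfl ((contMDiffAt_symmL hz.2 contMDiffAt_const).mdifferentiableAt (by simp))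
      ((contMDiffAt_extend_symm hc hz.1).mdifferentiableAt (by simp)) Z.1
  have h2 : D (0, Z.2) = verticalLift EB F (e.symmL ℝ ((c.extend 𝓘(ℝ, EB)).symm z.1) z.2)
        (e.symmL ℝ ((c.extend 𝓘(ℝ, EB)).symm z.1) Z.2) := by
    have hi : HasDerivAt (fun t : ℝ ↦ (z.1, z.2 + t • Z.2)) ((0 : EB), (1 : ℝ) • Z.2) 0 :=
      (hasDerivAt_const _ _).prodMk (((hasDerivAt_id (0 : ℝ)).smul_const _).const_add _)
    have e1 := mfderiv_comp_apply_of_base_eq (I := 𝓘(ℝ, ℝ))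
      (γ := fun t : ℝ ↦ (z.1, z.2 + t • Z.2)) (x := (0 : ℝ)) (q := z) (by simp) hb
      hi.hasFDerivAt.differentiableAt.mdifferentiableAt (1 : ℝ)
    rw [mfderiv_eq_fderiv, hi.hasFDerivAt.fderiv] at e1
    have e2 : (ContinuousLinearMap.toSpanSingleton ℝ ((0 : EB), (1 : ℝ) • Z.2)) (1 : ℝ) =
        ((0 : EB), Z.2) := by simp
    refine (congrArg D e2).symm.trans (e1.symm.trans ?_)
    have e3 : bundlePoint c e ∘ (fun t : ℝ ↦ (z.1, z.2 + t • Z.2)) = fun t : ℝ ↦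
        (⟨(c.extend 𝓘(ℝ, EB)).symm z.1, e.symmL ℝ ((c.extend 𝓘(ℝ, EB)).symm z.1) z.2 +
          t • e.symmL ℝ ((c.extend 𝓘(ℝ, EB)).symm z.1) Z.2⟩ : TotalSpace F V) := by
      funext t
      simp only [bundlePoint, Function.comp, map_add, map_smul]
    rw [e3]
    rfl
  exact hsplit.trans (congrArg₂ (· + ·) h1 h2)

variable [FiniteDimensional ℝ F] (gM : SmoothMetric 𝓘(ℝ, EB) B)
  (cov : CovariantDerivative 𝓘(ℝ, EB) F V)

/-- The scalar products of the connection metric. -/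
def connectionMetricForm (v : TotalSpace F V) :
    TangentSpace (𝓘(ℝ, EB).prod 𝓘(ℝ, F)) v →L[ℝ]
      TangentSpace (𝓘(ℝ, EB).prod 𝓘(ℝ, F)) v →L[ℝ] ℝ :=
  pullbackForm (gM.inner v.1) (dproj EB v) +
    pullbackForm (innerSL ℝ : V v.1 →L[ℝ] V v.1 →L[ℝ] ℝ) (connector cov v)

theorem connectionMetricForm_apply (v : TotalSpace F V)
    (Z W : TangentSpace (𝓘(ℝ, EB).prod 𝓘(ℝ, F)) v) : connectionMetricForm gM cov v Z W =
      gM.inner v.1 (dproj EB v Z) (dproj EB v W) +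
        inner ℝ (connector cov v Z) (connector cov v W) := rfl

theorem dproj_mfderiv_bundlePoint (hc : c ∈ atlas EB B) {z : EB × F}
    (hz : z.1 ∈ bundleChartDomain c e) (Z : EB × F) :
    dproj EB (bundlePoint c e z)
      (mfderiv 𝓘(ℝ, EB × F) (𝓘(ℝ, EB).prod 𝓘(ℝ, F)) (bundlePoint c e) z Z) =
    mfderiv 𝓘(ℝ, EB) 𝓘(ℝ, EB) (c.extend 𝓘(ℝ, EB)).symm z.1 Z.1 := by
  have h := mfderiv_bundlePoint hc hz Z
  refine (congrArg (fun W : EB × F ↦ dproj EB (bundlePoint c e z) W) h).trans ?_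
  refine (map_add (dproj EB (bundlePoint c e z)) _ _).trans ?_
  have h1 := dproj_mfderiv_section (EB := EB) (F := F) (V := V) (σ := fun y ↦ e.symmL ℝ y z.2)
    ((contMDiffAt_symmL hz.2 contMDiffAt_const).mdifferentiableAt (by simp))
    (mfderiv 𝓘(ℝ, EB) 𝓘(ℝ, EB) (c.extend 𝓘(ℝ, EB)).symm z.1 Z.1)
  have h2 := dproj_verticalLift (EB := EB) (F := F)
    (e.symmL ℝ ((c.extend 𝓘(ℝ, EB)).symm z.1) z.2) (e.symmL ℝ ((c.extend 𝓘(ℝ, EB)).symm z.1) Z.2)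
  refine (congrArg₂ (· + ·) h1 h2).trans (add_zero _)

theorem connector_mfderiv_bundlePoint (hc : c ∈ atlas EB B) {z : EB × F}
    (hz : z.1 ∈ bundleChartDomain c e) (Z : EB × F) :
    connector cov (bundlePoint c e z)
      (mfderiv 𝓘(ℝ, EB × F) (𝓘(ℝ, EB).prod 𝓘(ℝ, F)) (bundlePoint c e) z Z) =
    e.symmL ℝ ((c.extend 𝓘(ℝ, EB)).symm z.1) (Z.2 + connectionFormInChart c e cov z.1 Z.1 z.2) := by
  have h := mfderiv_bundlePoint hc hz Z
  refine (congrArg (fun W : EB × F ↦ connector cov (bundlePoint c e z) W) h).trans ?_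
  refine (map_add (connector cov (bundlePoint c e z)) _ _).trans ?_
  have h1 := connector_mfderiv_section cov (σ := fun y ↦ e.symmL ℝ y z.2)
    ((contMDiffAt_symmL hz.2 contMDiffAt_const).mdifferentiableAt (by simp))
    (mfderiv 𝓘(ℝ, EB) 𝓘(ℝ, EB) (c.extend 𝓘(ℝ, EB)).symm z.1 Z.1)
  have h2 := connector_verticalLift cov
    (e.symmL ℝ ((c.extend 𝓘(ℝ, EB)).symm z.1) z.2) (e.symmL ℝ ((c.extend 𝓘(ℝ, EB)).symm z.1) Z.2)
  refine (congrArg₂ (· + ·) h1 h2).trans ?_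
  rw [map_add, connectionFormInChart_apply, connectionForm_eq cov hz.2,
    e.symmL_continuousLinearMapAt (R := ℝ) hz.2]
  exact add_comm _ _

variable {cov} [FiniteDimensional ℝ EB] [IsContMDiffRiemannianBundle 𝓘(ℝ, EB) ∞ F V]

/-- The connection metric in coordinates. -/
theorem connectionMetricForm_mfderiv_bundlePoint (hs : cov.PreservesSmoothAt)
    (hm : cov.IsMetricCompatible) (hc : c ∈ atlas EB B) {z : EB × F}
    (hz : z.1 ∈ bundleChartDomain c e) (Z W : EB × F) :
    connectionMetricForm gM cov (bundlePoint c e z)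
      (mfderiv 𝓘(ℝ, EB × F) (𝓘(ℝ, EB).prod 𝓘(ℝ, F)) (bundlePoint c e) z Z)
      (mfderiv 𝓘(ℝ, EB × F) (𝓘(ℝ, EB).prod 𝓘(ℝ, F)) (bundlePoint c e) z W) =
    (localBundleData e gM hs hm hc).g z.1 Z.1 W.1 + (localBundleData e gM hs hm hc).k z.1
      ((localBundleData e gM hs hm hc).θ z Z) ((localBundleData e gM hs hm hc).θ z W) := by
  rw [connectionMetricForm_apply, dproj_mfderiv_bundlePoint hc hz, dproj_mfderiv_bundlePoint hc hz,
    connector_mfderiv_bundlePoint cov hc hz, connector_mfderiv_bundlePoint cov hc hz,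
    LocalBundleData.θ_apply, LocalBundleData.θ_apply]
  rfl

end ConnectionMetric
end

noncomputable section

/-! ### Positivity of bilinear forms checked in charts -/

section PosOfCharts

variable {E : Type*} [NormedAddCommGroup E] [NormedSpace ℝ E]
  {H : Type*} [TopologicalSpace H] {I : ModelWithCorners ℝ E H} [I.Boundaryless]
  {N : Type*} [TopologicalSpace N] [ChartedSpace H N] [IsManifold I ∞ N]

theorem pos_of_charts (b : ∀ x : N, TangentSpace I x →L[ℝ] TangentSpace I x →L[ℝ] ℝ)
    (h : ∀ x₀ : N, ∀ y ∈ ((chartAt H x₀).extend I).target, ∀ v : E, v ≠ 0 →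
      0 < b (((chartAt H x₀).extend I).symm y)
        (mfderiv 𝓘(ℝ, E) I ((chartAt H x₀).extend I).symm y v)
        (mfderiv 𝓘(ℝ, E) I ((chartAt H x₀).extend I).symm y v))
    (x : N) (v : TangentSpace I x) (hv : v ≠ 0) : 0 < b x v v := by
  have hx : x ∈ ((chartAt H x).extend I).source := by simp
  have hsx : ((chartAt H x).extend I).symm ((chartAt H x).extend I x) = x :=
    ((chartAt H x).extend I).left_inv hx
  have hd := mfderiv_symm_comp_mfderiv_extend (I := I) (chart_mem_atlas H x)
    (mem_chart_source H x) v
  have key := h x _ (((chartAt H x).extend I).map_source hx)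
    (mfderiv I 𝓘(ℝ, E) ((chartAt H x).extend I) x v) (fun h0 ↦ hv (by
      have h0' : mfderiv I 𝓘(ℝ, E) ((chartAt H x).extend I) x v = 0 := h0
      rw [← hd, h0']
      exact map_zero (mfderiv 𝓘(ℝ, E) I ((chartAt H x).extend I).symm ((chartAt H x).extend I x))))
  rw [hd, hsx] at key
  exact key

end PosOfCharts

/-! ### The connection metric as a smooth Riemannian metric -/

section ConnectionMetric

variable {EB : Type*} [NormedAddCommGroup EB] [NormedSpace ℝ EB]
  {B : Type*} [TopologicalSpace B] [ChartedSpace EB B] [IsManifold 𝓘(ℝ, EB) ∞ B]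
  {F : Type*} [NormedAddCommGroup F] [NormedSpace ℝ F]
  {V : B → Type*} [TopologicalSpace (TotalSpace F V)] [∀ x, NormedAddCommGroup (V x)]
  [∀ x, InnerProductSpace ℝ (V x)] [FiberBundle F V] [VectorBundle ℝ F V]
  [ContMDiffVectorBundle ∞ F V 𝓘(ℝ, EB)]
  [FiniteDimensional ℝ F] (gM : SmoothMetric 𝓘(ℝ, EB) B)
  {cov : CovariantDerivative 𝓘(ℝ, EB) F V} [FiniteDimensional ℝ EB]
  [IsContMDiffRiemannianBundle 𝓘(ℝ, EB) ∞ F V]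

/-- The connection metric in the charts of the total space. -/
theorem exists_connectionMetricForm_eq (hs : cov.PreservesSmoothAt) (hm : cov.IsMetricCompatible)
    {ψ : OpenPartialHomeomorph (TotalSpace F V) (ModelProd EB F)}
    (hψ : ψ ∈ atlas (ModelProd EB F) (TotalSpace F V)) :
    ∃ d : LocalBundleData EB F,
      (∀ z ∈ (ψ.extend (𝓘(ℝ, EB).prod 𝓘(ℝ, F))).target, z.1 ∈ d.U) ∧
      ∀ z ∈ (ψ.extend (𝓘(ℝ, EB).prod 𝓘(ℝ, F))).target, ∀ Z W : EB × F,
        connectionMetricForm gM cov ((ψ.extend (𝓘(ℝ, EB).prod 𝓘(ℝ, F))).symm z)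
          (mfderiv 𝓘(ℝ, EB × F) (𝓘(ℝ, EB).prod 𝓘(ℝ, F))
            (ψ.extend (𝓘(ℝ, EB).prod 𝓘(ℝ, F))).symm z Z)
          (mfderiv 𝓘(ℝ, EB × F) (𝓘(ℝ, EB).prod 𝓘(ℝ, F))
            (ψ.extend (𝓘(ℝ, EB).prod 𝓘(ℝ, F))).symm z W) =
        d.g z.1 Z.1 W.1 + d.k z.1 (d.θ z Z) (d.θ z W) := by
  obtain ⟨c, hc, e, hm', ht, hsymm⟩ := exists_bundlePoint_eq_symm hψ
  rw [extend_prod_target]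
  refine ⟨localBundleData e gM hs hm hc, fun z hz ↦ by rw [ht] at hz; exact hz, fun z hz Z W ↦ ?_⟩
  have hz' : z.1 ∈ bundleChartDomain c e := by rw [ht] at hz; exact hz
  have hev : (ψ.extend (𝓘(ℝ, EB).prod 𝓘(ℝ, F))).symm =ᶠ[𝓝 z] bundlePoint c e := by
    have ho : IsOpen {z : EB × F | z.1 ∈ bundleChartDomain c e} :=
      (isOpen_bundleChartDomain hc).preimage continuous_fst
    filter_upwards [ho.mem_nhds hz'] with w hw
    exact hsymm w hw
  rw [hev.mfderiv_eq, hev.self_of_nhds]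
  exact connectionMetricForm_mfderiv_bundlePoint gM hs hm hc hz' Z W

/-- The connection metric. -/
def connectionMetric (hs : cov.PreservesSmoothAt) (hm : cov.IsMetricCompatible) :
    SmoothMetric (𝓘(ℝ, EB).prod 𝓘(ℝ, F)) (TotalSpace F V) :=
  SmoothMetric.ofCharts (E := EB × F) (connectionMetricForm gM cov)
    (fun v Z W ↦ by
      rw [connectionMetricForm_apply, connectionMetricForm_apply, gM.symm, real_inner_comm])
    (pos_of_charts (E := EB × F) _ fun v z hz Z hZ ↦ by
      obtain ⟨d, hd, h⟩ := exists_connectionMetricForm_eq gM hs hm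
        (chart_mem_atlas (ModelProd EB F) v)
      rw [h z hz]
      -- At the given point `z` the form is the sphere metric whose `ε` is the inverse of the
      -- conformal factor at `z`, so its positivity is already known.
      have := (LocalBundleData.isMetricForm_sphereMetric (ε := (4 / (1 + d.normSq z) ^ 2)⁻¹) (by
        have := LocalBundleData.one_add_normSq_pos (hd z hz)
        positivity) (hd z hz)).pos Z hZ
      have hne : 4 / (1 + d.normSq z) ^ 2 ≠ 0 := by
        have := LocalBundleData.one_add_normSq_pos (hd z hz)
        positivity
      rwa [d.sphereMetric_apply, inv_mul_cancel₀ hne, one_mul] at this)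
    (fun v z hz Z W ↦ by
      obtain ⟨d, hd, h⟩ := exists_connectionMetricForm_eq gM hs hm
        (chart_mem_atlas (ModelProd EB F) v)
      have h1 : ContDiffAt ℝ ∞ (fun z : EB × F ↦
          d.g z.1 Z.1 W.1 + d.k z.1 (d.θ z Z) (d.θ z W)) z := by
        have hθ := LocalBundleData.contDiffAt_θ (hd z hz)
        exact ((((LocalBundleData.contDiffAt_g (hd z hz)).comp z contDiffAt_fst).clm_apply
          contDiffAt_const).clm_apply contDiffAt_const).add
          ((((LocalBundleData.contDiffAt_k (hd z hz)).comp z contDiffAt_fst).clm_apply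
            (hθ.clm_apply contDiffAt_const)).clm_apply (hθ.clm_apply contDiffAt_const))
      refine h1.congr_of_eventuallyEq ?_
      filter_upwards [((chartAt (ModelProd EB F) v).isOpen_extend_target
        (I := 𝓘(ℝ, EB).prod 𝓘(ℝ, F))).mem_nhds hz] with w hw
      exact h w hw Z W)

theorem isConnectionMetric_connectionMetric (hs : cov.PreservesSmoothAt)
    (hm : cov.IsMetricCompatible) : IsConnectionMetric gM cov (connectionMetric gM hs hm) := by
  intro σ p hσ X w Z
  change connectionMetricForm gM cov _ Z Z = _
  rw [connectionMetricForm_apply]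
  have h1 : dproj EB (⟨p, σ p⟩ : TotalSpace F V) Z = X := by
    refine (map_add (dproj EB (⟨p, σ p⟩ : TotalSpace F V)) _ _).trans ?_
    rw [dproj_mfderiv_section hσ, dproj_verticalLift, add_zero]
  have h2 : connector cov (⟨p, σ p⟩ : TotalSpace F V) Z = cov σ p X + w := by
    refine (map_add (connector cov (⟨p, σ p⟩ : TotalSpace F V)) _ _).trans ?_
    rw [connector_mfderiv_section cov hσ, connector_verticalLift]
  rw [h1, h2, real_inner_self_eq_norm_sq]

end ConnectionMetric
end

noncomputable section

/-! ### The double and the sphere bundle -/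

section DoubleSphere

variable {B F : Type*} {V : B → Type*} [∀ x, NormedAddCommGroup (V x)]
  [∀ x, InnerProductSpace ℝ (V x)]

theorem Double.sign_mul_self (s : Bool) : Double.sign s * Double.sign s = 1 := by
  cases s <;> simp [Double.sign]

/-- The inversion `v ↦ v/|v|²` preserves `2v/(1+|v|²)` and changes the sign of `(1-|v|²)/(1+|v|²)`;
the exchange of the discs restores that sign. One formula, the inverse stereographic projection,
therefore holds on the whole total space. -/
theorem Double.toSphere_fold (r : ℝ) (s : Bool) (v : TotalSpace F V) :
    Double.toSphere r (Double.fold s v) = (⟨v.1, (2 * r / (1 + ‖v.2‖ ^ 2)) • v.2⟩,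
      Double.sign s * (r * ((1 - ‖v.2‖ ^ 2) / (1 + ‖v.2‖ ^ 2)))) := by
  unfold Double.fold
  split_ifs with h
  · rfl
  · have hn := norm_fiberInversion v
    have h0 : 0 < ‖v.2‖ := by linarith [not_le.1 h]
    have h1 : 2 * r / (1 + ‖v.2‖⁻¹ ^ 2) * (‖v.2‖ ^ 2)⁻¹ = 2 * r / (1 + ‖v.2‖ ^ 2) := by
      field_simp
      ring
    have h2 : (1 - ‖v.2‖⁻¹ ^ 2) / (1 + ‖v.2‖⁻¹ ^ 2) = -((1 - ‖v.2‖ ^ 2) / (1 + ‖v.2‖ ^ 2)) := by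
      field_simp
      ring
    have h3 : Double.sign (!s) = -Double.sign s := by cases s <;> simp [Double.sign]
    refine Prod.ext (congrArg (TotalSpace.mk v.1) ?_) ?_
    · change (2 * r / (1 + ‖(fiberInversion v).2‖ ^ 2)) • ((‖v.2‖ ^ 2)⁻¹ • v.2 : V v.1) = _
      rw [hn]
      exact (smul_smul _ _ v.2).trans (congrArg (· • v.2) h1)
    · change Double.sign (!s) * (r * ((1 - ‖(fiberInversion v).2‖ ^ 2) /
        (1 + ‖(fiberInversion v).2‖ ^ 2))) = _
      rw [hn, h2, h3]
      ring

theorem Double.toSphere_snd (r : ℝ) (x : Double F V) :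
    (Double.toSphere r x).2 = r * (Double.toSphere 1 x).2 := by
  induction x using Double.ind with | h a v => ?_
  change Double.sign a * (r * _) = r * (Double.sign a * (1 * _))
  ring

theorem Double.exists_eq_fold (x : Double F V) : ∃ s v, x = Double.fold s v := by
  induction x using Double.ind with | h a v => ?_
  exact ⟨a, v.1, (show Double.fold a v.1 = Double.mk a v from dif_pos v.2).symm⟩

/-- The stereographic projection `(w, t) ↦ w / (r ± t)` recovers the unfolded point. -/
theorem Double.toSphere_fold_inv {r : ℝ} (hr : 0 < r) (s : Bool) (v : TotalSpace F V) :
    0 < r + Double.sign s * (Double.toSphere r (Double.fold s v)).2 ∧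
    v = ⟨(Double.toSphere r (Double.fold s v)).1.1,
      (r + Double.sign s * (Double.toSphere r (Double.fold s v)).2)⁻¹ •
        (Double.toSphere r (Double.fold s v)).1.2⟩ := by
  rw [Double.toSphere_fold]
  have hs := Double.sign_mul_self s
  have hp : 0 < 1 + ‖v.2‖ ^ 2 := by positivity
  have h1 : r + Double.sign s * (Double.sign s * (r * ((1 - ‖v.2‖ ^ 2) / (1 + ‖v.2‖ ^ 2)))) =
      2 * r / (1 + ‖v.2‖ ^ 2) := by
    rw [← mul_assoc, hs]
    field_simp
    ring
  have h2 : 0 < 2 * r / (1 + ‖v.2‖ ^ 2) := by positivity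
  refine ⟨by rw [h1]; exact h2, ?_⟩
  simp only
  rw [h1, smul_smul, inv_mul_cancel₀ h2.ne', one_smul]

theorem Double.range_toSphere {r : ℝ} (hr : 0 < r) :
    range (Double.toSphere r : Double F V → TotalSpace F V × ℝ) = sphereBundle F V r := by
  refine Subset.antisymm ?_ ?_
  · rintro _ ⟨x, rfl⟩
    obtain ⟨s, v, rfl⟩ := x.exists_eq_fold
    rw [Double.toSphere_fold]
    have hs := Double.sign_mul_self s
    have hp : 0 < 1 + ‖v.2‖ ^ 2 := by positivity
    change ‖(2 * r / (1 + ‖v.2‖ ^ 2)) • v.2‖ ^ 2 + (Double.sign s * _) ^ 2 = r ^ 2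
    rw [norm_smul, mul_pow, Real.norm_eq_abs, sq_abs, mul_pow, sq (Double.sign s), hs]
    field_simp
    ring
  · rintro ⟨⟨p, w⟩, t⟩ (h : ‖w‖ ^ 2 + t ^ 2 = r ^ 2)
    -- The disc is chosen by the sign of `t`, so that `r + τ > 0` and the point is not the centre of
    -- the stereographic projection.
    obtain ⟨s, hst⟩ : ∃ s, 0 ≤ Double.sign s * t := by
      rcases le_total 0 t with h0 | h0
      · exact ⟨true, by simpa [Double.sign] using h0⟩
      · exact ⟨false, by simpa [Double.sign] using h0⟩
    have hs := Double.sign_mul_self s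
    set τ := Double.sign s * t with hτ
    have ht : t = Double.sign s * τ := by rw [hτ, ← mul_assoc, hs, one_mul]
    have hp : 0 < r + τ := by linarith
    have h2 : ‖w‖ ^ 2 = (r + τ) * (r - τ) := by
      have : t ^ 2 = τ ^ 2 := by rw [ht, mul_pow, sq (Double.sign s), hs, one_mul]
      rw [this] at h
      linarith
    have h3 : ‖(r + τ)⁻¹ • w‖ ^ 2 = (r - τ) / (r + τ) := by
      rw [norm_smul, mul_pow, h2, norm_inv, Real.norm_eq_abs, inv_pow, sq_abs]
      field_simp
    refine ⟨Double.fold s ⟨p, (r + τ)⁻¹ • w⟩, ?_⟩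
    rw [Double.toSphere_fold]
    change ((⟨p, (2 * r / (1 + ‖(r + τ)⁻¹ • w‖ ^ 2)) • (r + τ)⁻¹ • w⟩ : TotalSpace F V),
      Double.sign s * (r * ((1 - ‖(r + τ)⁻¹ • w‖ ^ 2) / (1 + ‖(r + τ)⁻¹ • w‖ ^ 2)))) = _
    rw [h3, smul_smul]
    have h4 : 1 + (r - τ) / (r + τ) = 2 * r / (r + τ) := by field_simp; ring
    have h5 : 2 * r / (1 + (r - τ) / (r + τ)) * (r + τ)⁻¹ = 1 := by rw [h4]; field_simp
    have h6 : r * ((1 - (r - τ) / (r + τ)) / (1 + (r - τ) / (r + τ))) = τ := by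
      rw [h4]; field_simp; ring
    rw [h5, h6, one_smul, ht]

end DoubleSphere

/-! ### Separation, injectivity and compactness -/

section DoubleTopology

variable {EB : Type*} [NormedAddCommGroup EB] [NormedSpace ℝ EB]
  {B : Type*} [TopologicalSpace B] [ChartedSpace EB B]
  {F : Type*} [NormedAddCommGroup F] [NormedSpace ℝ F]
  {V : B → Type*} [TopologicalSpace (TotalSpace F V)] [∀ x, NormedAddCommGroup (V x)]
  [∀ x, InnerProductSpace ℝ (V x)] [FiberBundle F V] [VectorBundle ℝ F V]

theorem t2Space_totalSpace [T2Space B] : T2Space (TotalSpace F V) := by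
  refine ⟨fun v w hvw ↦ ?_⟩
  have hπ : Continuous (TotalSpace.proj : TotalSpace F V → B) := FiberBundle.continuous_proj F V
  by_cases h : v.1 = w.1
  · have hv : v ∈ (trivializationAt F V v.1).source :=
      (trivializationAt F V v.1).mem_source.2 (FiberBundle.mem_baseSet_trivializationAt' v.1)
    have hw : w ∈ (trivializationAt F V v.1).source :=
      (trivializationAt F V v.1).mem_source.2 (h ▸ FiberBundle.mem_baseSet_trivializationAt' v.1)
    have hne : trivializationAt F V v.1 v ≠ trivializationAt F V v.1 w := fun h' ↦
      hvw ((trivializationAt F V v.1).toOpenPartialHomeomorph.injOn hv hw h')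
    obtain ⟨S, T, hS, hT, hvS, hwT, hST⟩ := t2_separation hne
    have ho (S : Set (B × F)) (hS : IsOpen S) : IsOpen ((trivializationAt F V v.1).source ∩
        trivializationAt F V v.1 ⁻¹' S) :=
      (trivializationAt F V v.1).toOpenPartialHomeomorph.isOpen_inter_preimage hS
    exact ⟨_, _, ho S hS, ho T hT, ⟨hv, hvS⟩, ⟨hw, hwT⟩,
      (hST.preimage _).mono inter_subset_right inter_subset_right⟩
  · obtain ⟨S, T, hS, hT, hvS, hwT, hST⟩ := t2_separation h
    exact ⟨_, _, hS.preimage hπ, hT.preimage hπ, hvS, hwT, hST.preimage _⟩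

variable (EB) in
theorem Double.injective_toSphere [IsContMDiffRiemannianBundle 𝓘(ℝ, EB) ∞ F V] {r : ℝ} (hr : 0 < r) :
    Function.Injective (Double.toSphere r : Double F V → TotalSpace F V × ℝ) := by
  intro x x' h
  obtain ⟨s, v, rfl⟩ := x.exists_eq_fold
  have h1 := Double.toSphere_fold_inv hr s v
  -- If `x'` were the missing pole of the chart `s`, its height `-r · sign s` would make the
  -- positive quantity `r + sign s · t` vanish. Hence both points lie in one chart, where the
  -- stereographic projection separates them.
  have hx' : (Double.toSphere 1 x').2 ≠ -Double.sign s := by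
    intro h0
    have h2 := Double.toSphere_snd r x'
    rw [h] at h1
    rw [h2, h0] at h1
    have := h1.1
    have hs := Double.sign_mul_self s
    nlinarith
  have hfu : Double.fold s (Double.unfold s x') = x' := (Double.chart EB F V s).left_inv hx'
  have h2 := Double.toSphere_fold_inv hr s (Double.unfold s x')
  rw [hfu, ← h] at h2
  rw [← hfu, h2.2, ← h1.2]

variable (EB F V) in
-- Near a point of the base the trivializations are bounded by a constant `C` with respect to the
-- fibre norms. Over a compact neighbourhood `K` the disc bundle is then closed in the compact image
-- of `K` times a ball of radius `C`, and finitely many such `K` cover the base.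
theorem isCompact_discBundle [IsContMDiffRiemannianBundle 𝓘(ℝ, EB) ∞ F V] [CompactSpace B]
    [T2Space B] [FiniteDimensional ℝ F] :
    IsCompact {v : TotalSpace F V | ‖v.2‖ ≤ 1} := by
  have hN := (continuous_fiberNorm_and_continuousOn_fiberInversion EB F V).1
  have hπ : Continuous (TotalSpace.proj : TotalSpace F V → B) := FiberBundle.continuous_proj F V
  have hT2 : T2Space (TotalSpace F V) := t2Space_totalSpace
  have hR : IsContinuousRiemannianBundle F V := by
    obtain ⟨g, hg, h⟩ := IsContMDiffRiemannianBundle.exists_contMDiff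
      (IB := 𝓘(ℝ, EB)) (n := ∞) (F := F) (E := V)
    exact ⟨g, hg.continuous, h⟩
  have hloc (p : B) : ∃ K ∈ 𝓝 p, IsCompact {v : TotalSpace F V | v.1 ∈ K ∧ ‖v.2‖ ≤ 1} := by
    obtain ⟨C, hC, hev⟩ := eventually_norm_trivializationAt_lt F V p
    set e := trivializationAt F V p with he
    obtain ⟨K, hK, hKs, hKc⟩ := local_compact_nhds (Filter.inter_mem hev
      (e.open_baseSet.mem_nhds (FiberBundle.mem_baseSet_trivializationAt' p)))
    refine ⟨K, hK, ?_⟩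
    have hc : IsCompact (e.toOpenPartialHomeomorph.symm '' (K ×ˢ Metric.closedBall (0 : F) C)) := by
      refine (hKc.prod (isCompact_closedBall 0 C)).image_of_continuousOn
        (e.toOpenPartialHomeomorph.continuousOn_symm.mono ?_)
      rintro ⟨q, a⟩ hq
      exact e.mem_target.2 (hKs hq.1).2
    refine hc.of_isClosed_subset ?_ ?_
    · exact (hKc.isClosed.preimage hπ).inter (isClosed_le hN continuous_const)
    · rintro v ⟨hvK, hv1⟩
      have hvs : v ∈ e.source := e.mem_source.2 (hKs hvK).2
      refine ⟨e v, ⟨?_, ?_⟩, e.toOpenPartialHomeomorph.left_inv hvs⟩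
      · rw [e.coe_fst hvs]; exact hvK
      · rw [mem_closedBall_zero_iff, ← continuousLinearMapAt_eq_snd (hKs hvK).2 v.2]
        refine (ContinuousLinearMap.le_opNorm _ _).trans ?_
        have h1 : ‖e.continuousLinearMapAt ℝ v.1‖ < C := (hKs hvK).1
        calc ‖e.continuousLinearMapAt ℝ v.1‖ * ‖v.2‖ ≤ C * 1 := by gcongr
          _ = C := mul_one C
  choose K hK hKc using hloc
  obtain ⟨J, hJ⟩ := CompactSpace.elim_nhds_subcover K hK
  refine (J.isCompact_biUnion fun p _ ↦ hKc p).of_isClosed_subset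
    (isClosed_le hN continuous_const) ?_
  intro v hv
  have : v.1 ∈ ⋃ p ∈ J, K p := by rw [hJ]; trivial
  simp only [mem_iUnion, exists_prop] at this ⊢
  obtain ⟨p, hp, hvp⟩ := this
  exact ⟨p, hp, hvp, hv⟩

variable (EB F V) in
theorem Double.compactSpace [IsContMDiffRiemannianBundle 𝓘(ℝ, EB) ∞ F V] [CompactSpace B]
    [T2Space B] [FiniteDimensional ℝ F] :
    CompactSpace (Double F V) := by
  have : CompactSpace (DiscBundle F V) := isCompact_iff_compactSpace.1 (isCompact_discBundle EB F V)
  exact Quot.compactSpace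

end DoubleTopology
end

noncomputable section

/-! ### The inverse stereographic projection in local coordinates -/

namespace LocalBundleData

variable {EB F : Type*} [NormedAddCommGroup EB] [NormedSpace ℝ EB]
  [NormedAddCommGroup F] [NormedSpace ℝ F] {d : LocalBundleData EB F} {z : EB × F}

variable (d) in
/-- The fibre part of the inverse stereographic projection onto the spheres of radius `r`. -/
def stereo (r : ℝ) (z : EB × F) : EB × F := (z.1, (2 * r / (1 + d.normSq z)) • z.2)

theorem contDiffAt_stereo (r : ℝ) (hz : z.1 ∈ d.U) : ContDiffAt ℝ ∞ (d.stereo r) z :=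
  contDiffAt_fst.prodMk ((contDiffAt_const.div (contDiffAt_const.add (contDiffAt_normSq hz))
    (one_add_normSq_pos hz).ne').smul contDiffAt_snd)

theorem fderiv_stereo (r : ℝ) (hz : z.1 ∈ d.U) (V : EB × F) :
    fderiv ℝ (d.stereo r) z V = (V.1, (2 * r / (1 + d.normSq z)) • V.2 +
      (-4 * r / (1 + d.normSq z) ^ 2 * d.k z.1 z.2 (d.θ z V)) • z.2) := by
  have h0 := (one_add_normSq_pos hz).ne'
  have hN := hasDerivAt_normSq hz V
  have h1 : HasDerivAt (fun t : ℝ ↦ 2 * r / (1 + d.normSq (z + t • V)))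
      (-4 * r / (1 + d.normSq z) ^ 2 * d.k z.1 z.2 (d.θ z V)) 0 := by
    have := (hasDerivAt_const (0 : ℝ) (2 * r)).div (hN.const_add 1) (by simpa using h0)
    refine this.congr_deriv ?_
    simp only [zero_smul, add_zero]
    ring
  have h2 := h1.smul (hasDerivAt_snd z V)
  have h3 : HasDerivAt (fun t : ℝ ↦ (z + t • V).1) V.1 0 := by
    have h := ((hasDerivAt_id (0 : ℝ)).smul_const V.1).const_add z.1
    simpa using h
  have h4 := hasDerivAt_line ((contDiffAt_stereo r hz).differentiableAt (by simp)) V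
  refine (h4.unique (h3.prodMk h2)).trans ?_
  simp

/-- The connection form is linear in the fibre variable, so rescaling the fibres multiplies the
vertical part by the scale; the derivative of the scale adds a radial term. -/
theorem θ_stereo (r : ℝ) (hz : z.1 ∈ d.U) (V : EB × F) :
    d.θ (d.stereo r z) (fderiv ℝ (d.stereo r) z V) = (2 * r / (1 + d.normSq z)) • d.θ z V +
      (-4 * r / (1 + d.normSq z) ^ 2 * d.k z.1 z.2 (d.θ z V)) • z.2 := by
  rw [fderiv_stereo r hz, θ_apply]
  simp only [stereo, map_smul]
  rw [d.θ_apply z V, smul_add]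
  abel

/-- The metric of the sphere bundle of radius `r` in stereographic coordinates. -/
theorem sphereMetric_eq_pullback {r c : ℝ} (hc : c ^ 2 = r ^ 2) (hz : z.1 ∈ d.U) (V W : EB × F) :
    d.g z.1 V.1 W.1 + d.k z.1 (d.θ (d.stereo r z) (fderiv ℝ (d.stereo r) z V))
        (d.θ (d.stereo r z) (fderiv ℝ (d.stereo r) z W)) +
      fderiv ℝ (d.height c) z V * fderiv ℝ (d.height c) z W = d.sphereMetric (r ^ 2) z V W := by
  rw [θ_stereo r hz, θ_stereo r hz, fderiv_height c hz, fderiv_height c hz, sphereMetric_apply]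
  have h0 := (one_add_normSq_pos hz).ne'
  have hs := (d.metric_k z.1 hz).symm (d.θ z V) z.2
  have hu : d.k z.1 z.2 z.2 = d.normSq z := rfl
  simp only [map_add, map_smul, add_apply, smul_apply,
    smul_eq_mul, hs, hu]
  generalize d.normSq z = u at *
  generalize d.k z.1 z.2 (d.θ z V) = a
  generalize d.k z.1 z.2 (d.θ z W) = b
  generalize d.k z.1 (d.θ z V) (d.θ z W) = k
  -- The radial terms of the fibre part sum to a negative multiple of `a * b`, which the square of
  -- the height differential cancels exactly. Only `c ^ 2` matters, hence not the disc.
  have : (-4 * c / (1 + u) ^ 2 * a) * (-4 * c / (1 + u) ^ 2 * b) =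
      16 * r ^ 2 / (1 + u) ^ 4 * (a * b) := by
    rw [← hc]; field_simp
    ring
  rw [this]
  field_simp
  ring

end LocalBundleData

/-! ### Locality of the gradient and the Laplacian -/

section Congr

variable {E : Type*} [NormedAddCommGroup E] [NormedSpace ℝ E]

theorem gradientCoord_congr {G G' : E → E →L[ℝ] E →L[ℝ] ℝ} {f f' : E → ℝ} {y : E}
    (h : G =ᶠ[𝓝 y] G') (hf : f =ᶠ[𝓝 y] f') : gradientCoord G f y = gradientCoord G' f' y := by
  rw [gradientCoord, gradientCoord, h.self_of_nhds, hf.fderiv_eq]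

theorem laplacianCoord_congr {G G' : E → E →L[ℝ] E →L[ℝ] ℝ} {f f' : E → ℝ} {y : E}
    (h : G =ᶠ[𝓝 y] G') (hf : f =ᶠ[𝓝 y] f') : laplacianCoord G f y = laplacianCoord G' f' y := by
  rw [laplacianCoord, laplacianCoord, hessianCoord, hessianCoord, h.self_of_nhds,
    hf.fderiv.fderiv_eq, hf.fderiv_eq, (christoffel_congr h).self_of_nhds]

end Congr
end

noncomputable section

/-! ### The double in charts -/

section DoubleCharts

variable {EB : Type*} [NormedAddCommGroup EB] [NormedSpace ℝ EB]
  {B : Type*} [TopologicalSpace B] [ChartedSpace EB B]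
  {F : Type*} [NormedAddCommGroup F] [NormedSpace ℝ F]
  {V : B → Type*} [TopologicalSpace (TotalSpace F V)] [∀ x, NormedAddCommGroup (V x)]
  [∀ x, InnerProductSpace ℝ (V x)] [FiberBundle F V] [VectorBundle ℝ F V]
  [IsContMDiffRiemannianBundle 𝓘(ℝ, EB) ∞ F V] [IsManifold 𝓘(ℝ, EB) ∞ B]

/-- The inverses of the charts of the double. -/
theorem Double.exists_symm_eq_fold {ψ : OpenPartialHomeomorph (Double F V) (ModelProd EB F)}
    (hψ : ψ ∈ atlas (ModelProd EB F) (Double F V)) :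
    ∃ s, ∃ c ∈ atlas EB B, ∃ (e : Bundle.Trivialization F (TotalSpace.proj : TotalSpace F V → B))
      (_ : MemTrivializationAtlas e),
      (ψ.extend (𝓘(ℝ, EB).prod 𝓘(ℝ, F))).target = {z | z.1 ∈ bundleChartDomain c e} ∧
      ∀ z : EB × F, z.1 ∈ bundleChartDomain c e →
        (ψ.extend (𝓘(ℝ, EB).prod 𝓘(ℝ, F))).symm z = Double.fold s (bundlePoint c e z) := by
  obtain ⟨s, c', hc', rfl⟩ := hψ
  obtain ⟨c, hc, e, he, ht, hsymm⟩ := exists_bundlePoint_eq_symm hc'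
  refine ⟨s, c, hc, e, he, ?_, fun z hz ↦ ?_⟩
  · rw [extend_prod_target, OpenPartialHomeomorph.trans_target]
    exact (inter_eq_left.2 fun z _ ↦ trivial).trans ht
  · exact congrArg (Double.fold s) (hsymm z hz)

variable [ContMDiffVectorBundle ∞ F V 𝓘(ℝ, EB)]

theorem Double.contMDiff_toSphere (r : ℝ) :
    ContMDiff (𝓘(ℝ, EB).prod 𝓘(ℝ, F)) ((𝓘(ℝ, EB).prod 𝓘(ℝ, F)).prod 𝓘(ℝ, ℝ)) ∞
      (Double.toSphere r : Double F V → TotalSpace F V × ℝ) := by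
  intro x
  set ψ := chartAt (ModelProd EB F) x with hψ
  have hψa : ψ ∈ atlas (ModelProd EB F) (Double F V) := chart_mem_atlas _ x
  have hx : x ∈ ψ.source := mem_chart_source _ x
  have hx' : x ∈ (ψ.extend (𝓘(ℝ, EB).prod 𝓘(ℝ, F))).source := by simpa using hx
  obtain ⟨s, c, hc, e, he, ht, hsymm⟩ := Double.exists_symm_eq_fold hψa
  have hK : ContMDiff (𝓘(ℝ, EB).prod 𝓘(ℝ, F)) ((𝓘(ℝ, EB).prod 𝓘(ℝ, F)).prod 𝓘(ℝ, ℝ)) ∞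
      (fun v : TotalSpace F V ↦ Double.toSphere r (Double.fold s v)) := by
    intro v
    have hN : ContMDiffAt (𝓘(ℝ, EB).prod 𝓘(ℝ, F)) 𝓘(ℝ, ℝ) ∞
      (fun v : TotalSpace F V ↦ ‖v.2‖ ^ 2) v := (contMDiff_fiberNormSq EB F V).contMDiffAt
    have hp : 1 + ‖v.2‖ ^ 2 ≠ 0 := by positivity
    have h1 : ContDiffAt ℝ ∞ (fun u : ℝ ↦ 2 * r / (1 + u)) (‖v.2‖ ^ 2) :=
      contDiffAt_const.div (contDiffAt_const.add contDiffAt_id) hp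
    have h2 : ContDiffAt ℝ ∞ (fun u : ℝ ↦ Double.sign s * (r * ((1 - u) / (1 + u))))
        (‖v.2‖ ^ 2) :=
      contDiffAt_const.mul (contDiffAt_const.mul ((contDiffAt_const.sub contDiffAt_id).div
        (contDiffAt_const.add contDiffAt_id) hp))
    have h3 := (contMDiffAt_fiberSMul (EB := EB) (F := F) (V := V)
      (h1.contMDiffAt.comp v hN)).prodMk (h2.contMDiffAt.comp v hN)
    exact h3.congr_of_eventuallyEq (Filter.Eventually.of_forall fun w ↦ Double.toSphere_fold r s w)
  have hz := (ψ.extend (𝓘(ℝ, EB).prod 𝓘(ℝ, F))).map_source hx'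
  rw [ht] at hz
  have hT := (hK _).comp _ (contMDiffAt_bundlePoint hc hz)
  refine (hT.comp x (contMDiffAt_extend_of_mem hψa hx)).congr_of_eventuallyEq ?_
  filter_upwards [ψ.open_source.mem_nhds hx] with y hy
  have hy' : y ∈ (ψ.extend (𝓘(ℝ, EB).prod 𝓘(ℝ, F))).source := by simpa using hy
  have hzy := (ψ.extend (𝓘(ℝ, EB).prod 𝓘(ℝ, F))).map_source hy'
  rw [ht] at hzy
  have := hsymm _ hzy
  rw [(ψ.extend (𝓘(ℝ, EB).prod 𝓘(ℝ, F))).left_inv hy'] at this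
  exact congrArg (Double.toSphere r) this

theorem Double.contMDiff_fst_toSphere (r : ℝ) :
    ContMDiff (𝓘(ℝ, EB).prod 𝓘(ℝ, F)) (𝓘(ℝ, EB).prod 𝓘(ℝ, F)) ∞
      (fun x : Double F V ↦ (Double.toSphere r x).1) :=
  contMDiff_fst.comp (Double.contMDiff_toSphere r)

theorem Double.contMDiff_snd_toSphere (r : ℝ) :
    ContMDiff (𝓘(ℝ, EB).prod 𝓘(ℝ, F)) 𝓘(ℝ, ℝ) ∞
      (fun x : Double F V ↦ (Double.toSphere r x).2) :=
  contMDiff_snd.comp (Double.contMDiff_toSphere r)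

variable [FiniteDimensional ℝ F] (gM : SmoothMetric 𝓘(ℝ, EB) B)
  (cov : CovariantDerivative 𝓘(ℝ, EB) F V)

/-- The differential of the fibre coordinate in the total space. -/
def Double.dfst (r : ℝ) (x : Double F V) : TangentSpace (𝓘(ℝ, EB).prod 𝓘(ℝ, F)) x →L[ℝ]
    TangentSpace (𝓘(ℝ, EB).prod 𝓘(ℝ, F)) (Double.toSphere r x).1 :=
  mfderiv (𝓘(ℝ, EB).prod 𝓘(ℝ, F)) (𝓘(ℝ, EB).prod 𝓘(ℝ, F))
    (fun x : Double F V ↦ (Double.toSphere r x).1) x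

/-- The differential of the height. -/
def Double.dsnd (r : ℝ) (x : Double F V) : TangentSpace (𝓘(ℝ, EB).prod 𝓘(ℝ, F)) x →L[ℝ] ℝ :=
  mfderiv (𝓘(ℝ, EB).prod 𝓘(ℝ, F)) 𝓘(ℝ, ℝ) (fun x : Double F V ↦ (Double.toSphere r x).2) x

/-- The scalar products induced on the double by `Double.toSphere r`. -/
def Double.sphereForm (r : ℝ) (x : Double F V) :
    TangentSpace (𝓘(ℝ, EB).prod 𝓘(ℝ, F)) x →L[ℝ]
      TangentSpace (𝓘(ℝ, EB).prod 𝓘(ℝ, F)) x →L[ℝ] ℝ :=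
  pullbackForm (connectionMetricForm gM cov (Double.toSphere r x).1) (Double.dfst r x) +
    pullbackForm (ContinuousLinearMap.mul ℝ ℝ) (Double.dsnd r x)

theorem Double.sphereForm_apply (r : ℝ) (x : Double F V)
    (Y Y' : TangentSpace (𝓘(ℝ, EB).prod 𝓘(ℝ, F)) x) :
    Double.sphereForm gM cov r x Y Y' =
      connectionMetricForm gM cov (Double.toSphere r x).1 (Double.dfst r x Y)
        (Double.dfst r x Y') + Double.dsnd r x Y * Double.dsnd r x Y' := rfl

/-- Tangent vectors at `v` and `v'` are compared in the model space, which avoids transport along `v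
= v'`. -/
theorem connectionMetricForm_congr {v v' : TotalSpace F V} (h : v = v') {Z W Z' W' : EB × F}
    (hZ : Z = Z') (hW : W = W') :
    connectionMetricForm gM cov v Z W = connectionMetricForm gM cov v' Z' W' := by
  subst h hZ hW
  rfl

variable {cov} [FiniteDimensional ℝ EB]

/-- The height and the induced metric in the charts of the double. -/
theorem Double.exists_localBundleData (hs : cov.PreservesSmoothAt) (hm : cov.IsMetricCompatible)
    {ψ : OpenPartialHomeomorph (Double F V) (ModelProd EB F)}
    (hψ : ψ ∈ atlas (ModelProd EB F) (Double F V)) :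
    ∃ (d : LocalBundleData EB F) (σ : ℝ), σ ^ 2 = 1 ∧
      (ψ.extend (𝓘(ℝ, EB).prod 𝓘(ℝ, F))).target = {z | z.1 ∈ d.U} ∧
      (∃ c ∈ atlas EB B, d.U ⊆ (c.extend 𝓘(ℝ, EB)).target ∧ d.g = metricInChart gM c) ∧
      ∀ (r : ℝ) (z : EB × F), z.1 ∈ d.U →
        (Double.toSphere r ((ψ.extend (𝓘(ℝ, EB).prod 𝓘(ℝ, F))).symm z)).2 = d.height (σ * r) z ∧
        ∀ Z W : EB × F, Double.sphereForm gM cov r ((ψ.extend (𝓘(ℝ, EB).prod 𝓘(ℝ, F))).symm z)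
          (mfderiv 𝓘(ℝ, EB × F) (𝓘(ℝ, EB).prod 𝓘(ℝ, F))
            (ψ.extend (𝓘(ℝ, EB).prod 𝓘(ℝ, F))).symm z Z)
          (mfderiv 𝓘(ℝ, EB × F) (𝓘(ℝ, EB).prod 𝓘(ℝ, F))
            (ψ.extend (𝓘(ℝ, EB).prod 𝓘(ℝ, F))).symm z W) = d.sphereMetric (r ^ 2) z Z W := by
  obtain ⟨s, c, hc, e, he, ht, hsymm⟩ := Double.exists_symm_eq_fold hψ
  set d := localBundleData e gM hs hm hc with hd
  have hN (z : EB × F) : ‖(bundlePoint c e z).2‖ ^ 2 = d.normSq z := by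
    rw [← real_inner_self_eq_norm_sq]
    exact (fibreForm_apply _ _).symm
  -- In these coordinates `Double.toSphere r` is the local stereographic formula; the sign of the
  -- disc is absorbed into the height parameter.
  have hsph (r : ℝ) (z : EB × F) (hz : z.1 ∈ bundleChartDomain c e) :
      Double.toSphere r ((ψ.extend (𝓘(ℝ, EB).prod 𝓘(ℝ, F))).symm z) =
        (bundlePoint c e (d.stereo r z), d.height (Double.sign s * r) z) := by
    rw [hsymm z hz, Double.toSphere_fold, hN]
    refine Prod.ext ?_ (mul_assoc _ _ _).symm
    exact congrArg (TotalSpace.mk _) (map_smul (e.symmL ℝ _) _ _).symm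
  have hσ : Double.sign s ^ 2 = 1 := by rw [sq, Double.sign_mul_self]
  refine ⟨d, Double.sign s, hσ, ht, ⟨c, hc, fun x hx ↦ hx.1, rfl⟩, fun r z hz ↦ ?_⟩
  have hev : ∀ᶠ w : EB × F in 𝓝 z, Double.toSphere r ((ψ.extend (𝓘(ℝ, EB).prod 𝓘(ℝ, F))).symm w) =
        (bundlePoint c e (d.stereo r w), d.height (Double.sign s * r) w) := by
    filter_upwards [d.isOpen_domain.mem_nhds hz] with w hw
    exact hsph r w hw
  refine ⟨by rw [hsph r z hz], fun Z W ↦ ?_⟩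
  have hzt : z ∈ (ψ.extend (𝓘(ℝ, EB).prod 𝓘(ℝ, F))).target := by rw [ht]; exact hz
  have hsd := (contMDiffAt_extend_symm hψ hzt).mdifferentiableAt (by simp)
  have h1 (Z : EB × F) : (Double.dfst r ((ψ.extend (𝓘(ℝ, EB).prod 𝓘(ℝ, F))).symm z)
      (mfderiv 𝓘(ℝ, EB × F) (𝓘(ℝ, EB).prod 𝓘(ℝ, F))
        (ψ.extend (𝓘(ℝ, EB).prod 𝓘(ℝ, F))).symm z Z) : EB × F) =
      mfderiv 𝓘(ℝ, EB × F) (𝓘(ℝ, EB).prod 𝓘(ℝ, F)) (bundlePoint c e) (d.stereo r z)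
        (fderiv ℝ (d.stereo r) z Z) := by
    have e1 := mfderiv_comp_apply_of_base_eq rfl
      (((Double.contMDiff_fst_toSphere (V := V) (EB := EB) r).contMDiffAt
        (x := (ψ.extend (𝓘(ℝ, EB).prod 𝓘(ℝ, F))).symm z)).mdifferentiableAt (by simp)) hsd Z
    refine e1.symm.trans ?_
    have e2 : (fun x : Double F V ↦ (Double.toSphere r x).1) ∘
        (ψ.extend (𝓘(ℝ, EB).prod 𝓘(ℝ, F))).symm =ᶠ[𝓝 z] bundlePoint c e ∘ d.stereo r :=
      hev.mono fun w hw ↦ congrArg Prod.fst hw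
    rw [e2.mfderiv_eq]
    refine (mfderiv_comp_apply_of_base_eq (I := 𝓘(ℝ, EB × F)) (I' := 𝓘(ℝ, EB × F)) rfl
      ((contMDiffAt_bundlePoint hc (show (d.stereo r z).1 ∈ _ from hz)).mdifferentiableAt (by simp))
      ((LocalBundleData.contDiffAt_stereo r hz).differentiableAt
        (by simp)).mdifferentiableAt Z).trans ?_
    rw [mfderiv_eq_fderiv]
    rfl
  have h2 (Z : EB × F) : Double.dsnd r ((ψ.extend (𝓘(ℝ, EB).prod 𝓘(ℝ, F))).symm z)
      (mfderiv 𝓘(ℝ, EB × F) (𝓘(ℝ, EB).prod 𝓘(ℝ, F))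
        (ψ.extend (𝓘(ℝ, EB).prod 𝓘(ℝ, F))).symm z Z) =
      fderiv ℝ (d.height (Double.sign s * r)) z Z := by
    have e1 := mfderiv_comp_apply_of_base_eq rfl
      (((Double.contMDiff_snd_toSphere (V := V) (EB := EB) r).contMDiffAt
        (x := (ψ.extend (𝓘(ℝ, EB).prod 𝓘(ℝ, F))).symm z)).mdifferentiableAt (by simp)) hsd Z
    refine e1.symm.trans ?_
    have e2 : (fun x : Double F V ↦ (Double.toSphere r x).2) ∘
        (ψ.extend (𝓘(ℝ, EB).prod 𝓘(ℝ, F))).symm =ᶠ[𝓝 z] d.height (Double.sign s * r) :=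
      hev.mono fun w hw ↦ congrArg Prod.snd hw
    rw [e2.mfderiv_eq, mfderiv_eq_fderiv]
    rfl
  rw [Double.sphereForm_apply, h2, h2]
  rw [connectionMetricForm_congr gM cov (congrArg Prod.fst (hsph r z hz)) (h1 Z) (h1 W)]
  rw [connectionMetricForm_mfderiv_bundlePoint gM hs hm hc (show (d.stereo r z).1 ∈ _ from hz)]
  rw [← LocalBundleData.sphereMetric_eq_pullback (c := Double.sign s * r)
    (by rw [mul_pow, hσ, one_mul]) hz, LocalBundleData.fderiv_stereo r hz,
    LocalBundleData.fderiv_stereo r hz]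
  rfl

end DoubleCharts
end

noncomputable section

/-! ### The induced metric of the double -/

section DoubleMetric

variable {EB : Type*} [NormedAddCommGroup EB] [NormedSpace ℝ EB] [FiniteDimensional ℝ EB]
  {B : Type*} [TopologicalSpace B] [ChartedSpace EB B] [IsManifold 𝓘(ℝ, EB) ∞ B]
  {F : Type*} [NormedAddCommGroup F] [NormedSpace ℝ F] [FiniteDimensional ℝ F]
  {V : B → Type*} [TopologicalSpace (TotalSpace F V)] [∀ x, NormedAddCommGroup (V x)]
  [∀ x, InnerProductSpace ℝ (V x)] [FiberBundle F V] [VectorBundle ℝ F V]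
  [ContMDiffVectorBundle ∞ F V 𝓘(ℝ, EB)] [IsContMDiffRiemannianBundle 𝓘(ℝ, EB) ∞ F V]
  (gM : SmoothMetric 𝓘(ℝ, EB) B) {cov : CovariantDerivative 𝓘(ℝ, EB) F V}

/-- The Riemannian metric induced on the double by `Double.toSphere r`. -/
def Double.metric (hs : cov.PreservesSmoothAt) (hm : cov.IsMetricCompatible) {r : ℝ} (hr : 0 < r) :
    SmoothMetric (𝓘(ℝ, EB).prod 𝓘(ℝ, F)) (Double F V) :=
  SmoothMetric.ofCharts (E := EB × F) (Double.sphereForm gM cov r)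
    (fun x Y Y' ↦ by
      rw [Double.sphereForm_apply, Double.sphereForm_apply,
        mul_comm (Double.dsnd r x Y)]
      exact congrArg (· + _) ((connectionMetric gM hs hm).symm _ _ _))
    (pos_of_charts (E := EB × F) _ fun x z hz Z hZ ↦ by
      obtain ⟨d, σ, -, ht, -, h⟩ := Double.exists_localBundleData gM hs hm
        (chart_mem_atlas (ModelProd EB F) x)
      have hz' : z.1 ∈ d.U := by rw [ht] at hz; exact hz
      rw [(h r z hz').2]
      exact (LocalBundleData.isMetricForm_sphereMetric (by positivity) hz').pos Z hZ)
    (fun x z hz Z W ↦ by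
      obtain ⟨d, σ, -, ht, -, h⟩ := Double.exists_localBundleData gM hs hm
        (chart_mem_atlas (ModelProd EB F) x)
      have hz' : z.1 ∈ d.U := by rw [ht] at hz; exact hz
      refine (((LocalBundleData.contDiffAt_sphereMetric (r ^ 2) hz').clm_apply
        contDiffAt_const).clm_apply contDiffAt_const).congr_of_eventuallyEq (f := fun w ↦
          d.sphereMetric (r ^ 2) w Z W) ?_
      filter_upwards [d.isOpen_domain.mem_nhds hz'] with w hw
      exact (h r w hw).2 Z W)

variable (hs : cov.PreservesSmoothAt) (hm : cov.IsMetricCompatible)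

theorem Double.isInducedBySphere_metric {r : ℝ} (hr : 0 < r) :
    IsInducedBySphere (connectionMetric gM hs hm) r (Double.metric gM hs hm hr) :=
  fun _ _ _ ↦ rfl

/-- The height and the metric in the charts of the double, in terms of local data which do not
depend on the radius. -/
theorem Double.exists_metricInChart_eq
    {ψ : OpenPartialHomeomorph (Double F V) (ModelProd EB F)}
    (hψ : ψ ∈ atlas (ModelProd EB F) (Double F V)) :
    ∃ (d : LocalBundleData EB F) (σ : ℝ), σ ^ 2 = 1 ∧
      (ψ.extend (𝓘(ℝ, EB).prod 𝓘(ℝ, F))).target = {z | z.1 ∈ d.U} ∧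
      (∃ c ∈ atlas EB B, d.U ⊆ (c.extend 𝓘(ℝ, EB)).target ∧ d.g = metricInChart gM c) ∧
      ∀ (r : ℝ) (hr : 0 < r) (z : EB × F), z.1 ∈ d.U →
        (fun x ↦ (Double.toSphere r x).2) ∘ (ψ.extend (𝓘(ℝ, EB).prod 𝓘(ℝ, F))).symm =ᶠ[𝓝 z]
          d.height (σ * r) ∧
        metricInChart (Double.metric gM hs hm hr) ψ =ᶠ[𝓝 z] d.sphereMetric (r ^ 2) := by
  obtain ⟨d, σ, hσ, ht, hc, h⟩ := Double.exists_localBundleData gM hs hm hψ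
  refine ⟨d, σ, hσ, ht, hc, fun r hr z hz ↦ ⟨?_, ?_⟩⟩
  · filter_upwards [d.isOpen_domain.mem_nhds hz] with w hw
    exact (h r w hw).1
  · filter_upwards [d.isOpen_domain.mem_nhds hz] with w hw
    refine ContinuousLinearMap.ext fun Z ↦ ContinuousLinearMap.ext fun W ↦ ?_
    exact (h r w hw).2 Z W

/-- The functions are `b(t) = 1 - t²/r²` and `a(t) = -n t/r²`, as for the height on a round sphere
of radius `r`. -/
theorem Double.isIsoparametric_snd_toSphere [Nonempty B] {r : ℝ} (hr : 0 < r) :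
    IsIsoparametric (Double.metric gM hs hm hr) (fun x ↦ (Double.toSphere r x).2) := by
  refine ⟨Double.contMDiff_snd_toSphere r, ?_, ⟨fun t ↦ 1 - t ^ 2 / r ^ 2, by fun_prop, ?_⟩,
    ⟨fun t ↦ -(Module.finrank ℝ F) / r ^ 2 * t, ?_⟩⟩
  · obtain ⟨p⟩ := ‹Nonempty B›
    -- The two poles of the sphere over `p`, with heights `r` and `-r`.
    refine ⟨Double.fold true ⟨p, 0⟩, Double.fold false ⟨p, 0⟩, ?_⟩
    beta_reduce
    rw [Double.toSphere_fold, Double.toSphere_fold]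
    simp only [Double.sign, norm_zero]
    norm_num
    linarith
  all_goals
    intro ψ hψ z hz
    obtain ⟨d, σ, hσ, ht, -, h⟩ := Double.exists_metricInChart_eq gM hs hm hψ
    have hz' : z.1 ∈ d.U := by rw [ht] at hz; exact hz
    obtain ⟨h1, h2⟩ := h r hr z hz'
    have hc : σ * r ≠ 0 := mul_ne_zero (by rintro rfl; norm_num at hσ) hr.ne'
    have hc2 : (σ * r) ^ 2 = r ^ 2 := by rw [mul_pow, hσ, one_mul]
    have h3 : (Double.toSphere r ((ψ.extend (𝓘(ℝ, EB).prod 𝓘(ℝ, F))).symm z)).2 =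
      d.height (σ * r) z := h1.self_of_nhds
    rw [← hc2] at h2
    beta_reduce
  · rw [h3, gradientCoord_congr h2 h1, h2.self_of_nhds,
      LocalBundleData.normSq_gradientCoord_height hc hz', hc2]
  · rw [h3, laplacianCoord_congr h2 h1, LocalBundleData.laplacianCoord_height hc hz', hc2]

/-- A continuous injection of a compact space into a Hausdorff space is an embedding. The
differential is injective because a vector in its kernel would have length zero for the induced
metric, which is positive definite. -/
theorem Double.isSphereDiffeo [T2Space B] [CompactSpace B] {r : ℝ} (hr : 0 < r)
    (g : SmoothMetric (𝓘(ℝ, EB).prod 𝓘(ℝ, F)) (Double F V))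
    {h : SmoothMetric (𝓘(ℝ, EB).prod 𝓘(ℝ, F)) (TotalSpace F V)} (hg : IsInducedBySphere h r g) :
    IsSphereDiffeo EB F V r := by
  have hsm := Double.contMDiff_toSphere (EB := EB) (F := F) (V := V) r
  refine ⟨hsm, ?_, fun x ↦ ?_, Double.range_toSphere hr⟩
  · have := Double.compactSpace EB F V
    have : T2Space (TotalSpace F V) := t2Space_totalSpace
    exact (hsm.continuous.isClosedEmbedding (Double.injective_toSphere EB hr)).isEmbedding
  · have h1 := ((Double.contMDiff_fst_toSphere (EB := EB) (F := F) (V := V) r).contMDiffAt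
      (x := x)).mdifferentiableAt (by simp)
    have h2 := ((Double.contMDiff_snd_toSphere (EB := EB) (F := F) (V := V) r).contMDiffAt
      (x := x)).mdifferentiableAt (by simp)
    have hp := mfderiv_prodMk h1 h2
    refine (injective_iff_map_eq_zero _).2 fun Y hY ↦ ?_
    by_contra hY0
    have hpos := g.pos x Y hY0
    have hY' : (Double.dfst (EB := EB) r x).prod (Double.dsnd r x) Y = 0 :=
      (congrArg (fun L : EB × F →L[ℝ] (EB × F) × ℝ ↦ L Y) hp).symm.trans hY
    have hY1 : Double.dfst (EB := EB) r x Y = 0 := congrArg Prod.fst hY'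
    have hY2 : Double.dsnd (EB := EB) r x Y = 0 := congrArg Prod.snd hY'
    have he : g.inner x Y Y = h.inner (Double.toSphere r x).1 (Double.dfst r x Y)
      (Double.dfst r x Y) + Double.dsnd r x Y * Double.dsnd r x Y := hg x Y Y
    rw [he, hY1, hY2] at hpos
    simp at hpos

/-- The local data do not involve the radius, so each point has a bound for `r ^ 2` valid on a
neighbourhood; compactness of the double makes it uniform. -/
theorem Double.exists_hasPosRicci_metric [T2Space B] [CompactSpace B]
    (hn : 2 ≤ Module.finrank ℝ F) (hM : HasPosRicci gM) :
    ∃ r₀ : ℝ, 0 < r₀ ∧ ∀ (r : ℝ) (hr : 0 < r), r < r₀ →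
      HasPosRicci (Double.metric gM hs hm hr) := by
  -- The estimate is made in the preferred chart at `x` and carried by naturality to every chart `ψ`
  -- around `x'`, so that no uniformity over the atlas is needed.
  have hloc (x : Double F V) : ∃ δ : ℝ, 0 < δ ∧ ∃ S ∈ 𝓝 x, ∀ x' ∈ S, ∀ (r : ℝ) (hr : 0 < r),
      r ^ 2 < δ → ∀ ψ ∈ atlas (ModelProd EB F) (Double F V), x' ∈ ψ.source → ∀ v : EB × F, v ≠ 0 →
        0 < ricciCoord (metricInChart (Double.metric gM hs hm hr) ψ)
          (ψ.extend (𝓘(ℝ, EB).prod 𝓘(ℝ, F)) x') v v := by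
    obtain ⟨d, σ, -, ht, ⟨c, hc, hcU, hcg⟩, h⟩ := Double.exists_metricInChart_eq gM hs hm
      (chart_mem_atlas (ModelProd EB F) x)
    set φ := chartAt (ModelProd EB F) x with hφ
    have hmem {x' : Double F V} (hx' : x' ∈ φ.source) :
        (φ.extend (𝓘(ℝ, EB).prod 𝓘(ℝ, F)) x').1 ∈ d.U := by
      have := (φ.extend (𝓘(ℝ, EB).prod 𝓘(ℝ, F))).map_source (by simpa using hx')
      rw [ht] at this
      exact this
    have hx : x ∈ φ.source := mem_chart_source _ x
    obtain ⟨δ, hδ, hev⟩ := LocalBundleData.exists_ricciCoord_sphereMetric_pos hn (hmem hx)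
      (fun X hX ↦ by rw [hcg]; exact hM c hc _ (hcU (hmem hx)) X hX)
    have hcont : ContinuousAt (φ.extend (𝓘(ℝ, EB).prod 𝓘(ℝ, F))) x :=
      (contMDiffAt_extend_of_mem (chart_mem_atlas (ModelProd EB F) x) hx).continuousAt
    refine ⟨δ, hδ, _, Filter.inter_mem (hcont.eventually hev) (φ.open_source.mem_nhds hx), ?_⟩
    rintro x' ⟨hx1, hx2⟩ r hr hrδ ψ hψ hx3 v hv
    refine ricciCoord_metricInChart_pos _ (chart_mem_atlas (ModelProd EB F) x) hψ hx2 hx3 ?_ v hv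
    intro w hw
    rw [ricciCoord_congr (h r hr _ (hmem hx2)).2]
    exact hx1 (r ^ 2) (by positivity) hrδ w hw
  choose δ hδ S hS hSp using hloc
  have := Double.compactSpace EB F V
  obtain ⟨J, hJ⟩ := CompactSpace.elim_nhds_subcover S hS
  obtain ⟨η, hη, hηJ⟩ : ∃ η : ℝ, 0 < η ∧ ∀ x ∈ J, η ≤ δ x := by
    rcases J.eq_empty_or_nonempty with rfl | hne
    · exact ⟨1, one_pos, by simp⟩
    · obtain ⟨x, -, hx⟩ := J.exists_min_image δ hne
      exact ⟨δ x, hδ x, hx⟩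
  -- The bound `η` concerns `ε = r ^ 2`, hence the square root.
  refine ⟨√η, Real.sqrt_pos.2 hη, fun r hr hrη ψ hψ z hz v hv ↦ ?_⟩
  have hr2 : r ^ 2 < η := (Real.lt_sqrt hr.le).1 hrη
  have hx : (ψ.extend (𝓘(ℝ, EB).prod 𝓘(ℝ, F))).symm z ∈ ⋃ x ∈ J, S x := by rw [hJ]; trivial
  simp only [mem_iUnion, exists_prop] at hx
  obtain ⟨x, hxJ, hxS⟩ := hx
  have key := hSp x _ hxS r hr (hr2.trans_le (hηJ x hxJ)) ψ hψ (extend_symm_mem_source hz) v hv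
  rwa [(ψ.extend (𝓘(ℝ, EB).prod 𝓘(ℝ, F))).right_inv hz] at key

end DoubleMetric
end

/-! ### The theorem on the double manifold -/

theorem theorem1p3 {m n : ℕ} (hn : 2 ≤ n)
    {M : Type*} [TopologicalSpace M] [T2Space M] [CompactSpace M] [Nonempty M]
    [ChartedSpace (EuclideanSpace ℝ (Fin m)) M] [IsManifold (𝓡 m) ∞ M]
    {V : M → Type*} [TopologicalSpace (TotalSpace (EuclideanSpace ℝ (Fin n)) V)]
    [∀ x, NormedAddCommGroup (V x)] [∀ x, InnerProductSpace ℝ (V x)]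
    [FiberBundle (EuclideanSpace ℝ (Fin n)) V] [VectorBundle ℝ (EuclideanSpace ℝ (Fin n)) V]
    [ContMDiffVectorBundle ∞ (EuclideanSpace ℝ (Fin n)) V (𝓡 m)]
    [IsContMDiffRiemannianBundle (𝓡 m) ∞ (EuclideanSpace ℝ (Fin n)) V]
    (gM : SmoothMetric (𝓡 m) M) (hM : HasPosRicci gM) :
    ∃ (cov : CovariantDerivative (𝓡 m) (EuclideanSpace ℝ (Fin n)) V)
      (h : SmoothMetric ((𝓡 m).prod (𝓡 n)) (TotalSpace (EuclideanSpace ℝ (Fin n)) V)),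
      cov.ContMDiffCovariantDerivative ∞ ∧ cov.IsMetricCompatible ∧ IsConnectionMetric gM cov h ∧
      ∃ r₀ : ℝ, 0 < r₀ ∧ ∀ r : ℝ, 0 < r → r < r₀ →
        IsSphereDiffeo (EuclideanSpace ℝ (Fin m)) (EuclideanSpace ℝ (Fin n)) V r ∧
        ∃ g : SmoothMetric ((𝓡 m).prod (𝓡 n)) (Double (EuclideanSpace ℝ (Fin n)) V),
          IsInducedBySphere h r g ∧ HasPosRicci g ∧
          IsIsoparametric g (fun x ↦ (Double.toSphere r x).2) := by
  obtain ⟨cov, hm, hs'⟩ := exists_metricConnection (EB := EuclideanSpace ℝ (Fin m))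
    (F := EuclideanSpace ℝ (Fin n)) (V := V)
  have hs : cov.PreservesSmoothAt := hs'
  obtain ⟨r₀, hr₀, hric⟩ := Double.exists_hasPosRicci_metric gM hs hm (by simpa using hn) hM
  refine ⟨cov, connectionMetric gM hs hm, hs.contMDiffCovariantDerivative, hm,
    isConnectionMetric_connectionMetric gM hs hm, r₀, hr₀, fun r hr hrr ↦ ?_⟩
  have hind := Double.isInducedBySphere_metric gM hs hm hr
  exact ⟨Double.isSphereDiffeo hr _ hind, Double.metric gM hs hm hr, hind, hric r hr hrr,
    Double.isIsoparametric_snd_toSphere gM hs hm hr⟩
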